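/- Let $a>-1$ be real. For integers $N,k,l\ge 0$, $\lambda_1,\dots,\lambda_l\in\mathbb C$ and $\kappa_1,\dots,\kappa_k\in\mathbb C\setminus[0,\infty)$ let $$Z^{(N)}_{k|l}(\kappa,\lambda)=\frac1{N!}\int_{(0,\infty)^N}\prod_{1\le i<j\le N}\frac{(z_j-z_i)^2}{z_i+z_j}\prod_{j=1}^N z_j^a e^{-z_j}\frac{\prod_{i=1}^l(z_j-\lambda_i)}{\prod_{i=1}^k(z_j-\kappa_i)}\,dz$$ be the partition functions of the Bures ensemble with weight $z^ae^{-z}$ (so $Z^{(0)}_{k|l}=1$). The kernels of its Pfaffian representation are the ratios on the left-hand sides below. Let $$G^{m,n}_{p,q}\Big(\begin{matrix}a_1,\dots,a_n;a_{n+1},\dots,a_p\\ b_1,\dots,b_m;b_{m+1},\dots,b_q\end{matrix}\Big|z\Big)=\int_C\frac{ds}{2\pi i}\,\frac{z^s\prod_{j=1}^m\Gamma(b_j-s)\prod_{j=1}^n\Gamma(1-a_j+s)}{\prod_{j=m+1}^q\Gamma(1-b_j+s)\prod_{j=n+1}^p\Gamma(a_j-s)}$$ be the Meijer G-function, where $C$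 is an upward vertical line which has the poles of the $\Gamma(b_j-s)$ on its right and the poles of the $\Gamma(1-a_j+s)$ on its left if $p+q<2(m+n)$, and otherwise (with $p<q$) such a line with both ends bent to $+\infty$, so that it is a loop around the poles of the $\Gamma(b_j-s)$; the value at $z=0$ is the limit. All complex powers are principal. For an integer $M\ge0$ and $t>0$ put $$P(x)=G^{1,1}_{2,3}\Big(\begin{matrix}-2a-M-1;M\\0;-a,-2a-1\end{matrix}\Big|x\Big),\quad Q(x)=G^{1,1}_{2,3}\Big(\begin{matrix}-2a-M-1;M\\0;-a-1,-2a-1\end{matrix}\Big|x\Big),$$ $$R(x)=G^{3,1}_{2,3}\Big(\begin{matrix}-M;M+2a+1\\0,a,2a+1\end{matrix}\Big|x\Big),\quad S(x)=G^{3,1}_{2,3}\Big(\begin{matrix}-M;M+2a+1\\0,a+1,2a+1\end{matrix}\Big|x\Big),$$ $$U_M(x)=G^{3,1}_{2,3}\Big(\begin{matrix}-M-a;M+a+1\\0,-a,a+1\end{matrix}\Big|x\Big),\quad V_M(x)=G^{3,1}_{2,3}\Big(\begin{matrix}-M-a-1;M+a\\0,-a-1,a\end{matrix}\Big|x\Big),$$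 $$A_M(t)=\kappa_2\,U_M(-t\kappa_1)V_M(-t\kappa_2)-\kappa_1\,U_M(-t\kappa_2)V_M(-t\kappa_1).$$ Then for all $\lambda,\lambda_1,\lambda_2\in\mathbb C$ and $\kappa,\kappa_1,\kappa_2\in\mathbb C\setminus[0,\infty)$ the following hold, and all the $t$-integrals converge absolutely. (a) If $M\ge2$, then $$(\lambda_1-\lambda_2)\frac{Z^{(M-2)}_{0|2}(\lambda_1,\lambda_2)}{Z^{(M)}_{0|0}}=-\frac14\int_0^1 t^{2a+1}\big[P(t\lambda_1)Q(t\lambda_2)-P(t\lambda_2)Q(t\lambda_1)\big]dt.$$ (b) If $\kappa\ne\lambda$, then $$\frac1{\kappa-\lambda}\frac{Z^{(M)}_{1|1}(\kappa,\lambda)}{Z^{(M)}_{0|0}}=\frac1{\kappa-\lambda}+\frac12\int_0^1\big[P(t\lambda)R(-t\kappa)+Q(t\lambda)S(-t\kappa)\big]dt.$$ (c) If $-1<a<0$, then $$(\kappa_1-\kappa_2)\frac{Z^{(M+2)}_{2|0}(\kappa_1,\kappa_2)}{Z^{(M)}_{0|0}}=\int_{(0,\infty)^2}\frac{(xy)^a(y-x)e^{-x-y}}{(\kappa_1-x)(\kappa_2-y)(x+y)}\,dx\,dy+(-\kappa_1)^a(-\kappa_2)^a\int_0^1\big[A_M(t)-A_0(t)\big]dt,$$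 and for every $a>-1$ $$(\kappa_1-\kappa_2)\frac{Z^{(M+2)}_{2|0}(\kappa_1,\kappa_2)}{Z^{(M)}_{0|0}}=-(-\kappa_1)^a(-\kappa_2)^a\int_1^\infty A_M(t)\,dt.$$ (d) If $M\ge1$, then $$\frac{Z^{(M-1)}_{0|1}(\lambda)}{Z^{(M+1)}_{0|0}}=\frac{2^{2(M+a)}\,\Gamma(M+a+\tfrac32)}{\sqrt\pi\,M!\,\Gamma(M+2a+2)}\,G^{1,1}_{2,3}\Big(\begin{matrix}-M-2a-1;M\\0;-2a-1,-a-1\end{matrix}\Big|\lambda\Big).$$ (e) $$\frac{Z^{(M+1)}_{1|0}(\kappa)}{Z^{(M+1)}_{0|0}}=\frac{\Gamma(2M+2a+2)}{M!\,\Gamma(M+a+1)\,\Gamma(M+2a+2)}\,G^{3,1}_{2,3}\Big(\begin{matrix}-M;M+2a+1\\0,a,2a+1\end{matrix}\Big|-\kappa\Big).$$ -/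

import Mathlib

open MeasureTheory Filter Topology Set

noncomputable section

/-- The partition function `Z_{k|l}^{(N,a)}(κ, lam)` of the Bures ensemble: the integral over
`(0, ∞)^N` of `(1 / N!) ∏_{i<j} (z_j - z_i)² / (z_i + z_j) ∏_j z_j^a e^{-z_j}`, times the
products of `z_j - lam_i` over the products of `z_j - κ_i`. -/
def buresZ (N : ℕ) (a : ℝ) {k l : ℕ} (κ : Fin k → ℂ) (lam : Fin l → ℂ) : ℂ :=
  (1 / (N.factorial : ℂ)) *
    ∫ z in Set.univ.pi (fun _ : Fin N => Ioi (0 : ℝ)),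
      (((∏ i : Fin N, ∏ j ∈ Finset.Ioi i, (z j - z i) ^ 2 / (z i + z j)) *
          ∏ j : Fin N, (z j ^ a * Real.exp (-z j)) : ℝ) : ℂ) *
        ∏ j : Fin N, ((∏ i : Fin l, ((z j : ℂ) - lam i)) / ∏ i : Fin k, ((z j : ℂ) - κ i))

/-- The integrand of the Mellin–Barnes integral defining the Meijer G-function. The upper
parameters `a_1, …, a_n` and `a_{n+1}, …, a_p` are `a₁` and `a₂`, the lower parameters
`b_1, …, b_m` and `b_{m+1}, …, b_q` are `b₁` and `b₂`. -/
def meijerIntegrand {n p' m q' : ℕ} (a₁ : Fin n → ℝ) (a₂ : Fin p' → ℝ)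
    (b₁ : Fin m → ℝ) (b₂ : Fin q' → ℝ) (z s : ℂ) : ℂ :=
  z ^ s * ((∏ j, Complex.Gamma (b₁ j - s)) * ∏ j, Complex.Gamma (1 - a₁ j + s)) /
    ((∏ j, Complex.Gamma (1 - b₂ j + s)) * ∏ j, Complex.Gamma (a₂ j - s))

/-- A real abscissa `c` such that the poles of all `Γ(b_j - s)`, `j ≤ m`, lie to the right and
the poles of all `Γ(1 - a_j + s)`, `j ≤ n`, lie to the left of the line `Re s = c`, if there is
one. The contour integrals below do not depend on which such `c` is taken. -/
def meijerAbscissa {n m : ℕ} (a₁ : Fin n → ℝ) (b₁ : Fin m → ℝ) : ℝ :=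
  Classical.epsilon fun c : ℝ => (∀ j, a₁ j - 1 < c) ∧ ∀ j, c < b₁ j

/-- `1 / (2πi)` times the integral of `f` along the vertical line from `c - i∞` to `c + i∞`. -/
def lineIntegral (c : ℝ) (f : ℂ → ℂ) : ℂ :=
  (1 / (2 * Real.pi : ℂ)) * ∫ y : ℝ, f (c + y * Complex.I)

/-- `1 / (2πi)` times the integral of `f` along the loop which comes in from `+∞ - i` along
`Im s = -1` to `c - i`, goes up to `c + i` and then out to `+∞ + i` along `Im s = 1`. -/
def loopIntegral (c : ℝ) (f : ℂ → ℂ) : ℂ :=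
  (1 / (2 * Real.pi * Complex.I : ℂ)) *
    (-(∫ x in Ioi c, f (x - Complex.I))
      + Complex.I * (∫ y in (-1 : ℝ)..1, f (c + y * Complex.I))
      + ∫ x in Ioi c, f (x + Complex.I))

/-- The Mellin–Barnes integral of the Meijer G-function (real parameters, principal branch of
`z ^ s`, `z ≠ 0`). With `p = n + p'` and `q = m + q'`: if `p + q < 2 (m + n)` the contour is the
vertical line (the integral converges for `|arg z| < (m + n - (p + q) / 2) π`); otherwise its two
ends are bent to the right, so that it is a loop around the poles of the `Γ(b_j - s)` (the
integral converges for `p < q`). -/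
def meijerIntegral {n p' m q' : ℕ} (a₁ : Fin n → ℝ) (a₂ : Fin p' → ℝ)
    (b₁ : Fin m → ℝ) (b₂ : Fin q' → ℝ) (z : ℂ) : ℂ :=
  if (n + p') + (m + q') < 2 * (m + n) then
    lineIntegral (meijerAbscissa a₁ b₁) (meijerIntegrand a₁ a₂ b₁ b₂ z)
  else
    loopIntegral (meijerAbscissa a₁ b₁) (meijerIntegrand a₁ a₂ b₁ b₂ z)

/-- The Meijer G-function `G^{m,n}_{p,q}`; its value at `z = 0` is the limit at `0`. -/
def meijerG {n p' m q' : ℕ} (a₁ : Fin n → ℝ) (a₂ : Fin p' → ℝ)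
    (b₁ : Fin m → ℝ) (b₂ : Fin q' → ℝ) (z : ℂ) : ℂ :=
  if z = 0 then limUnder (𝓝[≠] (0 : ℂ)) (meijerIntegral a₁ a₂ b₁ b₂)
  else meijerIntegral a₁ a₂ b₁ b₂ z

/-- `G^{1,1}_{2,3}(a₁; a₂ | b₁; b₂, b₃ | z)`. -/
def meijerG11 (a₁ a₂ b₁ b₂ b₃ : ℝ) (z : ℂ) : ℂ :=
  meijerG ![a₁] ![a₂] ![b₁] ![b₂, b₃] z

/-- `G^{3,1}_{2,3}(a₁; a₂ | b₁, b₂, b₃ | z)`. -/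
def meijerG31 (a₁ a₂ b₁ b₂ b₃ : ℝ) (z : ℂ) : ℂ :=
  meijerG ![a₁] ![a₂] ![b₁, b₂, b₃] ![] z

/-- The integrand of the kernel with two characteristic polynomials in the numerator. -/
def kernelIntegrand02 (M : ℕ) (a : ℝ) (lam₁ lam₂ : ℂ) (t : ℝ) : ℂ :=
  ((t ^ (2 * a + 1) : ℝ) : ℂ) *
    (meijerG11 (-2 * a - M - 1) M 0 (-a) (-2 * a - 1) (t * lam₁) *
        meijerG11 (-2 * a - M - 1) M 0 (-a - 1) (-2 * a - 1) (t * lam₂)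
      - meijerG11 (-2 * a - M - 1) M 0 (-a) (-2 * a - 1) (t * lam₂) *
        meijerG11 (-2 * a - M - 1) M 0 (-a - 1) (-2 * a - 1) (t * lam₁))

/-- The integrand of the kernel with one characteristic polynomial in the numerator and one in
the denominator. -/
def kernelIntegrand11 (M : ℕ) (a : ℝ) (κ lam : ℂ) (t : ℝ) : ℂ :=
  meijerG11 (-2 * a - M - 1) M 0 (-a) (-2 * a - 1) (t * lam) *
      meijerG31 (-M) (M + 2 * a + 1) 0 a (2 * a + 1) (-(t * κ))
    + meijerG11 (-2 * a - M - 1) M 0 (-a - 1) (-2 * a - 1) (t * lam) *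
      meijerG31 (-M) (M + 2 * a + 1) 0 (a + 1) (2 * a + 1) (-(t * κ))

/-- The integrand of the kernel with two characteristic polynomials in the denominator. -/
def kernelIntegrand20 (M : ℕ) (a : ℝ) (κ₁ κ₂ : ℂ) (t : ℝ) : ℂ :=
  κ₂ * meijerG31 (-M - a) (M + a + 1) 0 (-a) (a + 1) (-(t * κ₁)) *
      meijerG31 (-M - a - 1) (M + a) 0 (-a - 1) a (-(t * κ₂))
    - κ₁ * meijerG31 (-M - a) (M + a + 1) 0 (-a) (a + 1) (-(t * κ₂)) *
      meijerG31 (-M - a - 1) (M + a) 0 (-a - 1) a (-(t * κ₁))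

end

/-! The weight of the ensemble is a Vandermonde determinant times Schur's product `∏_{i<j} (z_j -
z_i)/(z_j + z_i)`. Multiplied by the ratio of characteristic polynomials, the Vandermonde
determinant becomes a combination of determinants of one-variable functions. Schur's product is
antisymmetric, so the `N!` terms of each determinant contribute equally, and every partition
function is a finite combination of integrals `schurIntegral f` of pure products `∏ f_i(z_i)`
against Schur's product (`buresZ_eq_sum_schurIntegral`).

The engine is `schurIntegral_gammaDensity`: against the densities `x^(α_i - 1) e^{-x}` Schur's
product reproduces itself, the integral being `∏ Γ(α_i) ∏_{i<j} (α_j - α_i)/(α_j + α_i)`. In two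
variables this follows from `1/(x + y) = ∫_0^∞ e^{-r(x+y)} dr`. In general the Pfaffian-type row
expansions `schurProd_odd` and `schurProd_even` hold for the variables and for the exponents alike,
which gives an induction.

Polynomials in the numerator only delete exponents from the list `k + a + 1`, so averages become
polynomials with coefficients `buresCoeff`; summing residues shows that the functions
`G^{1,1}_{2,3}` are these polynomials (`meijerG11_succ`). A factor `1/(x - κ)` is a Mellin–Barnes
superposition of powers of `x`, so it adds an exponent `a - s` to the list and a line integral over
`s` (`schurIntegral_cons_cauchyDensity`). The ratios of this exponent with all the others telescope
into the Gamma factors of `G^{3,1}_{2,3}` (`lineKernel_eq_prod_schurRatio`).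

With two sources, the only factor coupling them is a Schur ratio `(β - α)/(β + α)` or its inverse.
Its denominator is undone by a power integral, over `(0,1)` or over `(1,∞)` according to the sign of
its real part. Its numerator splits into two terms, which is why each kernel is made of two
companion G-functions.

For two denominators the natural contours satisfy `Re (s + s') < 2a`, and this gives the integral
over `(1,∞)`. To reach `(0,1)` the pole at `s + s' = 2a` has to be crossed. The difference of the
integrands for `M + 1` and `M` has no such pole (`meijerProductKernel_succ_sub`), so its integral
over `(0,∞)` vanishes. Telescoping down to `M = 0` leaves the explicit double integral, which is the
two-particle partition function. -/

noncomputable section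

/-! ### Algebra of Schur's product. -/

/-- The factor `(y - x) / (y + x)` of Schur's Pfaffian. -/
def schurRatio {K : Type*} [Field K] (x y : K) : K := (y - x) / (y + x)

/-- Schur's product `∏_{i<j} (z_j - z_i) / (z_j + z_i)`. -/
def schurProd {K : Type*} [Field K] {n : ℕ} (z : Fin n → K) : K :=
  ∏ i, ∏ j ∈ Finset.Ioi i, schurRatio (z i) (z j)

section SchurAlgebra

variable {K : Type*} [Field K] {n : ℕ}

lemma schurRatio_swap (x y : K) : schurRatio x y = -schurRatio y x := by
  simp only [schurRatio, ← neg_div, neg_sub, add_comm]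

lemma schurProd_comp_perm (z : Fin n → K) (σ : Equiv.Perm (Fin n)) :
    schurProd (z ∘ σ) = Equiv.Perm.sign σ * schurProd z :=
  Equiv.Perm.prod_Ioi_comp_eq_sign_mul_prod σ (f := fun i j => schurRatio (z i) (z j))
    (fun _ _ => schurRatio_swap _ _)

lemma schurProd_cons (x : K) (z : Fin n → K) :
    schurProd (Fin.cons x z : Fin (n + 1) → K) = (∏ i, schurRatio x (z i)) * schurProd z := by
  simp [schurProd, Fin.prod_univ_succ, Fin.prod_Ioi_succ]

/-- Moving the `k`-th variable to the front is a cycle of sign `(-1)^k`; then `schurProd_cons`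
splits it off. -/
lemma schurProd_eq_removeNth (z : Fin (n + 1) → K) (k : Fin (n + 1)) :
    schurProd z = (-1) ^ (k : ℕ) * (∏ i, schurRatio (z k) (z (k.succAbove i))) *
      schurProd (k.removeNth z) := by
  have h := schurProd_comp_perm z k.cycleRange.symm
  rw [← Fin.cons_removeNth_eq_comp_cycleRange_symm, schurProd_cons, Equiv.Perm.sign_symm,
    Fin.sign_cycleRange] at h
  simp only [Fin.removeNth_apply] at h ⊢
  rw [mul_assoc, h, ← mul_assoc]
  push_cast
  rw [← mul_pow]
  simp

lemma schurProd_eq_zero_of_eq {z : Fin n → K} {i j : Fin n} (hij : i ≠ j) (h : z i = z j) :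
    schurProd z = 0 := by
  wlog hlt : i < j generalizing i j
  · exact this hij.symm h.symm (lt_of_le_of_ne (not_lt.1 hlt) hij.symm)
  refine Finset.prod_eq_zero (Finset.mem_univ i) (Finset.prod_eq_zero (Finset.mem_Ioi.2 hlt) ?_)
  simp [schurRatio, h]

/-- Lagrange interpolation of a monic polynomial: its leading coefficient. -/
lemma sum_eval_div_prod_sub_eq_one {v : Fin (n + 1) → K} (hv : Function.Injective v)
    {P : Polynomial K} (hP : P.Monic) (hd : P.natDegree = n) :
    ∑ i, P.eval (v i) / ∏ j : Fin n, (v i - v (i.succAbove j)) = 1 := by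
  have h := Lagrange.coeff_eq_sum (s := Finset.univ) (v := v) hv.injOn (P := P) (by
    rw [Polynomial.degree_eq_natDegree hP.ne_zero, hd, Finset.card_univ, Fintype.card_fin]
    exact_mod_cast n.lt_succ_self)
  have h1 : P.coeff (Finset.univ.card (α := Fin (n + 1)) - 1) = 1 := by
    rw [Finset.card_univ, Fintype.card_fin, Nat.add_sub_cancel, ← hd]
    exact hP
  rw [h1] at h
  rw [h]
  refine Finset.sum_congr rfl fun i _ => ?_
  congr 1
  rw [← Finset.compl_singleton, ← Fin.image_succAbove_univ, Finset.prod_image]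
  exact fun a _ b _ hab => Fin.succAbove_right_injective hab

variable {z : Fin (n + 1) → K}

lemma prod_inv_schurRatio (hn : Even n) (z : Fin (n + 1) → K) (k : Fin (n + 1)) :
    ∏ i, (schurRatio (z k) (z (k.succAbove i)))⁻¹ =
      ∏ i, (z k + z (k.succAbove i)) / (z k - z (k.succAbove i)) := by
  have : ∀ i, (schurRatio (z k) (z (k.succAbove i)))⁻¹ =
      (-1) * ((z k + z (k.succAbove i)) / (z k - z (k.succAbove i))) := fun i => by
    rw [schurRatio, inv_div, ← neg_sub (z k), div_neg, add_comm]; ring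
  simp only [this, Finset.prod_mul_distrib]
  simp [hn.neg_one_pow]

lemma schurProd_removeNth_eq (hz : Function.Injective z) (h2 : ∀ i j, z i + z j ≠ 0)
    (k : Fin (n + 1)) :
    (-1) ^ (k : ℕ) * schurProd (k.removeNth z) =
      schurProd z * ∏ i, (schurRatio (z k) (z (k.succAbove i)))⁻¹ := by
  have h0 : ∏ i, schurRatio (z k) (z (k.succAbove i)) ≠ 0 :=
    Finset.prod_ne_zero_iff.2 fun i _ => div_ne_zero
      (sub_ne_zero.2 fun h => Fin.succAbove_ne k i (hz h)) (h2 _ _)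
  rw [schurProd_eq_removeNth z k, Finset.prod_inv_distrib]
  field_simp

lemma monic_prod_X_add (z : Fin n → K) :
    (∏ i, (Polynomial.X + Polynomial.C (z i))).Monic :=
  Polynomial.monic_prod_of_monic _ _ fun i _ => Polynomial.monic_X_add_C (z i)

lemma natDegree_prod_X_add (z : Fin n → K) :
    (∏ i, (Polynomial.X + Polynomial.C (z i))).natDegree = n := by
  rw [Polynomial.natDegree_prod_of_monic _ _ fun i _ => Polynomial.monic_X_add_C (z i)]
  simp

/-- Expansion of Schur's product in an odd number of variables. -/
lemma schurProd_odd (hn : Even n) (hz : Function.Injective z) (h2 : ∀ i j, z i + z j ≠ 0) :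
    schurProd z = ∑ k : Fin (n + 1), (-1) ^ (k : ℕ) * schurProd (k.removeNth z) := by
  have h20 : (2 : K) ≠ 0 := fun h => h2 0 0 (by rw [← two_mul, h, zero_mul])
  have hz0 : ∀ i, z i ≠ 0 := fun i h => h2 i i (by simp [h])
  -- Interpolate `∏ (X + z_i)` at the nodes `0, z_0, …, z_n`. The node `0` contributes `(-1)^(n+1) =
  -- -1`, the node `z_k` contributes `2 ∏_{i≠k} (z_k + z_i)/(z_k - z_i)`, and the total is the
  -- leading coefficient `1`; so these products sum to `1`.
  obtain ⟨v, hv0, hvs⟩ : ∃ v : Fin (n + 2) → K, v 0 = 0 ∧ ∀ i : Fin (n + 1), v i.succ = z i :=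
    ⟨Fin.cons 0 z, rfl, fun _ => rfl⟩
  have hinj : Function.Injective v := by
    rw [← Fin.cons_self_tail v, Fin.cons_injective_iff, hv0]
    exact ⟨fun ⟨i, hi⟩ => hz0 i ((hvs i).symm.trans hi), fun i j hij =>
      hz ((hvs i).symm.trans (hij.trans (hvs j)))⟩
  have h := sum_eval_div_prod_sub_eq_one hinj (monic_prod_X_add z) (natDegree_prod_X_add z)
  have h0 : (∏ i, z i) ≠ 0 := Finset.prod_ne_zero_iff.2 fun i _ => hz0 i
  have hodd : (-1 : K) ^ (n + 1) = -1 := hn.add_one.neg_one_pow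
  have e0 : (∏ i, (v 0 + z i)) / ∏ j, (v 0 - v ((0 : Fin (n + 2)).succAbove j)) = -1 := by
    simp only [hv0, zero_add, zero_sub, Fin.succAbove_zero, hvs]
    rw [Finset.prod_neg, Finset.card_univ, Fintype.card_fin, hodd]
    field_simp
  have ek : ∀ k : Fin (n + 1), (∏ i, (v k.succ + z i)) / ∏ j, (v k.succ - v (k.succ.succAbove j)) =
      2 * ∏ i, (z k + z (k.succAbove i)) / (z k - z (k.succAbove i)) := fun k => by
    rw [Fin.prod_univ_succ (n := n) (f := fun j => v k.succ - v (k.succ.succAbove j))]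
    simp only [Fin.succ_succAbove_zero, Fin.succ_succAbove_succ, hvs, hv0, sub_zero]
    rw [Fin.prod_univ_succAbove _ k, Finset.prod_div_distrib, mul_div_mul_comm, ← two_mul,
      mul_div_cancel_right₀ _ (hz0 k)]
  simp only [Polynomial.eval_prod, Polynomial.eval_add, Polynomial.eval_X, Polynomial.eval_C] at h
  rw [Fin.sum_univ_succ, e0] at h
  simp only [ek, ← Finset.mul_sum] at h
  have hs : ∑ k : Fin (n + 1), ∏ i, (z k + z (k.succAbove i)) / (z k - z (k.succAbove i)) = 1 := by
    apply mul_left_cancel₀ h20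
    linear_combination h
  simp only [schurProd_removeNth_eq hz h2, prod_inv_schurRatio hn, ← Finset.mul_sum, hs, mul_one]

/-- Expansion of Schur's product in an even number of variables. -/
lemma schurProd_even (hn : Even n) {x : K} (hx : x ≠ 0) (hz : Function.Injective z)
    (h2 : ∀ i j, z i + z j ≠ 0) (hxz : ∀ i, z i + x ≠ 0) :
    (∏ i, schurRatio x (z i)) * schurProd z =
      ∑ k : Fin (n + 1), (-1) ^ (k : ℕ) * schurRatio x (z k) * schurProd (k.removeNth z) := by
  have h20 : (2 : K) ≠ 0 := fun h => h2 0 0 (by rw [← two_mul, h, zero_mul])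
  have hz0 : ∀ i, z i ≠ 0 := fun i h => h2 i i (by simp [h])
  -- The same argument for `(X - x) ∏ (X + z_i)` with the additional node `-x`. The node `0`
  -- contributes `1`, the node `-x` contributes `-2 ∏ (z_i - x)/(z_i + x)`, and the factor `X - x`
  -- at `z_k` together with the distance to `-x` makes the ratio of `x` and `z_k`.
  obtain ⟨v, hv0, hv1, hvs⟩ : ∃ v : Fin (n + 3) → K, v 0 = 0 ∧ v (Fin.succ 0) = -x ∧
      ∀ i : Fin (n + 1), v i.succ.succ = z i :=
    ⟨Fin.cons 0 (Fin.cons (-x) z), rfl, rfl, fun _ => rfl⟩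
  have hinj : Function.Injective v := by
    have hv : v = Fin.cons 0 (Fin.cons (-x) z) := by
      funext i
      induction i using Fin.cases with
      | zero => exact hv0
      | succ i =>
        induction i using Fin.cases with
        | zero => exact hv1
        | succ i => exact hvs i
    rw [hv]
    refine Fin.cons_injective_iff.2 ⟨?_, Fin.cons_injective_iff.2 ⟨?_, hz⟩⟩
    · rintro ⟨i, hi⟩
      induction i using Fin.cases with
      | zero => simp [hx] at hi
      | succ i => exact hz0 i (by simpa using hi)
    · rintro ⟨i, hi⟩
      exact hxz i (by rw [hi]; ring)
  have hm : ((Polynomial.X - Polynomial.C x) *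
      ∏ i, (Polynomial.X + Polynomial.C (z i))).Monic :=
    (Polynomial.monic_X_sub_C x).mul (monic_prod_X_add z)
  have hd : ((Polynomial.X - Polynomial.C x) *
      ∏ i, (Polynomial.X + Polynomial.C (z i))).natDegree = n + 2 := by
    rw [(Polynomial.monic_X_sub_C x).natDegree_mul (monic_prod_X_add z),
      Polynomial.natDegree_X_sub_C, natDegree_prod_X_add, add_comm]
  have h := sum_eval_div_prod_sub_eq_one hinj hm hd
  have h0 : (∏ i, z i) ≠ 0 := Finset.prod_ne_zero_iff.2 fun i _ => hz0 i
  have hodd : (-1 : K) ^ (n + 1) = -1 := hn.add_one.neg_one_pow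
  have e0 : (v 0 - x) * (∏ i, (v 0 + z i)) /
      ∏ j, (v 0 - v ((0 : Fin (n + 3)).succAbove j)) = 1 := by
    rw [Fin.prod_univ_succ (n := n + 1)]
    simp only [hv0, zero_add, zero_sub, Fin.succAbove_zero, hvs, hv1, neg_neg]
    rw [Finset.prod_neg, Finset.card_univ, Fintype.card_fin, hodd]
    field_simp
  have e1 : (v (Fin.succ 0) - x) * (∏ i, (v (Fin.succ 0) + z i)) /
      ∏ j, (v (Fin.succ 0) - v ((Fin.succ 0 : Fin (n + 3)).succAbove j)) =
        -2 * ∏ i, schurRatio x (z i) := by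
    have hx2 : ∀ i, -x - z i = (-1) * (z i + x) := fun i => by ring
    rw [Fin.prod_univ_succ (n := n + 1)]
    simp only [Fin.succ_succAbove_zero, Fin.succ_succAbove_succ, Fin.succAbove_zero, hvs, hv0,
      hv1, sub_zero, hx2, Finset.prod_mul_distrib, schurRatio, Finset.prod_div_distrib]
    rw [Finset.prod_const, Finset.card_univ, Fintype.card_fin, hodd]
    have : ∏ i, (z i + x) ≠ 0 := Finset.prod_ne_zero_iff.2 fun i _ => hxz i
    simp only [neg_add_eq_sub]
    field_simp
    ring
  have ek : ∀ k : Fin (n + 1), (v k.succ.succ - x) * (∏ i, (v k.succ.succ + z i)) /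
      ∏ j, (v k.succ.succ - v (k.succ.succ.succAbove j)) =
      2 * (schurRatio x (z k) *
        ∏ i, (z k + z (k.succAbove i)) / (z k - z (k.succAbove i))) := fun k => by
    have h1 := hxz k
    have h3 := hz0 k
    rw [Fin.prod_univ_succ (n := n + 1),
      Fin.prod_univ_succ (n := n) (f := fun j => v k.succ.succ - v (k.succ.succ.succAbove j.succ))]
    simp only [Fin.succ_succAbove_zero, Fin.succ_succAbove_succ, hvs, hv0, hv1, sub_zero,
      sub_neg_eq_add]
    rw [Fin.prod_univ_succAbove _ k, Finset.prod_div_distrib, schurRatio]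
    field_simp
    ring
  simp only [Polynomial.eval_prod, Polynomial.eval_add, Polynomial.eval_X, Polynomial.eval_C,
    Polynomial.eval_mul, Polynomial.eval_sub] at h
  rw [Fin.sum_univ_succ, Fin.sum_univ_succ, e0, e1] at h
  simp only [ek, ← Finset.mul_sum] at h
  have hs : ∑ k : Fin (n + 1), schurRatio x (z k) *
      ∏ i, (z k + z (k.succAbove i)) / (z k - z (k.succAbove i)) = ∏ i, schurRatio x (z i) := by
    apply mul_left_cancel₀ h20
    linear_combination h
  rw [← hs, Finset.sum_mul]
  refine Finset.sum_congr rfl fun k _ => ?_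
  rw [mul_right_comm ((-1) ^ (k : ℕ)), schurProd_removeNth_eq hz h2, prod_inv_schurRatio hn]
  ring

end SchurAlgebra
end

/-! ### Integrals of products against Schur's product. -/

noncomputable section

/-- Lebesgue measure on `(0, ∞)`. -/
def posMeasure : Measure ℝ := volume.restrict (Ioi 0)

instance : SFinite posMeasure := inferInstanceAs (SFinite (volume.restrict (Ioi 0)))
instance : SigmaFinite posMeasure := inferInstanceAs (SigmaFinite (volume.restrict (Ioi 0)))

/-- The integral of `∏ f_i(z_i)` against Schur's product. -/
def schurIntegral {n : ℕ} (f : Fin n → ℝ → ℂ) : ℂ :=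
  ∫ z, (∏ i, f i (z i)) * ((schurProd z : ℝ) : ℂ) ∂Measure.pi fun _ : Fin n => posMeasure

/-- The density obtained from `schurIntegral` by freeing a first variable. -/
def schurCofactor {n : ℕ} (f : Fin n → ℝ → ℂ) (x : ℝ) : ℂ :=
  ∫ z, (∏ i, f i (z i)) * (((∏ i, schurRatio x (z i)) * schurProd z : ℝ) : ℂ)
    ∂Measure.pi fun _ : Fin n => posMeasure

section SchurIntegral

variable {n : ℕ}

lemma pi_posMeasure : (Measure.pi fun _ : Fin n => posMeasure) =
    (volume : Measure (Fin n → ℝ)).restrict (Set.univ.pi fun _ => Ioi 0) := by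
  rw [volume_pi, Measure.restrict_pi_pi]; rfl

lemma ae_posMeasure : ∀ᵐ x ∂posMeasure, 0 < x := ae_restrict_mem measurableSet_Ioi

lemma ae_pi_pos : ∀ᵐ z ∂(Measure.pi fun _ : Fin n => posMeasure), ∀ i, 0 < z i := by
  rw [pi_posMeasure]
  filter_upwards [ae_restrict_mem (MeasurableSet.univ_pi fun _ => measurableSet_Ioi)] with z hz i
  exact hz i (Set.mem_univ i)

/-- The expansions of Schur's product divide by differences of the variables; the hyperplanes where
two variables coincide are proper subspaces, hence null. -/
lemma ae_pi_injective :
    ∀ᵐ z ∂(Measure.pi fun _ : Fin n => posMeasure), Function.Injective z := by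
  rw [pi_posMeasure]
  refine ae_restrict_of_ae ?_
  have : ∀ i j : Fin n, i ≠ j → ∀ᵐ z : Fin n → ℝ, z i ≠ z j := fun i j hij => by
    let s : Submodule ℝ (Fin n → ℝ) :=
      LinearMap.ker (LinearMap.proj (R := ℝ) (φ := fun _ : Fin n => ℝ) i - LinearMap.proj j)
    have hs : s ≠ ⊤ := fun h => by
      have h1 : Pi.single i (1 : ℝ) ∈ s := h ▸ Submodule.mem_top
      simp [s, hij] at h1
    have := Measure.addHaar_submodule volume s hs
    rw [← compl_mem_ae_iff] at this
    filter_upwards [this] with z hz h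
    exact hz (by simp [s, h])
  have h : ∀ᵐ z : Fin n → ℝ, ∀ i j, i ≠ j → z i ≠ z j :=
    ae_all_iff.2 fun i => ae_all_iff.2 fun j => by
      by_cases hij : i = j
      · exact Eventually.of_forall fun _ h => absurd hij h
      · filter_upwards [this i j hij] with z hz _ using hz
  filter_upwards [h] with z hz i j hij
  by_contra hne
  exact hz i j hne hij

lemma abs_schurRatio_le {x y : ℝ} (hx : 0 < x) (hy : 0 < y) : |schurRatio x y| ≤ 1 := by
  rw [schurRatio, abs_div, abs_of_pos (add_pos hy hx), div_le_one (add_pos hy hx)]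
  exact abs_sub_le_iff.2 ⟨by linarith, by linarith⟩

lemma abs_schurProd_le {z : Fin n → ℝ} (hz : ∀ i, 0 < z i) : |schurProd z| ≤ 1 := by
  rw [schurProd, Finset.abs_prod]
  refine Finset.prod_le_one (fun _ _ => abs_nonneg _) fun i _ => ?_
  rw [Finset.abs_prod]
  exact Finset.prod_le_one (fun _ _ => abs_nonneg _) fun j _ => abs_schurRatio_le (hz i) (hz j)

lemma abs_prod_schurRatio_le {x : ℝ} (hx : 0 < x) {z : Fin n → ℝ} (hz : ∀ i, 0 < z i) :
    |∏ i, schurRatio x (z i)| ≤ 1 := by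
  rw [Finset.abs_prod]
  exact Finset.prod_le_one (fun _ _ => abs_nonneg _) fun i _ => abs_schurRatio_le hx (hz i)

@[fun_prop]
lemma measurable_schurRatio {α : Type*} [MeasurableSpace α] {f g : α → ℝ} (hf : Measurable f)
    (hg : Measurable g) : Measurable fun a => schurRatio (f a) (g a) :=
  (hg.sub hf).div (hg.add hf)

@[fun_prop]
lemma measurable_schurProd : Measurable (schurProd : (Fin n → ℝ) → ℝ) := by
  unfold schurProd
  fun_prop

/-- Products of Schur ratios are at most `1` in modulus on the positive orthant, so integrability is
a matter of the one-variable factors alone. -/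
lemma integrable_prod_mul {f : Fin n → ℝ → ℂ} (hf : ∀ i, Integrable (f i) posMeasure)
    {g : (Fin n → ℝ) → ℝ} (hg : Measurable g) (hb : ∀ z, (∀ i, 0 < z i) → |g z| ≤ 1) :
    Integrable (fun z => (∏ i, f i (z i)) * ((g z : ℝ) : ℂ))
      (Measure.pi fun _ : Fin n => posMeasure) := by
  refine (Integrable.fintype_prod hf).mul_bdd (c := 1)
    (Complex.measurable_ofReal.comp hg).aestronglyMeasurable ?_
  filter_upwards [ae_pi_pos] with z hz
  simpa using hb z hz

lemma schurIntegral_comp_perm (f : Fin n → ℝ → ℂ) (σ : Equiv.Perm (Fin n)) :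
    schurIntegral (f ∘ σ) = Equiv.Perm.sign σ * schurIntegral f := by
  have hmp := measurePreserving_piCongrLeft (fun _ : Fin n => posMeasure) σ
  have hf : schurIntegral f = _ := (hmp.integral_comp'
    (fun z : Fin n → ℝ => (∏ i, f i (z i)) * ((schurProd z : ℝ) : ℂ))).symm
  rw [hf, ← integral_const_mul, schurIntegral]
  refine integral_congr_ae (Eventually.of_forall fun z => ?_)
  have hz : ∀ i, (MeasurableEquiv.piCongrLeft (fun _ : Fin n => ℝ) σ) z (σ i) = z i := fun i =>
    Equiv.piCongrLeft_apply_apply _ _ _ _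
  have h := schurProd_comp_perm ((MeasurableEquiv.piCongrLeft (fun _ : Fin n => ℝ) σ) z) σ
  have h2 : (MeasurableEquiv.piCongrLeft (fun _ : Fin n => ℝ) σ) z ∘ σ = z := funext hz
  rw [h2] at h
  simp only [h, Function.comp_apply]
  rw [← Equiv.prod_comp σ (fun i => f i ((MeasurableEquiv.piCongrLeft (fun _ : Fin n => ℝ) σ) z i))]
  simp only [hz]
  push_cast
  ring

lemma schurIntegral_eq_zero_of_eq {f : Fin n → ℝ → ℂ} {i j : Fin n} (hij : i ≠ j)
    (h : f i = f j) : schurIntegral f = 0 := by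
  have h1 := schurIntegral_comp_perm f (Equiv.swap i j)
  have h2 : f ∘ Equiv.swap i j = f := by
    funext k
    simp only [Function.comp_apply, Equiv.swap_apply_def]
    split_ifs with h3 h4
    · rw [h3, h]
    · rw [h4, h]
    · rfl
  rw [h2, Equiv.Perm.sign_swap hij] at h1
  push_cast at h1
  linear_combination h1 / 2

lemma integral_pi_succAbove (k : Fin (n + 1)) (F : (Fin (n + 1) → ℝ) → ℂ) :
    ∫ z, F z ∂(Measure.pi fun _ : Fin (n + 1) => posMeasure) =
      ∫ p : ℝ × (Fin n → ℝ), F (k.insertNth p.1 p.2)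
        ∂(posMeasure.prod (Measure.pi fun _ : Fin n => posMeasure)) :=
  (((measurePreserving_piFinSuccAbove (fun _ : Fin (n + 1) => posMeasure) k).symm).integral_comp'
    F).symm

/-- With the `k`-th variable removed from Schur's product, that variable decouples and Fubini
factors the integral. -/
lemma integral_mul_schurProd_removeNth (k : Fin (n + 1)) (g : ℝ → ℂ) (f : Fin n → ℝ → ℂ) :
    ∫ z, g (z k) * ((∏ i, f i (z (k.succAbove i))) * ((schurProd (k.removeNth z) : ℝ) : ℂ))
      ∂(Measure.pi fun _ : Fin (n + 1) => posMeasure) =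
      (∫ x, g x ∂posMeasure) * schurIntegral f := by
  rw [integral_pi_succAbove k, schurIntegral, ← integral_prod_mul]
  simp

lemma schurIntegral_cons {h : ℝ → ℂ} {f : Fin n → ℝ → ℂ} (hh : Integrable h posMeasure)
    (hf : ∀ i, Integrable (f i) posMeasure) :
    schurIntegral (Fin.cons h f : Fin (n + 1) → ℝ → ℂ) =
      ∫ x, h x * schurCofactor f x ∂posMeasure := by
  have hint := integrable_prod_mul (n := n + 1) (f := Fin.cons h f) (fun i => by
    induction i using Fin.cases with
    | zero => exact hh
    | succ i => exact hf i) measurable_schurProd (fun _ => abs_schurProd_le)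
  have hint2 := ((measurePreserving_piFinSuccAbove
    (fun _ : Fin (n + 1) => posMeasure) 0).symm).integrable_comp_emb
    (MeasurableEquiv.measurableEmbedding _) |>.2 hint
  rw [schurIntegral, integral_pi_succAbove 0]
  refine (integral_prod _ hint2).trans ?_
  refine integral_congr_ae (Eventually.of_forall fun x => ?_)
  have hc : ∀ a : Fin n → ℝ, (Fin.consEquiv fun _ => ℝ) (x, a) = (Fin.cons x a : Fin (n + 1) → ℝ) :=
    fun _ => rfl
  simp only [Function.comp_apply, MeasurableEquiv.piFinSuccAbove_symm_apply,
    Fin.insertNthEquiv_zero, hc, Fin.prod_univ_succ, Fin.cons_zero, Fin.cons_succ, schurProd_cons,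
    mul_assoc]
  rw [integral_const_mul, schurCofactor]

/-- Uniformity in `x` is what later dominates the exchange of the `x`-integral with a Mellin–Barnes
integral. -/
lemma norm_schurCofactor_le {f : Fin n → ℝ → ℂ} (hf : ∀ i, Integrable (f i) posMeasure) :
    ∃ C, ∀ x, 0 < x → ‖schurCofactor f x‖ ≤ C := by
  refine ⟨∫ z, ‖∏ i, f i (z i)‖ ∂Measure.pi fun _ : Fin n => posMeasure, fun x hx => ?_⟩
  refine norm_integral_le_of_norm_le (Integrable.fintype_prod hf).norm ?_
  filter_upwards [ae_pi_pos] with z hz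
  rw [norm_mul, Complex.norm_real, Real.norm_eq_abs, abs_mul]
  exact mul_le_of_le_one_right (norm_nonneg _) (mul_le_one₀ (abs_prod_schurRatio_le hx hz)
    (abs_nonneg _) (abs_schurProd_le hz))

lemma aestronglyMeasurable_schurCofactor {f : Fin n → ℝ → ℂ}
    (hf : ∀ i, Integrable (f i) posMeasure) :
    AEStronglyMeasurable (schurCofactor f) posMeasure := by
  refine AEStronglyMeasurable.integral_prod_right' (f := fun p : ℝ × (Fin n → ℝ) =>
    (∏ i, f i (p.2 i)) * (((∏ i, schurRatio p.1 (p.2 i)) * schurProd p.2 : ℝ) : ℂ)) ?_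
  refine AEStronglyMeasurable.mul ?_ ?_
  · exact (Integrable.fintype_prod hf).aestronglyMeasurable.comp_snd
  · exact (Complex.measurable_ofReal.comp (by fun_prop)).aestronglyMeasurable

/-- Integrate `schurProd_odd` term by term: each term loses one variable, which leaves a plain
moment. -/
lemma schurIntegral_odd (hn : Even n) {f : Fin (n + 1) → ℝ → ℂ}
    (hf : ∀ i, Integrable (f i) posMeasure) :
    schurIntegral f = ∑ k : Fin (n + 1), (-1) ^ (k : ℕ) *
      ((∫ x, f k x ∂posMeasure) * schurIntegral (k.removeNth f)) := by
  have h1 : schurIntegral f = ∫ z, ∑ k : Fin (n + 1), (-1) ^ (k : ℕ) *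
      ((∏ i, f i (z i)) * ((schurProd (k.removeNth z) : ℝ) : ℂ))
      ∂(Measure.pi fun _ : Fin (n + 1) => posMeasure) := by
    refine integral_congr_ae ?_
    filter_upwards [ae_pi_pos, ae_pi_injective] with z hz hi
    rw [schurProd_odd hn hi fun i j => (add_pos (hz i) (hz j)).ne']
    push_cast
    rw [Finset.mul_sum]
    exact Finset.sum_congr rfl fun k _ => by ring
  rw [h1, integral_finsetSum]
  · refine Finset.sum_congr rfl fun k _ => ?_
    rw [integral_const_mul, ← integral_mul_schurProd_removeNth k]
    simp only [Fin.prod_univ_succAbove _ k, mul_assoc, Fin.removeNth_apply]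
  · intro k _
    refine Integrable.const_mul (integrable_prod_mul hf ?_ fun z hz => ?_) _
    · exact measurable_schurProd.comp (measurable_pi_lambda _ fun i => measurable_pi_apply _)
    · exact abs_schurProd_le fun i => hz _

/-- Integrate `schurProd_even` term by term with the first variable frozen at `x`; integrating over
`x` afterwards turns the coefficients into bilinear moments of the Schur ratio. -/
lemma schurCofactor_even (hn : Even n) {f : Fin (n + 1) → ℝ → ℂ}
    (hf : ∀ i, Integrable (f i) posMeasure) {x : ℝ} (hx : 0 < x) :
    schurCofactor f x = ∑ k : Fin (n + 1), (-1) ^ (k : ℕ) *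
      ((∫ y, f k y * ((schurRatio x y : ℝ) : ℂ) ∂posMeasure) *
        schurIntegral (k.removeNth f)) := by
  have h1 : schurCofactor f x = ∫ z, ∑ k : Fin (n + 1), (-1) ^ (k : ℕ) *
      ((∏ i, f i (z i)) * ((schurRatio x (z k) * schurProd (k.removeNth z) : ℝ) : ℂ))
      ∂(Measure.pi fun _ : Fin (n + 1) => posMeasure) := by
    refine integral_congr_ae ?_
    filter_upwards [ae_pi_pos, ae_pi_injective] with z hz hi
    rw [schurProd_even hn hx.ne' hi (fun i j => (add_pos (hz i) (hz j)).ne')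
      fun i => (add_pos (hz i) hx).ne']
    push_cast
    rw [Finset.mul_sum]
    exact Finset.sum_congr rfl fun k _ => by ring
  rw [h1, integral_finsetSum]
  · refine Finset.sum_congr rfl fun k _ => ?_
    rw [integral_const_mul, ← integral_mul_schurProd_removeNth k]
    congr 1
    refine integral_congr_ae (Eventually.of_forall fun z => ?_)
    simp only [Fin.prod_univ_succAbove _ k, Fin.removeNth_apply]
    push_cast
    ring
  · intro k _
    refine Integrable.const_mul (integrable_prod_mul hf ?_ fun z hz => ?_) _
    · exact (measurable_schurRatio measurable_const (measurable_pi_apply k)).mul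
        (measurable_schurProd.comp (measurable_pi_lambda _ fun i => measurable_pi_apply _))
    · rw [abs_mul]
      exact mul_le_one₀ (abs_schurRatio_le hx (hz k)) (abs_nonneg _)
        (abs_schurProd_le fun i => hz _)

end SchurIntegral
end

/-! ### Gamma densities and the self-reproduction of Schur's product. -/

noncomputable section

/-- The Gamma density `x ^ (α - 1) e^{-x}`. -/
def gammaDensity (α : ℂ) (x : ℝ) : ℂ := (x : ℂ) ^ (α - 1) * Real.exp (-x)

section GammaDensity

lemma integrable_gammaDensity {α : ℂ} (hα : 0 < α.re) : Integrable (gammaDensity α) posMeasure :=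
  (Complex.GammaIntegral_convergent hα).congr (Eventually.of_forall fun x => by
    simp only [gammaDensity]; push_cast; ring)

lemma integral_gammaDensity {α : ℂ} (hα : 0 < α.re) :
    ∫ x, gammaDensity α x ∂posMeasure = Complex.Gamma α := by
  rw [Complex.Gamma_eq_integral hα, Complex.GammaIntegral]
  exact integral_congr_ae (Eventually.of_forall fun x => by simp only [gammaDensity]; push_cast; ring)

lemma integral_one_add_cpow {w : ℂ} (hw : 0 < w.re) :
    ∫ r : ℝ, ((1 + r : ℝ) : ℂ) ^ (-w - 1) ∂posMeasure = 1 / w := by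
  have hw0 : w ≠ 0 := fun h => by simp [h] at hw
  have h := integral_Ioi_cpow_of_lt (a := -w - 1) (by simp; linarith) zero_lt_one
  rw [← integral_indicator measurableSet_Ioi] at h
  rw [posMeasure, ← integral_indicator measurableSet_Ioi,
    ← integral_sub_right_eq_self _ (1 : ℝ), ← integral_congr_ae
      (f := (Ioi 1).indicator fun t : ℝ => (t : ℂ) ^ (-w - 1)), h]
  · simp only [Complex.ofReal_one, Complex.one_cpow]
    rw [sub_add_cancel, neg_div_neg_eq]
  · refine Eventually.of_forall fun x => ?_
    simp only [Set.indicator_apply, mem_Ioi, sub_pos, add_sub_cancel]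

lemma integral_gammaDensity_mul_exp {α : ℂ} (hα : 0 < α.re) {r : ℝ} (hr : 0 < r) :
    ∫ x, gammaDensity α x * Real.exp (-r * x) ∂posMeasure =
      ((1 + r : ℝ) : ℂ) ^ (-α) * Complex.Gamma α := by
  have h := Complex.integral_cpow_mul_exp_neg_mul_Ioi hα (r := 1 + r) (by linarith)
  rw [one_div] at h
  have : ((1 + r : ℝ) : ℂ).arg ≠ Real.pi := by
    rw [Complex.arg_ofReal_of_nonneg (by linarith)]; exact Real.pi_ne_zero.symm
  rw [Complex.cpow_neg, ← Complex.inv_cpow _ _ this]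
  push_cast at h ⊢
  rw [← h]
  refine integral_congr_ae (Eventually.of_forall fun x => ?_)
  simp only [gammaDensity]
  push_cast
  rw [mul_assoc, ← Complex.exp_add]
  ring_nf

lemma gammaDensity_mul_self {α : ℂ} {x : ℝ} (hx : 0 < x) :
    gammaDensity α x * x = gammaDensity (α + 1) x := by
  have : (x : ℂ) ≠ 0 := by exact_mod_cast hx.ne'
  simp only [gammaDensity]
  rw [add_sub_cancel_right, Complex.cpow_sub _ _ this, Complex.cpow_one]
  field_simp

lemma measurable_gammaDensity (α : ℂ) : Measurable (gammaDensity α) := by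
  unfold gammaDensity
  fun_prop

lemma integral_exp_neg_mul_posMeasure {c : ℝ} (hc : 0 < c) :
    ∫ r, Real.exp (-(r * c)) ∂posMeasure = 1 / c := by
  have h := integral_exp_mul_Ioi (a := -c) (by linarith) 0
  rw [posMeasure]
  simp only [mul_comm _ c, ← neg_mul]
  rw [h]
  simp [neg_div_neg_eq]

lemma integrable_exp_neg_mul_posMeasure {c : ℝ} (hc : 0 < c) :
    Integrable (fun r => Real.exp (-(r * c))) posMeasure := by
  have h := integrableOn_exp_mul_Ioi (a := -c) (by linarith) 0
  exact h.congr (Eventually.of_forall fun x => by simp only; ring_nf)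

/-- The bilinear moments of `(y - x) / (y + x)`. -/
lemma integral_gammaDensity_schurRatio {s t : ℂ} (hs : 0 < s.re) (ht : 0 < t.re) :
    ∫ x, gammaDensity s x * ∫ y, gammaDensity t y * ((schurRatio x y : ℝ) : ℂ) ∂posMeasure
      ∂posMeasure = Complex.Gamma s * Complex.Gamma t * schurRatio s t := by
  have hst : s + t ≠ 0 := fun h => by
    have := congrArg Complex.re h; simp at this; linarith
  have hs0 : s ≠ 0 := fun h => by simp [h] at hs
  have ht0 : t ≠ 0 := fun h => by simp [h] at ht
  have hint : Integrable (fun p : ℝ × ℝ => gammaDensity s p.1 * gammaDensity t p.2)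
      (posMeasure.prod posMeasure) :=
    (integrable_gammaDensity hs).mul_prod (integrable_gammaDensity ht)
  have hpos : ∀ᵐ p ∂(posMeasure.prod posMeasure), 0 < p.1 ∧ 0 < p.2 := by
    rw [posMeasure, Measure.prod_restrict]
    exact ae_restrict_mem (measurableSet_Ioi.prod measurableSet_Ioi)
  have hmr : Measurable fun p : ℝ × ℝ => ((schurRatio p.1 p.2 : ℝ) : ℂ) :=
    Complex.measurable_ofReal.comp (measurable_schurRatio measurable_fst measurable_snd)
  have hint1 : Integrable (fun p : ℝ × ℝ => gammaDensity s p.1 * gammaDensity t p.2 *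
      ((schurRatio p.1 p.2 : ℝ) : ℂ)) (posMeasure.prod posMeasure) := by
    refine hint.mul_bdd (c := 1) hmr.aestronglyMeasurable ?_
    filter_upwards [hpos] with p hp
    simpa using abs_schurRatio_le hp.1 hp.2
  have e1 : ∫ x, gammaDensity s x * ∫ y, gammaDensity t y * ((schurRatio x y : ℝ) : ℂ) ∂posMeasure
      ∂posMeasure = ∫ p : ℝ × ℝ, gammaDensity s p.1 * gammaDensity t p.2 *
      ((schurRatio p.1 p.2 : ℝ) : ℂ) ∂(posMeasure.prod posMeasure) := by
    rw [integral_prod _ hint1]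
    refine integral_congr_ae (Eventually.of_forall fun x => ?_)
    simp only [mul_assoc]
    rw [integral_const_mul]
  -- Writing `1/(x + y) = ∫_0^∞ e^{-r(x+y)} dr` decouples the two variables.
  have e2 : ∫ p : ℝ × ℝ, gammaDensity s p.1 * gammaDensity t p.2 *
      ((schurRatio p.1 p.2 : ℝ) : ℂ) ∂(posMeasure.prod posMeasure) =
      ∫ p : ℝ × ℝ, ∫ r : ℝ, gammaDensity s p.1 * gammaDensity t p.2 *
        (((p.2 - p.1) * Real.exp (-(r * (p.2 + p.1))) : ℝ) : ℂ) ∂posMeasure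
        ∂(posMeasure.prod posMeasure) := by
    refine integral_congr_ae ?_
    filter_upwards [hpos] with p hp
    rw [integral_const_mul, integral_complex_ofReal, integral_const_mul,
      integral_exp_neg_mul_posMeasure (add_pos hp.2 hp.1), schurRatio]
    simp [div_eq_mul_inv]
  -- For Fubini: the `r`-integral of the modulus restores `|y - x|/(x + y)`, so the integrability of
  -- the original integrand is enough.
  have hint2 : Integrable (Function.uncurry fun (p : ℝ × ℝ) (r : ℝ) =>
      gammaDensity s p.1 * gammaDensity t p.2 *
        (((p.2 - p.1) * Real.exp (-(r * (p.2 + p.1))) : ℝ) : ℂ))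
      ((posMeasure.prod posMeasure).prod posMeasure) := by
    have hm : Measurable (Function.uncurry fun (p : ℝ × ℝ) (r : ℝ) =>
      gammaDensity s p.1 * gammaDensity t p.2 *
        (((p.2 - p.1) * Real.exp (-(r * (p.2 + p.1))) : ℝ) : ℂ)) := by
      have h1 := measurable_gammaDensity s
      have h2 := measurable_gammaDensity t
      unfold Function.uncurry
      fun_prop
    rw [integrable_prod_iff hm.aestronglyMeasurable]
    constructor
    · filter_upwards [hpos] with p hp
      simp only [Function.uncurry]
      exact ((((integrable_exp_neg_mul_posMeasure (add_pos hp.2 hp.1)).const_mul _).ofReal).const_mul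
        _)
    · refine hint1.norm.congr ?_
      filter_upwards [hpos] with p hp
      simp only [Function.uncurry, norm_mul, Complex.norm_real, Real.norm_eq_abs, Real.abs_exp]
      rw [integral_const_mul, integral_const_mul,
        integral_exp_neg_mul_posMeasure (add_pos hp.2 hp.1), schurRatio, abs_div,
        abs_of_pos (add_pos hp.2 hp.1), mul_one_div]
  rw [e1, e2, integral_integral_swap hint2]
  -- For fixed `r` there remain Laplace transforms of Gamma densities. The factor `y - x` raises one
  -- exponent in each of two terms, and `Γ(z + 1) = z Γ(z)` combines them into the factor `t - s`.
  -- Integrating the power of `1 + r` then supplies `1/(s + t)`.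
  have e3 : ∀ r : ℝ, 0 < r → ∫ p : ℝ × ℝ, gammaDensity s p.1 * gammaDensity t p.2 *
        (((p.2 - p.1) * Real.exp (-(r * (p.2 + p.1))) : ℝ) : ℂ) ∂(posMeasure.prod posMeasure) =
      Complex.Gamma s * Complex.Gamma t * (t - s) * ((1 + r : ℝ) : ℂ) ^ (-(s + t) - 1) := by
    intro r hr
    have hI : ∀ {α : ℂ}, 0 < α.re → Integrable (fun x => gammaDensity α x * Real.exp (-r * x))
        posMeasure := fun {α} hα => by
      refine (integrable_gammaDensity hα).mul_bdd (c := 1) (by fun_prop) ?_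
      filter_upwards [ae_posMeasure] with x hx
      rw [Complex.norm_real, Real.norm_eq_abs, Real.abs_exp, Real.exp_le_one_iff]
      nlinarith
    have hs1 : 0 < (s + 1).re := by simp; linarith
    have ht1 : 0 < (t + 1).re := by simp; linarith
    have h1 : ∫ p : ℝ × ℝ, gammaDensity s p.1 * gammaDensity t p.2 *
        (((p.2 - p.1) * Real.exp (-(r * (p.2 + p.1))) : ℝ) : ℂ) ∂(posMeasure.prod posMeasure) =
      ∫ p : ℝ × ℝ, ((gammaDensity s p.1 * Real.exp (-r * p.1)) *
        (gammaDensity (t + 1) p.2 * Real.exp (-r * p.2)) -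
        (gammaDensity (s + 1) p.1 * Real.exp (-r * p.1)) *
        (gammaDensity t p.2 * Real.exp (-r * p.2))) ∂(posMeasure.prod posMeasure) := by
      refine integral_congr_ae ?_
      filter_upwards [hpos] with p hp
      have : Real.exp (-(r * (p.2 + p.1))) = Real.exp (-r * p.1) * Real.exp (-r * p.2) := by
        rw [← Real.exp_add]; ring_nf
      rw [← gammaDensity_mul_self hp.1, ← gammaDensity_mul_self hp.2, this]
      push_cast
      ring
    have hr1 : ((1 + r : ℝ) : ℂ) ≠ 0 := by
      exact_mod_cast (by linarith : (0 : ℝ) < 1 + r).ne'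
    rw [h1, integral_sub ((hI hs).mul_prod (hI ht1)) ((hI hs1).mul_prod (hI ht)),
      integral_prod_mul (fun x => gammaDensity s x * (Real.exp (-r * x) : ℂ))
        (fun x => gammaDensity (t + 1) x * (Real.exp (-r * x) : ℂ)),
      integral_prod_mul (fun x => gammaDensity (s + 1) x * (Real.exp (-r * x) : ℂ))
        (fun x => gammaDensity t x * (Real.exp (-r * x) : ℂ)), integral_gammaDensity_mul_exp hs hr,
      integral_gammaDensity_mul_exp ht hr, integral_gammaDensity_mul_exp hs1 hr,
      integral_gammaDensity_mul_exp ht1 hr, Complex.Gamma_add_one _ hs0,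
      Complex.Gamma_add_one _ ht0, neg_add, neg_add, Complex.cpow_add _ _ hr1,
      Complex.cpow_add _ _ hr1, sub_eq_add_neg (-(s + t)), neg_add, Complex.cpow_add _ _ hr1,
      Complex.cpow_add _ _ hr1]
    ring
  have e4 : ∫ r, ∫ p : ℝ × ℝ, gammaDensity s p.1 * gammaDensity t p.2 *
        (((p.2 - p.1) * Real.exp (-(r * (p.2 + p.1))) : ℝ) : ℂ) ∂(posMeasure.prod posMeasure)
        ∂posMeasure = ∫ r : ℝ, Complex.Gamma s * Complex.Gamma t * (t - s) *
          ((1 + r : ℝ) : ℂ) ^ (-(s + t) - 1) ∂posMeasure := by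
    refine integral_congr_ae ?_
    filter_upwards [ae_posMeasure] with r hr
    exact e3 r hr
  rw [e4, integral_const_mul, integral_one_add_cpow (by simp; linarith), schurRatio, add_comm t s]
  ring

variable {n : ℕ}

lemma add_ne_zero_of_re_pos {s t : ℂ} (hs : 0 < s.re) (ht : 0 < t.re) : s + t ≠ 0 := fun h => by
  have := congrArg Complex.re h
  simp only [Complex.add_re, Complex.zero_re] at this
  linarith

/-- The expansion of Schur's product is used twice: in the integration variables, and, read
backwards, in the exponents. The moments of the Gamma densities are exactly the missing Gamma
factors. -/
lemma schurIntegral_gammaDensity_odd (hn : Even n)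
    (ih : ∀ α : Fin n → ℂ, (∀ i, 0 < (α i).re) →
      schurIntegral (fun i => gammaDensity (α i)) = (∏ i, Complex.Gamma (α i)) * schurProd α)
    {α : Fin (n + 1) → ℂ} (hα : ∀ i, 0 < (α i).re) (hinj : Function.Injective α) :
    schurIntegral (fun i => gammaDensity (α i)) = (∏ i, Complex.Gamma (α i)) * schurProd α := by
  rw [schurIntegral_odd hn fun i => integrable_gammaDensity (hα i),
    schurProd_odd hn hinj fun i j => add_ne_zero_of_re_pos (hα i) (hα j), Finset.mul_sum]
  refine Finset.sum_congr rfl fun k _ => ?_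
  have : k.removeNth (fun i => gammaDensity (α i)) = fun i => gammaDensity (k.removeNth α i) := rfl
  rw [this, ih (k.removeNth α) fun i => hα _, integral_gammaDensity (hα k), Fin.prod_univ_succAbove _ k]
  simp only [Fin.removeNth_apply]
  ring

/-- As in the odd case, with the two-variable moment `integral_gammaDensity_schurRatio` in place of
the one-variable one. -/
lemma schurIntegral_gammaDensity_even (hn : Even n)
    (ih : ∀ α : Fin n → ℂ, (∀ i, 0 < (α i).re) →
      schurIntegral (fun i => gammaDensity (α i)) = (∏ i, Complex.Gamma (α i)) * schurProd α)
    {β : ℂ} (hβ : 0 < β.re)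
    {α : Fin (n + 1) → ℂ} (hα : ∀ i, 0 < (α i).re) (hinj : Function.Injective α) :
    schurIntegral (Fin.cons (gammaDensity β) fun i => gammaDensity (α i) :
        Fin (n + 2) → ℝ → ℂ) =
      (Complex.Gamma β * ∏ i, Complex.Gamma (α i)) * ((∏ i, schurRatio β (α i)) * schurProd α) := by
  have hβ0 : β ≠ 0 := fun h => by simp [h] at hβ
  have hI := fun i => integrable_gammaDensity (hα i)
  rw [schurIntegral_cons (integrable_gammaDensity hβ) hI,
    schurProd_even hn hβ0 hinj (fun i j => add_ne_zero_of_re_pos (hα i) (hα j))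
      fun i => add_ne_zero_of_re_pos (hα i) hβ, Finset.mul_sum]
  have h1 : ∫ x, gammaDensity β x * schurCofactor (fun i => gammaDensity (α i)) x ∂posMeasure =
      ∫ x, ∑ k : Fin (n + 1), (-1) ^ (k : ℕ) * schurIntegral (k.removeNth fun i =>
        gammaDensity (α i)) * (gammaDensity β x *
        ∫ y, gammaDensity (α k) y * ((schurRatio x y : ℝ) : ℂ) ∂posMeasure) ∂posMeasure := by
    refine integral_congr_ae ?_
    filter_upwards [ae_posMeasure] with x hx
    rw [schurCofactor_even hn hI hx, Finset.mul_sum]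
    exact Finset.sum_congr rfl fun k _ => by ring
  rw [h1, integral_finsetSum]
  · refine Finset.sum_congr rfl fun k _ => ?_
    have : k.removeNth (fun i => gammaDensity (α i)) = fun i => gammaDensity (k.removeNth α i) := rfl
    rw [integral_const_mul, integral_gammaDensity_schurRatio hβ (hα k), this, ih (k.removeNth α) fun i => hα _,
      Fin.prod_univ_succAbove _ k]
    simp only [Fin.removeNth_apply]
    ring
  · intro k _
    refine Integrable.const_mul ((integrable_gammaDensity hβ).mul_bdd
      (c := ∫ y, ‖gammaDensity (α k) y‖ ∂posMeasure) ?_ ?_) _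
    · refine AEStronglyMeasurable.integral_prod_right' (f := fun p : ℝ × ℝ =>
        gammaDensity (α k) p.2 * ((schurRatio p.1 p.2 : ℝ) : ℂ)) ?_
      have := measurable_gammaDensity (α k)
      exact Measurable.aestronglyMeasurable (by fun_prop)
    · filter_upwards [ae_posMeasure] with x hx
      refine norm_integral_le_of_norm_le (hI k).norm ?_
      filter_upwards [ae_posMeasure] with y hy
      rw [norm_mul, Complex.norm_real, Real.norm_eq_abs]
      exact mul_le_of_le_one_right (norm_nonneg _) (abs_schurRatio_le hx hy)

/-- Schur's product reproduces itself under integration against Gamma densities. -/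
theorem schurIntegral_gammaDensity (α : Fin n → ℂ) (hα : ∀ i, 0 < (α i).re) :
    schurIntegral (fun i => gammaDensity (α i)) = (∏ i, Complex.Gamma (α i)) * schurProd α := by
  -- The expansion in the exponents needs them distinct; if two coincide, antisymmetry makes both
  -- sides vanish.
  have coincide : ∀ {m : ℕ} {α : Fin m → ℂ}, ¬Function.Injective α →
      schurIntegral (fun i => gammaDensity (α i)) = (∏ i, Complex.Gamma (α i)) * schurProd α := by
    intro m α h
    simp only [Function.Injective, not_forall] at h
    obtain ⟨i, j, hij, hne⟩ := h
    rw [schurProd_eq_zero_of_eq hne hij, mul_zero]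
    exact schurIntegral_eq_zero_of_eq hne (by simp only [hij])
  -- Even numbers of variables are reached in steps of two; an odd number then reduces to the even
  -- number below it.
  have even : ∀ m : ℕ, Even m → ∀ α : Fin m → ℂ, (∀ i, 0 < (α i).re) →
      schurIntegral (fun i => gammaDensity (α i)) = (∏ i, Complex.Gamma (α i)) * schurProd α := by
    intro m hm
    obtain ⟨k, rfl⟩ := hm
    induction k with
    | zero =>
      intro α _
      simp [schurIntegral, schurProd, measureReal_def]
    | succ k ih =>
      have he : k + 1 + (k + 1) = k + k + 2 := by ring
      rw [he]
      intro α hα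
      by_cases hinj : Function.Injective α
      · have h := schurIntegral_gammaDensity_even ⟨k, rfl⟩ ih (hα 0) (fun i => hα i.succ)
          (fun i j hij => Fin.succ_injective _ (hinj hij))
        have hc : (Fin.cons (gammaDensity (α 0)) fun i => gammaDensity (α i.succ) :
            Fin (k + k + 2) → ℝ → ℂ) = fun i => gammaDensity (α i) := by
          funext i
          induction i using Fin.cases <;> rfl
        rw [hc, ← schurProd_cons, ← Fin.prod_univ_succ (fun i => Complex.Gamma (α i))] at h
        rw [h]
        congr 2
        exact Fin.cons_self_tail α
      · exact coincide hinj
  rcases n.even_or_odd with hn | ⟨k, rfl⟩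
  · exact even n hn α hα
  · by_cases hinj : Function.Injective α
    · exact schurIntegral_gammaDensity_odd (even_two_mul k) (even _ (even_two_mul k)) hα hinj
    · exact coincide hinj

end GammaDensity
end

/-! ### Determinantal expansions of the partition functions. -/

noncomputable section

/-- The exponents `i + a + 1` of the Gamma densities `x ^ i x ^ a e^{-x}`. -/
def buresExponent (a : ℝ) {n : ℕ} (i : Fin n) : ℂ := i + a + 1

/-- The weight `x ^ a e^{-x}` divided by `x - κ`. -/
def cauchyDensity (a : ℝ) (κ : ℂ) (x : ℝ) : ℂ := ((x : ℂ) - κ)⁻¹ * gammaDensity (a + 1) x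

section Determinants

variable {n : ℕ}

lemma det_cons_expand (G : Fin (n + 1) → ℂ → ℂ) (x : ℂ) (z : Fin n → ℂ) :
    (Matrix.of fun i j => G j ((Fin.cons x z : Fin (n + 1) → ℂ) i)).det =
      ∑ k : Fin (n + 1), (-1) ^ (k : ℕ) * G k x *
        (Matrix.of fun i j => G (k.succAbove j) (z i)).det := by
  rw [Matrix.det_succ_row_zero]
  rfl

lemma det_vandermonde_cons (x : ℂ) (z : Fin n → ℂ) :
    (Matrix.vandermonde (Fin.cons x z : Fin (n + 1) → ℂ)).det =
      (∏ i, (z i - x)) * (Matrix.vandermonde z).det := by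
  rw [Matrix.det_vandermonde, Matrix.det_vandermonde]
  simp [Fin.prod_univ_succ, Fin.prod_Ioi_succ]

/-- Multiplying each row by `z_i - κ` turns the columns into the monic polynomials `1, (X - κ) X^j`
of degrees `0, 1, …, n`, whose determinant is the Vandermonde determinant. -/
lemma det_cauchy_vandermonde {κ : ℂ} {z : Fin (n + 1) → ℂ} (hz : ∀ i, z i ≠ κ) :
    (Matrix.of fun i j => (Fin.cons (fun x => (x - κ)⁻¹) (fun (j : Fin n) x => x ^ (j : ℕ)) :
      Fin (n + 1) → ℂ → ℂ) j (z i)).det = (∏ i, (z i - κ))⁻¹ * (Matrix.vandermonde z).det := by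
  have h := Matrix.det_eval_matrixOfPolynomials_eq_det_vandermonde z
    (Fin.cons 1 fun j : Fin n => (Polynomial.X - Polynomial.C κ) * Polynomial.X ^ (j : ℕ))
    (fun i => by
      induction i using Fin.cases with
      | zero => simp
      | succ i =>
        rw [Fin.cons_succ, (Polynomial.monic_X_sub_C κ).natDegree_mul (Polynomial.monic_X_pow _)]
        simp [add_comm])
    (fun i => by
      induction i using Fin.cases with
      | zero => simp
      | succ i => exact (Polynomial.monic_X_sub_C κ).mul (Polynomial.monic_X_pow _))
  rw [h, ← Finset.prod_inv_distrib, ← Matrix.det_mul_column]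
  congr 1
  ext i j
  have := sub_ne_zero.2 (hz i)
  induction j using Fin.cases with
  | zero => simp
  | succ j =>
    simp only [Matrix.of_apply, Fin.cons_succ, Polynomial.eval_mul, Polynomial.eval_sub,
      Polynomial.eval_X, Polynomial.eval_C, Polynomial.eval_pow]
    field_simp

/-- After multiplying the rows by `(z_i - κ₁)(z_i - κ₂)` the first two columns are `z_i - κ₂` and
`z_i - κ₁`. Their difference is the constant `κ₁ - κ₂`, so one column operation leads to monic
polynomials of degrees `0, 1, 2, …` and this prefactor. -/
lemma det_cauchy_vandermonde_two {κ₁ κ₂ : ℂ} {z : Fin (n + 2) → ℂ} (h₁ : ∀ i, z i ≠ κ₁)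
    (h₂ : ∀ i, z i ≠ κ₂) :
    (Matrix.of fun i j => (Fin.cons (fun x => (x - κ₁)⁻¹) (Fin.cons (fun x => (x - κ₂)⁻¹)
      (fun (j : Fin n) x => x ^ (j : ℕ))) : Fin (n + 2) → ℂ → ℂ) j (z i)).det =
      (κ₁ - κ₂) * ((∏ i, (z i - κ₁) * (z i - κ₂))⁻¹ * (Matrix.vandermonde z).det) := by
  have h := Matrix.det_eval_matrixOfPolynomials_eq_det_vandermonde z
    (Fin.cons 1 (Fin.cons (Polynomial.X - Polynomial.C κ₁) fun j : Fin n =>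
      (Polynomial.X - Polynomial.C κ₁) * (Polynomial.X - Polynomial.C κ₂) *
        Polynomial.X ^ (j : ℕ)))
    (fun i => by
      induction i using Fin.cases with
      | zero => simp
      | succ i =>
        induction i using Fin.cases with
        | zero => simp
        | succ i =>
          rw [Fin.cons_succ, Fin.cons_succ, ((Polynomial.monic_X_sub_C κ₁).mul
            (Polynomial.monic_X_sub_C κ₂)).natDegree_mul (Polynomial.monic_X_pow _),
            (Polynomial.monic_X_sub_C κ₁).natDegree_mul (Polynomial.monic_X_sub_C κ₂)]
          simp only [Polynomial.natDegree_X_sub_C, Polynomial.natDegree_X_pow, Fin.val_succ]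
          ring)
    (fun i => by
      induction i using Fin.cases with
      | zero => simp
      | succ i =>
        induction i using Fin.cases with
        | zero => exact Polynomial.monic_X_sub_C κ₁
        | succ i => exact ((Polynomial.monic_X_sub_C κ₁).mul
            (Polynomial.monic_X_sub_C κ₂)).mul (Polynomial.monic_X_pow _))
  have hc : κ₁ - κ₂ = ∏ j : Fin (n + 2), (Fin.cons (κ₁ - κ₂) 1 : Fin (n + 2) → ℂ) j := by
    simp [Fin.prod_univ_succ]
  rw [h, ← Finset.prod_inv_distrib, ← Matrix.det_mul_column, hc, ← Matrix.det_mul_row,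
    ← Matrix.det_updateCol_add_smul_self _ (Fin.succ_ne_zero 0).symm (-1)]
  congr 1
  ext i j
  have k₁ := sub_ne_zero.2 (h₁ i)
  have k₂ := sub_ne_zero.2 (h₂ i)
  induction j using Fin.cases with
  | zero =>
    rw [Matrix.updateCol_self]
    simp
    field_simp
    ring
  | succ j =>
    rw [Matrix.updateCol_ne (Fin.succ_ne_zero j)]
    induction j using Fin.cases with
    | zero =>
      simp
      field_simp
    | succ j =>
      simp
      field_simp

end Determinants

section PartitionFunction

variable {a : ℝ}

lemma buresExponent_re (ha : -1 < a) {n : ℕ} (i : Fin n) : 0 < (buresExponent a i).re := by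
  have : (0 : ℝ) ≤ (i : ℕ) := Nat.cast_nonneg _
  simp only [buresExponent, Complex.add_re, Complex.natCast_re, Complex.ofReal_re, Complex.one_re]
  linarith

lemma ofReal_weight {x : ℝ} (hx : 0 < x) :
    ((x ^ a * Real.exp (-x) : ℝ) : ℂ) = gammaDensity (a + 1) x := by
  rw [gammaDensity, add_sub_cancel_right, Complex.ofReal_mul, Complex.ofReal_cpow hx.le]

lemma pow_mul_gammaDensity {x : ℝ} (hx : 0 < x) {n : ℕ} (i : Fin n) :
    (x : ℂ) ^ (i : ℕ) * gammaDensity (a + 1) x = gammaDensity (buresExponent a i) x := by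
  have : (x : ℂ) ≠ 0 := by exact_mod_cast hx.ne'
  rw [gammaDensity, gammaDensity, buresExponent, ← mul_assoc, ← Complex.cpow_natCast,
    ← Complex.cpow_add _ _ this]
  ring_nf

/-- Partition functions as sums of `schurIntegral`s, from an expansion of the Vandermonde
determinant times the characteristic polynomials in determinants. -/
lemma buresZ_eq_sum_schurIntegral {ι : Type*} [Fintype ι] {N k l : ℕ} {κ : Fin k → ℂ}
    {lam : Fin l → ℂ} {c : ℂ} {b : ι → ℂ} {g : ι → Fin N → ℂ → ℂ} {f : ι → Fin N → ℝ → ℂ}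
    (hf : ∀ p i, Integrable (f p i) posMeasure)
    (hfg : ∀ p i x, 0 < x → f p i x = g p i x * gammaDensity (a + 1) x)
    (hdet : ∀ z : Fin N → ℝ, (∀ i, 0 < z i) →
      ∑ p, b p * (Matrix.of fun i j => g p j (z i)).det =
        c * ((Matrix.vandermonde fun i => (z i : ℂ)).det *
          ∏ j, ((∏ i, ((z j : ℂ) - lam i)) / ∏ i, ((z j : ℂ) - κ i)))) :
    c * buresZ N a κ lam = ∑ p, b p * schurIntegral (f p) := by
  have h1 : c * buresZ N a κ lam = (1 / (N.factorial : ℂ)) *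
      ∫ z, ∑ p, ∑ σ : Equiv.Perm (Fin N), b p * ((Equiv.Perm.sign σ : ℂ) *
        ((∏ i, (f p ∘ σ) i (z i)) * ((schurProd z : ℝ) : ℂ)))
        ∂(Measure.pi fun _ : Fin N => posMeasure) := by
    rw [buresZ, ← pi_posMeasure, mul_left_comm, ← integral_const_mul]
    congr 1
    refine integral_congr_ae ?_
    filter_upwards [ae_pi_pos] with z hz
    have h := hdet z hz
    -- One power of each difference goes into the Vandermonde determinant, the other into Schur's
    -- product.
    have e1 : ((∏ i : Fin N, ∏ j ∈ Finset.Ioi i, (z j - z i) ^ 2 / (z i + z j) : ℝ) : ℂ) =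
        (Matrix.vandermonde fun i => (z i : ℂ)).det * ((schurProd z : ℝ) : ℂ) := by
      rw [Matrix.det_vandermonde, schurProd]
      push_cast
      rw [← Finset.prod_mul_distrib]
      refine Finset.prod_congr rfl fun i _ => ?_
      rw [← Finset.prod_mul_distrib]
      refine Finset.prod_congr rfl fun j _ => ?_
      rw [schurRatio]
      push_cast
      rw [add_comm (z i : ℂ)]
      ring
    have e2 : ((∏ j : Fin N, (z j ^ a * Real.exp (-z j)) : ℝ) : ℂ) =
        ∏ j, gammaDensity (a + 1) (z j) := by
      rw [Complex.ofReal_prod]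
      exact Finset.prod_congr rfl fun j _ => ofReal_weight (hz j)
    rw [Complex.ofReal_mul, e1, e2]
    calc _ = (c * ((Matrix.vandermonde fun i => (z i : ℂ)).det *
          ∏ j, ((∏ i, ((z j : ℂ) - lam i)) / ∏ i, ((z j : ℂ) - κ i)))) *
          ((∏ j, gammaDensity (a + 1) (z j)) * ((schurProd z : ℝ) : ℂ)) := by ring
      _ = _ := by
        rw [← h, Finset.sum_mul]
        refine Finset.sum_congr rfl fun p _ => ?_
        rw [← Matrix.det_transpose, Matrix.det_apply', Finset.mul_sum, Finset.sum_mul]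
        refine Finset.sum_congr rfl fun σ _ => ?_
        have : ∏ i, (f p ∘ σ) i (z i) =
            (∏ i, g p (σ i) (z i)) * ∏ j, gammaDensity (a + 1) (z j) := by
          rw [← Finset.prod_mul_distrib]
          exact Finset.prod_congr rfl fun i _ => hfg p (σ i) (z i) (hz i)
        rw [this]
        simp only [Matrix.transpose_apply, Matrix.of_apply]
        ring
  have hint : ∀ p (σ : Equiv.Perm (Fin N)), Integrable (fun z => b p * ((Equiv.Perm.sign σ : ℂ) *
        ((∏ i, (f p ∘ σ) i (z i)) * ((schurProd z : ℝ) : ℂ))))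
        (Measure.pi fun _ : Fin N => posMeasure) := fun p σ =>
    ((integrable_prod_mul (fun i => hf p (σ i)) measurable_schurProd
      fun _ => abs_schurProd_le).const_mul _).const_mul _
  rw [h1, integral_finsetSum _ fun p _ => integrable_finsetSum _ fun σ _ => hint p σ,
    Finset.mul_sum]
  refine Finset.sum_congr rfl fun p _ => ?_
  rw [integral_finsetSum _ fun σ _ => hint p σ]
  -- The sign from the Leibniz formula meets the sign from the antisymmetry of `schurIntegral`; so
  -- all `N!` terms agree and cancel the prefactor `1/N!`.
  have h2 : ∀ σ : Equiv.Perm (Fin N), ∫ z, b p * ((Equiv.Perm.sign σ : ℂ) *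
        ((∏ i, (f p ∘ σ) i (z i)) * ((schurProd z : ℝ) : ℂ)))
        ∂(Measure.pi fun _ : Fin N => posMeasure) = b p * schurIntegral (f p) := fun σ => by
    rw [integral_const_mul, integral_const_mul]
    have := schurIntegral_comp_perm (f p) σ
    rw [schurIntegral] at this
    rw [this, ← mul_assoc (_ : ℂ) (_ : ℂ) (schurIntegral _)]
    rcases Int.units_eq_one_or (Equiv.Perm.sign σ) with h | h <;> simp [h]
  have hN : (N.factorial : ℂ) ≠ 0 := by exact_mod_cast N.factorial_ne_zero
  simp only [h2, Finset.sum_const, Finset.card_univ, Fintype.card_perm, Fintype.card_fin,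
    nsmul_eq_mul]
  field_simp

lemma integrable_buresExponent (ha : -1 < a) {n : ℕ} (i : Fin n) :
    Integrable (gammaDensity (buresExponent a i)) posMeasure :=
  integrable_gammaDensity (buresExponent_re ha i)

lemma buresZ_zero_zero (ha : -1 < a) (N : ℕ) (κ lam : Fin 0 → ℂ) :
    buresZ N a κ lam = (∏ i : Fin N, Complex.Gamma (buresExponent a i)) *
      schurProd fun i : Fin N => buresExponent a i := by
  rw [← schurIntegral_gammaDensity _ fun i => buresExponent_re ha i]
  have := buresZ_eq_sum_schurIntegral (a := a) (ι := Unit) (N := N) (κ := κ) (lam := lam) (c := 1)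
    (b := fun _ => 1) (g := fun _ j x => x ^ (j : ℕ))
    (f := fun _ i => gammaDensity (buresExponent a i))
    (fun _ i => integrable_buresExponent ha i)
    (fun _ i x hx => (pow_mul_gammaDensity hx i).symm)
    (fun z _ => by simp; rfl)
  simpa using this

/-- The characteristic polynomial extends the Vandermonde determinant by the variable `lam`;
expanding along its row omits one power in each term. -/
lemma buresZ_zero_one (ha : -1 < a) (N : ℕ) (lam : ℂ) :
    buresZ N a ![] ![lam] = ∑ k : Fin (N + 1), (-1) ^ (k : ℕ) * lam ^ (k : ℕ) *
      schurIntegral (k.removeNth fun i => gammaDensity (buresExponent a i)) := by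
  rw [← one_mul (buresZ _ _ _ _)]
  refine buresZ_eq_sum_schurIntegral (a := a)
    (g := fun (k : Fin (N + 1)) (j : Fin N) (x : ℂ) => x ^ ((k.succAbove j : Fin (N + 1)) : ℕ))
    (fun k i => integrable_buresExponent ha _)
    (fun k i x hx => (pow_mul_gammaDensity hx (k.succAbove i)).symm) fun z _ => ?_
  have h := det_vandermonde_cons lam fun i => (z i : ℂ)
  have h' := det_cons_expand (fun j x => x ^ (j : ℕ)) lam fun i => (z i : ℂ)
  rw [← h']
  simp only [one_mul, Fin.prod_univ_one, Matrix.cons_val_zero, Finset.univ_eq_empty,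
    Finset.prod_empty, div_one]
  rw [mul_comm, ← h]
  rfl

/-- The Vandermonde determinant in `lam₁, lam₂, z` is expanded along its first two rows, which omits
two powers. -/
lemma buresZ_zero_two (ha : -1 < a) (N : ℕ) (lam₁ lam₂ : ℂ) :
    (lam₂ - lam₁) * buresZ N a ![] ![lam₁, lam₂] =
      ∑ p : Fin (N + 2) × Fin (N + 1),
      ((-1) ^ (p.1 : ℕ) * lam₁ ^ (p.1 : ℕ) * ((-1) ^ (p.2 : ℕ) *
        lam₂ ^ (p.1.succAbove p.2 : ℕ))) *
      schurIntegral (p.2.removeNth (p.1.removeNth fun i => gammaDensity (buresExponent a i))) := by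
  refine buresZ_eq_sum_schurIntegral
    (a := a) (g := fun (p : Fin (N + 2) × Fin (N + 1)) (j : Fin N) (x : ℂ) =>
      x ^ ((p.1.succAbove (p.2.succAbove j) : Fin (N + 2)) : ℕ))
    (fun k i => integrable_buresExponent ha _)
    (fun p i x hx => (pow_mul_gammaDensity hx (p.1.succAbove (p.2.succAbove i))).symm)
    fun z _ => ?_
  have h := det_vandermonde_cons lam₁ (Fin.cons lam₂ fun i => (z i : ℂ))
  have h2 := det_cons_expand (fun j x => x ^ (j : ℕ)) lam₁ (Fin.cons lam₂ fun i => (z i : ℂ))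
  have h3 : ∀ k : Fin (N + 2), _ := fun k =>
    det_cons_expand (fun j x => x ^ (k.succAbove j : ℕ)) lam₂ fun i => (z i : ℂ)
  simp only [h3, Finset.mul_sum] at h2
  rw [Fintype.sum_prod_type]
  simp only [mul_assoc] at h2 ⊢
  refine h2.symm.trans (h.trans ?_)
  rw [det_vandermonde_cons, Fin.prod_univ_succ]
  simp only [Fin.cons_zero, Fin.cons_succ, Fin.prod_univ_two, Matrix.cons_val_zero,
    Matrix.cons_val_one, Finset.univ_eq_empty, Finset.prod_empty, div_one, Finset.prod_mul_distrib]
  ring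

/-- A point off the closed half-line has positive distance to it. -/
lemma norm_inv_sub_le {κ : ℂ} (hκ : ∀ x : ℝ, 0 ≤ x → κ ≠ x) :
    ∃ C, ∀ x : ℝ, 0 < x → ‖((x : ℂ) - κ)⁻¹‖ ≤ C := by
  have hc : IsClosed ((fun x : ℝ => (x : ℂ)) '' Ici 0) :=
    Complex.isometry_ofReal.isClosedEmbedding.isClosedMap _ isClosed_Ici
  have hmem : κ ∈ ((fun x : ℝ => (x : ℂ)) '' Ici 0)ᶜ := by
    rintro ⟨x, hx, rfl⟩
    exact hκ x hx rfl
  obtain ⟨ε, hε, hb⟩ := Metric.isOpen_iff.1 hc.isOpen_compl κ hmem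
  refine ⟨ε⁻¹, fun x hx => ?_⟩
  rw [norm_inv]
  refine inv_anti₀ hε (not_lt.1 fun h => hb (a := (x : ℂ)) ?_ ⟨x, le_of_lt hx, rfl⟩)
  rwa [mem_ball_iff_norm]

lemma integrable_cauchyDensity (ha : -1 < a) {κ : ℂ} (hκ : ∀ x : ℝ, 0 ≤ x → κ ≠ x) :
    Integrable (cauchyDensity a κ) posMeasure := by
  obtain ⟨C, hC⟩ := norm_inv_sub_le hκ
  refine Integrable.bdd_mul (c := C) (integrable_gammaDensity (by simp; linarith)) ?_ ?_
  · exact Measurable.aestronglyMeasurable (by fun_prop)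
  · filter_upwards [ae_posMeasure] with x hx using hC x hx

lemma buresZ_one_zero (ha : -1 < a) (N : ℕ) {κ : ℂ} (hκ : ∀ x : ℝ, 0 ≤ x → κ ≠ x) :
    buresZ (N + 1) a ![κ] ![] = schurIntegral (Fin.cons (cauchyDensity a κ)
      fun i : Fin N => gammaDensity (buresExponent a i) : Fin (N + 1) → ℝ → ℂ) := by
  have := buresZ_eq_sum_schurIntegral (a := a) (ι := Unit) (N := N + 1) (κ := ![κ]) (lam := ![])
    (c := 1) (b := fun _ => 1)
    (g := fun _ => Fin.cons (fun x => (x - κ)⁻¹) (fun (j : Fin N) x => x ^ (j : ℕ)))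
    (f := fun _ => Fin.cons (cauchyDensity a κ) fun i => gammaDensity (buresExponent a i))
    (fun _ i => by
      induction i using Fin.cases with
      | zero => exact integrable_cauchyDensity ha hκ
      | succ i => exact integrable_buresExponent ha i)
    (fun _ i x hx => by
      induction i using Fin.cases with
      | zero => rfl
      | succ i => exact (pow_mul_gammaDensity hx i).symm)
    (fun z hz => by
      have := det_cauchy_vandermonde (z := fun i => (z i : ℂ)) fun i => (hκ _ (hz i).le).symm
      simp only [Finset.univ_unique, Finset.sum_singleton, one_mul, this]
      simp [mul_comm])
  simpa using this

lemma buresZ_two_zero (ha : -1 < a) (N : ℕ) {κ₁ κ₂ : ℂ} (h₁ : ∀ x : ℝ, 0 ≤ x → κ₁ ≠ x)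
    (h₂ : ∀ x : ℝ, 0 ≤ x → κ₂ ≠ x) :
    (κ₁ - κ₂) * buresZ (N + 2) a ![κ₁, κ₂] ![] =
      schurIntegral (Fin.cons (cauchyDensity a κ₁) (Fin.cons (cauchyDensity a κ₂)
      fun i : Fin N => gammaDensity (buresExponent a i)) : Fin (N + 2) → ℝ → ℂ) := by
  have := buresZ_eq_sum_schurIntegral (a := a) (ι := Unit) (N := N + 2) (κ := ![κ₁, κ₂])
    (lam := ![]) (c := κ₁ - κ₂) (b := fun _ => 1)
    (g := fun _ => Fin.cons (fun x => (x - κ₁)⁻¹) (Fin.cons (fun x => (x - κ₂)⁻¹)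
      (fun (j : Fin N) x => x ^ (j : ℕ))))
    (f := fun _ => Fin.cons (cauchyDensity a κ₁) (Fin.cons (cauchyDensity a κ₂)
      fun i => gammaDensity (buresExponent a i)))
    (fun _ i => by
      induction i using Fin.cases with
      | zero => exact integrable_cauchyDensity ha h₁
      | succ i =>
        induction i using Fin.cases with
        | zero => exact integrable_cauchyDensity ha h₂
        | succ i => exact integrable_buresExponent ha i)
    (fun _ i x hx => by
      induction i using Fin.cases with
      | zero => rfl
      | succ i =>
        induction i using Fin.cases with
        | zero => rfl
        | succ i => exact (pow_mul_gammaDensity hx i).symm)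
    (fun z hz => by
      have := det_cauchy_vandermonde_two (z := fun i => (z i : ℂ))
        (fun i => (h₁ _ (hz i).le).symm) fun i => (h₂ _ (hz i).le).symm
      simp only [Finset.univ_unique, Finset.sum_singleton, one_mul, this]
      simp [mul_comm (Matrix.det _), Finset.prod_mul_distrib])
  simpa using this

/-- Expand the Cauchy–Vandermonde determinant in the variables `lam, z` along the row of `lam`. The
Cauchy entry of that row leaves an ordinary Vandermonde determinant, which is the separate first
term; every other entry leaves the Cauchy column and omits one power. -/
lemma buresZ_one_one (ha : -1 < a) (N : ℕ) {κ lam : ℂ} (hκ : ∀ x : ℝ, 0 ≤ x → κ ≠ x)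
    (hne : κ ≠ lam) :
    (lam - κ)⁻¹ * buresZ (N + 1) a ![κ] ![lam] =
      (lam - κ)⁻¹ * buresZ (N + 1) a ![] ![] - ∑ k : Fin (N + 1), (-1) ^ (k : ℕ) *
        lam ^ (k : ℕ) * schurIntegral (Fin.cons (cauchyDensity a κ)
      (k.removeNth fun i => gammaDensity (buresExponent a i)) : Fin (N + 1) → ℝ → ℂ) := by
  have h := buresZ_eq_sum_schurIntegral (a := a) (ι := Fin (N + 2)) (N := N + 1) (κ := ![κ])
    (lam := ![lam]) (c := (lam - κ)⁻¹)
    (b := fun k => (-1) ^ (k : ℕ) * (Fin.cons (fun x => (x - κ)⁻¹)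
      (fun (j : Fin (N + 1)) x => x ^ (j : ℕ)) : Fin (N + 2) → ℂ → ℂ) k lam)
    (g := fun k j => (Fin.cons (fun x => (x - κ)⁻¹)
      (fun (j : Fin (N + 1)) x => x ^ (j : ℕ)) : Fin (N + 2) → ℂ → ℂ) (k.succAbove j))
    (f := fun k i => (Fin.cons (cauchyDensity a κ)
      (fun i => gammaDensity (buresExponent a i)) : Fin (N + 2) → ℝ → ℂ) (k.succAbove i))
    (fun k i => by
      induction k.succAbove i using Fin.cases with
      | zero => exact integrable_cauchyDensity ha hκ
      | succ i => exact integrable_buresExponent ha i)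
    (fun k i x hx => by
      induction k.succAbove i using Fin.cases with
      | zero => rfl
      | succ i => exact (pow_mul_gammaDensity hx i).symm)
    (fun z hz => by
      have h0 := det_cons_expand (Fin.cons (fun x => (x - κ)⁻¹)
        (fun (j : Fin (N + 1)) x => x ^ (j : ℕ))) lam fun i => (z i : ℂ)
      rw [← h0, det_cauchy_vandermonde, det_vandermonde_cons, Fin.prod_univ_succ]
      · simp
        ring
      · intro i
        induction i using Fin.cases with
        | zero => exact hne.symm
        | succ i => exact (hκ _ (hz i).le).symm)
  rw [h, Fin.sum_univ_succ, buresZ_zero_zero ha, ← schurIntegral_gammaDensity _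
    fun i => buresExponent_re ha i, sub_eq_add_neg, ← Finset.sum_neg_distrib]
  congr 1
  · simp
  · refine Finset.sum_congr rfl fun k _ => ?_
    have : (fun i => (Fin.cons (cauchyDensity a κ)
      (fun i => gammaDensity (buresExponent a i)) : Fin (N + 2) → ℝ → ℂ) (k.succ.succAbove i)) =
      (Fin.cons (cauchyDensity a κ)
      (k.removeNth fun i => gammaDensity (buresExponent a i)) : Fin (N + 1) → ℝ → ℂ) := by
      funext i
      induction i using Fin.cases with
      | zero => simp
      | succ i => simp [Fin.removeNth_apply]
    rw [this]
    simp [pow_succ]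

lemma buresZ_of_isEmpty {k l : ℕ} (κ : Fin k → ℂ) (lam : Fin l → ℂ) :
    buresZ 0 a κ lam = 1 := by
  rw [buresZ, ← pi_posMeasure]
  simp [measureReal_def]

end PartitionFunction
end

/-! ### Functions of exponential decay on vertical strips. -/

noncomputable section

/-- `f` is holomorphic on the strip `l < Re s < r` and is `O(e^{-θ'|Im s|})` on closed substrips
for all `θ' < θ`. -/
structure StripDecay (l r θ : ℝ) (f : ℂ → ℂ) : Prop where
  diff : DifferentiableOn ℂ f (Complex.re ⁻¹' Ioo l r)
  bound : ∀ u v θ' : ℝ, l < u → v < r → θ' < θ →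
    ∃ C, ∀ s : ℂ, u ≤ s.re → s.re ≤ v → ‖f s‖ ≤ C * Real.exp (-θ' * |s.im|)

namespace StripDecay

variable {l r θ θ₁ θ₂ : ℝ} {f g : ℂ → ℂ}

lemma mono (hf : StripDecay l r θ f) {l' r' θ' : ℝ} (hl : l ≤ l') (hr : r' ≤ r) (hθ : θ' ≤ θ) :
    StripDecay l' r' θ' f :=
  ⟨hf.diff.mono (preimage_mono (Ioo_subset_Ioo hl hr)), fun u v t hu hv ht =>
    hf.bound u v t (hl.trans_lt hu) (hv.trans_le hr) (ht.trans_le hθ)⟩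

lemma mul (hf : StripDecay l r θ₁ f) (hg : StripDecay l r θ₂ g) :
    StripDecay l r (θ₁ + θ₂) fun s => f s * g s := by
  refine ⟨hf.diff.mul hg.diff, fun u v t hu hv ht => ?_⟩
  obtain ⟨C, hC⟩ := hf.bound u v (θ₁ - (θ₁ + θ₂ - t) / 2) hu hv (by linarith)
  obtain ⟨D, hD⟩ := hg.bound u v (θ₂ - (θ₁ + θ₂ - t) / 2) hu hv (by linarith)
  refine ⟨C * D, fun s h1 h2 => ?_⟩
  rw [norm_mul]
  refine (mul_le_mul (hC s h1 h2) (hD s h1 h2) (norm_nonneg _)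
    ((norm_nonneg _).trans (hC s h1 h2))).trans_eq ?_
  rw [mul_mul_mul_comm, ← Real.exp_add]
  ring_nf

lemma sub (hf : StripDecay l r θ f) (hg : StripDecay l r θ g) :
    StripDecay l r θ fun s => f s - g s := by
  refine ⟨hf.diff.sub hg.diff, fun u v t hu hv ht => ?_⟩
  obtain ⟨C, hC⟩ := hf.bound u v t hu hv ht
  obtain ⟨D, hD⟩ := hg.bound u v t hu hv ht
  refine ⟨C + D, fun s h1 h2 => ?_⟩
  rw [add_mul]
  exact (norm_sub_le _ _).trans (add_le_add (hC s h1 h2) (hD s h1 h2))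

/-- It suffices to bound `f` for `|Im s| ≥ 1`. -/
lemma of_large (hd : DifferentiableOn ℂ f (Complex.re ⁻¹' Ioo l r))
    (hb : ∀ u v θ' : ℝ, l < u → v < r → θ' < θ →
      ∃ C, ∀ s : ℂ, u ≤ s.re → s.re ≤ v → 1 ≤ |s.im| → ‖f s‖ ≤ C * Real.exp (-θ' * |s.im|)) :
    StripDecay l r θ f := by
  refine ⟨hd, fun u v t hu hv ht => ?_⟩
  obtain ⟨C, hC⟩ := hb u v t hu hv ht
  have hK : IsCompact (Icc u v ×ℂ Icc (-1) 1) := isCompact_Icc.reProdIm isCompact_Icc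
  have hcont : ContinuousOn (fun s : ℂ => ‖f s‖ / Real.exp (-t * |s.im|))
      (Icc u v ×ℂ Icc (-1) 1) := by
    refine ((hd.continuousOn.mono fun s hs => ?_).norm).div (by fun_prop)
      fun _ _ => (Real.exp_pos _).ne'
    exact ⟨hu.trans_le (Complex.mem_reProdIm.1 hs).1.1, (Complex.mem_reProdIm.1 hs).1.2.trans_lt hv⟩
  obtain ⟨D, hD⟩ := (hK.image_of_continuousOn hcont).bddAbove
  refine ⟨max C D, fun s h1 h2 => ?_⟩
  rcases le_total 1 |s.im| with h | h
  · exact (hC s h1 h2 h).trans (mul_le_mul_of_nonneg_right (le_max_left _ _) (Real.exp_pos _).le)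
  · have := hD ⟨s, Complex.mem_reProdIm.2 ⟨⟨h1, h2⟩, abs_le.1 h⟩, rfl⟩
    rw [div_le_iff₀ (Real.exp_pos _)] at this
    exact this.trans (mul_le_mul_of_nonneg_right (le_max_right _ _) (Real.exp_pos _).le)

/-- A function that is bounded on closed substrips. -/
lemma of_bounded (hd : DifferentiableOn ℂ f (Complex.re ⁻¹' Ioo l r))
    (hb : ∀ u v : ℝ, l < u → v < r → ∃ C, ∀ s : ℂ, u ≤ s.re → s.re ≤ v → ‖f s‖ ≤ C) :
    StripDecay l r 0 f := by
  refine ⟨hd, fun u v t hu hv ht => ?_⟩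
  obtain ⟨C, hC⟩ := hb u v hu hv
  refine ⟨C, fun s h1 h2 => (hC s h1 h2).trans (le_mul_of_one_le_right
    ((norm_nonneg _).trans (hC s h1 h2)) (Real.one_le_exp ?_))⟩
  exact mul_nonneg (by linarith) (abs_nonneg _)

lemma const (c : ℂ) : StripDecay l r 0 fun _ => c :=
  of_bounded (differentiableOn_const c) fun _ _ _ _ => ⟨‖c‖, fun _ _ _ => le_rfl⟩

/-- Rate `0` asks only for bounds by `e^{δ|Im s|}` with arbitrarily small `δ > 0`, so polynomial
growth is allowed and polynomial factors cost no decay. -/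
lemma id : StripDecay l r 0 fun s => s := by
  refine ⟨differentiableOn_id, fun u v t hu hv ht => ?_⟩
  refine ⟨max |u| |v| + (-t)⁻¹, fun s h1 h2 => ?_⟩
  have ht' : 0 < -t := by linarith
  have h3 : |s.re| ≤ max |u| |v| := abs_le_max_abs_abs h1 h2
  have h4 : 1 ≤ Real.exp (-t * |s.im|) := Real.one_le_exp (mul_nonneg ht'.le (abs_nonneg _))
  have h5 : |s.im| ≤ (-t)⁻¹ * Real.exp (-t * |s.im|) := by
    rw [inv_mul_eq_div, le_div_iff₀ ht', mul_comm]
    linarith [Real.add_one_le_exp (-t * |s.im|)]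
  calc ‖s‖ ≤ |s.re| + |s.im| := Complex.norm_le_abs_re_add_abs_im s
    _ ≤ max |u| |v| * Real.exp (-t * |s.im|) + (-t)⁻¹ * Real.exp (-t * |s.im|) :=
      add_le_add (h3.trans (le_mul_of_one_le_right ((abs_nonneg _).trans h3) h4)) h5
    _ = _ := by ring

lemma add_const (c : ℂ) : StripDecay l r 0 fun s => s + c := by
  simpa using (id (l := l) (r := r)).sub (const (-c))

lemma const_sub (c : ℂ) : StripDecay l r 0 fun s => c - s := (const c).sub id

lemma inv_const_sub {c : ℝ} (hc : r ≤ c) : StripDecay l r 0 fun s => ((c : ℂ) - s)⁻¹ := by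
  refine of_bounded (fun s hs => ?_) fun u v hu hv => ⟨(c - v)⁻¹, fun s h1 h2 => ?_⟩
  · have : (c : ℂ) - s ≠ 0 := fun h => by
      have h1 := congrArg Complex.re h
      simp only [Complex.sub_re, Complex.ofReal_re, Complex.zero_re] at h1
      linarith [hs.2]
    exact ((differentiableAt_const _).sub differentiableAt_id).inv this |>.differentiableWithinAt
  · rw [norm_inv]
    refine inv_anti₀ (by linarith) ?_
    calc c - v ≤ ((c : ℂ) - s).re := by simp only [Complex.sub_re, Complex.ofReal_re]; linarith
      _ ≤ _ := Complex.re_le_norm _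

lemma prod {n : ℕ} {F : ℕ → ℂ → ℂ} (hF : ∀ j, StripDecay l r 0 (F j)) :
    StripDecay l r 0 fun s => ∏ j ∈ Finset.range n, F j s := by
  induction n with
  | zero => simpa using const 1
  | succ n ih =>
    simp only [Finset.prod_range_succ]
    simpa using ih.mul (hF n)

end StripDecay

lemma norm_Gamma_le {z : ℂ} (hz : 0 < z.re) : ‖Complex.Gamma z‖ ≤ Real.Gamma z.re := by
  rw [Complex.Gamma_eq_integral hz, Complex.GammaIntegral, Real.Gamma_eq_integral hz]
  refine (norm_integral_le_integral_norm _).trans_eq ?_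
  refine setIntegral_congr_fun measurableSet_Ioi fun x hx => ?_
  simp only [norm_mul, Complex.norm_real, Real.norm_eq_abs, Real.abs_exp]
  rw [Complex.norm_cpow_eq_rpow_re_of_pos hx, Complex.sub_re, Complex.one_re]

lemma Complex.Gamma_ne_pole {z : ℂ} (hz : 0 < z.re) (m : ℕ) : z ≠ -m := fun h => by
  have h1 := congrArg Complex.re h
  simp only [Complex.neg_re, Complex.natCast_re] at h1
  have : (0 : ℝ) ≤ m := Nat.cast_nonneg _
  linarith

namespace StripDecay

variable {l r θ : ℝ} {f : ℂ → ℂ}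

/-- On vertical lines the Gamma function is bounded by its value at the real part. The genuine decay
of this factor is not needed: the pair `Γ(-s) Γ(1 + M + s)` suffices. -/
lemma Gamma_sub {b : ℝ} (hb : r ≤ b) : StripDecay l r 0 fun s => Complex.Gamma (b - s) := by
  refine of_bounded (fun s hs => ?_) fun u v hu hv => ?_
  · have hre : 0 < ((b : ℂ) - s).re := by
      simp only [Complex.sub_re, Complex.ofReal_re]; linarith [hs.2]
    exact ((Complex.differentiableAt_Gamma _ (Complex.Gamma_ne_pole hre)).comp s
      ((differentiableAt_const _).sub differentiableAt_id)).differentiableWithinAt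
  · have hcont : ContinuousOn Real.Gamma (Icc (b - v) (b - u)) := fun x hx =>
      (Real.differentiableAt_Gamma fun m h => by
        have : (0 : ℝ) ≤ m := Nat.cast_nonneg _
        linarith [hx.1]).continuousAt.continuousWithinAt
    obtain ⟨C, hC⟩ := (isCompact_Icc.image_of_continuousOn hcont).bddAbove
    refine ⟨C, fun s h1 h2 => ?_⟩
    have hre : ((b : ℂ) - s).re = b - s.re := by simp
    refine (norm_Gamma_le (by rw [hre]; linarith)).trans (hC ⟨_, ?_, rfl⟩)
    rw [hre]
    exact ⟨by linarith, by linarith⟩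

/-- The modulus is `|x|^(Re s) e^{-arg x · Im s}`, so a power costs the rate `|arg x|`. -/
lemma cpow {x : ℂ} (hx : x ≠ 0) : StripDecay l r (-|x.arg|) fun s => x ^ s := by
  refine ⟨fun s _ => ?_, fun u v t hu hv ht => ?_⟩
  · exact (DifferentiableAt.const_cpow differentiableAt_id (Or.inl hx)).differentiableWithinAt
  · have hx' : 0 < ‖x‖ := norm_pos_iff.2 hx
    refine ⟨max (‖x‖ ^ u) (‖x‖ ^ v), fun s h1 h2 => ?_⟩
    rw [Complex.norm_cpow_of_ne_zero hx, div_eq_mul_inv, ← Real.exp_neg]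
    refine mul_le_mul ?_ (Real.exp_le_exp.2 ?_) (Real.exp_pos _).le
      ((Real.rpow_nonneg hx'.le _).trans (le_max_left _ _))
    · rcases le_total 1 ‖x‖ with h | h
      · exact (Real.rpow_le_rpow_of_exponent_le h h2).trans (le_max_right _ _)
      · exact (Real.rpow_le_rpow_of_exponent_ge hx' h h1).trans (le_max_left _ _)
    · calc -(x.arg * s.im) ≤ |x.arg * s.im| := neg_le_abs _
        _ = |x.arg| * |s.im| := abs_mul _ _
        _ ≤ _ := mul_le_mul_of_nonneg_right (by linarith) (abs_nonneg _)

lemma exists_bound (hf : StripDecay l r θ f) (hθ : 0 < θ) {u v : ℝ} (hu : l < u) (hv : v < r) :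
    ∃ C δ : ℝ, 0 < δ ∧ ∀ s : ℂ, u ≤ s.re → s.re ≤ v → ‖f s‖ ≤ C * Real.exp (-δ * |s.im|) := by
  obtain ⟨C, hC⟩ := hf.bound u v (θ / 2) hu hv (by linarith)
  exact ⟨C, θ / 2, by linarith, hC⟩

lemma continuous_line (hf : StripDecay l r θ f) {c : ℝ} (hl : l < c) (hr : c < r) :
    Continuous fun y : ℝ => f (c + y * Complex.I) := by
  refine hf.diff.continuousOn.comp_continuous (by fun_prop) fun y => ?_
  simp [hl, hr]

lemma integrable_exp_neg_abs {δ : ℝ} (hδ : 0 < δ) :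
    Integrable fun y : ℝ => Real.exp (-δ * |y|) := by
  rw [← integrableOn_univ, ← Iic_union_Ioi (a := (0 : ℝ)), integrableOn_union]
  constructor
  · refine (integrableOn_exp_mul_Iic hδ 0).congr_fun (fun y hy => ?_) measurableSet_Iic
    simp [abs_of_nonpos (mem_Iic.1 hy)]
  · refine (integrableOn_exp_mul_Ioi (a := -δ) (by linarith) 0).congr_fun (fun y hy => ?_)
      measurableSet_Ioi
    simp [abs_of_pos (mem_Ioi.1 hy)]

lemma integrable_line (hf : StripDecay l r θ f) (hθ : 0 < θ) {c : ℝ} (hl : l < c) (hr : c < r) :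
    Integrable fun y : ℝ => f (c + y * Complex.I) := by
  obtain ⟨C, δ, hδ, hC⟩ := hf.exists_bound hθ hl hr
  refine ((integrable_exp_neg_abs hδ).const_mul C).mono'
    (hf.continuous_line hl hr).aestronglyMeasurable (Eventually.of_forall fun y => ?_)
  simpa using hC (c + y * Complex.I) (by simp) (by simp)

/-- The vertical line of integration may be moved inside the strip. -/
lemma lineIntegral_eq (hf : StripDecay l r θ f) (hθ : 0 < θ) {c d : ℝ} (hlc : l < c) (hcr : c < r)
    (hld : l < d) (hdr : d < r) : lineIntegral c f = lineIntegral d f := by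
  wlog hcd : c ≤ d generalizing c d
  · exact (this hld hdr hlc hcr (not_le.1 hcd).le).symm
  obtain ⟨C, δ, hδ, hC⟩ := hf.exists_bound hθ hlc hdr
  -- Cauchy's theorem on the rectangle between the two lines, cut at heights `±T`.
  have hrect : ∀ T : ℝ, (∫ y in (-T)..T, f (d + y * Complex.I)) -
      (∫ y in (-T)..T, f (c + y * Complex.I)) =
      -Complex.I * ((∫ x in c..d, f (x + (T : ℝ) * Complex.I)) -
        ∫ x in c..d, f (x + (-T : ℝ) * Complex.I)) := fun T => by
    have h := Complex.integral_boundary_rect_eq_zero_of_differentiableOn f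
      (c + (-T : ℝ) * Complex.I) (d + (T : ℝ) * Complex.I) (hf.diff.mono fun s hs => by
        have := (Complex.mem_reProdIm.1 hs).1
        simp only [Complex.add_re, Complex.ofReal_re, Complex.mul_re, Complex.I_re, mul_zero,
          Complex.ofReal_im, Complex.I_im, mul_one, sub_self, add_zero, uIcc_of_le hcd] at this
        exact ⟨hlc.trans_le this.1, this.2.trans_lt hdr⟩)
    simp only [Complex.add_re, Complex.ofReal_re, Complex.mul_re, Complex.I_re, mul_zero,
      Complex.ofReal_im, Complex.I_im, mul_one, sub_self, add_zero, Complex.add_im,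
      Complex.mul_im, zero_add, smul_eq_mul] at h
    linear_combination -Complex.I * h + ((∫ y in (-T)..T, f (d + y * Complex.I)) -
      (∫ y in (-T)..T, f (c + y * Complex.I))) * Complex.I_sq
  have hside : ∀ ε : ℝ, |ε| = 1 →
      Tendsto (fun T : ℝ => ∫ x in c..d, f (x + (ε * T : ℝ) * Complex.I)) atTop (𝓝 0) := by
    intro ε hε
    have hlim : Tendsto (fun T : ℝ => C * Real.exp (-δ * T) * |d - c|) atTop (𝓝 0) := by
      have := (Real.tendsto_exp_atBot.comp
        (tendsto_id.const_mul_atTop_of_neg (neg_neg_of_pos hδ))).const_mul C |>.mul_const |d - c|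
      simpa using this
    refine squeeze_zero_norm' ?_ hlim
    filter_upwards [eventually_ge_atTop 0] with T hT
    refine intervalIntegral.norm_integral_le_of_norm_le_const fun x hx => ?_
    rw [uIoc_of_le hcd] at hx
    have := hC (x + (ε * T : ℝ) * Complex.I) (by simpa using hx.1.le) (by simpa using hx.2)
    simpa [abs_mul, hε, abs_of_nonneg hT] using this
  have h1 := (intervalIntegral_tendsto_integral (hf.integrable_line hθ hld hdr)
    tendsto_neg_atTop_atBot tendsto_id).sub (intervalIntegral_tendsto_integral
    (hf.integrable_line hθ hlc hcr) tendsto_neg_atTop_atBot tendsto_id)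
  have h2 := ((hside 1 (by simp)).sub (hside (-1) (by simp))).const_mul (-Complex.I)
  simp only [one_mul, neg_one_mul, sub_zero, mul_zero] at h2
  have h3 := tendsto_nhds_unique h1 (h2.congr fun T => (hrect T).symm)
  rw [lineIntegral, lineIntegral, sub_eq_zero.1 h3]

end StripDecay
end

/-! ### The Mellin–Barnes representation of the Cauchy kernel. -/

noncomputable section

section MellinBarnes

/-- One has `2|sin z| ≥ e^{|y|} - e^{-|y|}` with `y = Im z`, and `e^{-|y|} ≤ 1 ≤ e^{|y|}/2` for `|y|
≥ 1`; hence the constant `4`. -/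
lemma exp_le_norm_sin {z : ℂ} (hz : 1 ≤ |z.im|) :
    Real.exp |z.im| ≤ 4 * ‖Complex.sin z‖ := by
  have h1 : ‖Complex.sin z‖ = ‖Complex.exp (-z * Complex.I) - Complex.exp (z * Complex.I)‖ / 2 := by
    rw [Complex.sin, norm_div, norm_mul, Complex.norm_I, mul_one]; simp
  have h2 : ‖Complex.exp (-z * Complex.I)‖ = Real.exp z.im := by
    rw [Complex.norm_exp]; simp
  have h3 : ‖Complex.exp (z * Complex.I)‖ = Real.exp (-z.im) := by
    rw [Complex.norm_exp]; simp
  have h4 : Real.exp |z.im| - Real.exp (-|z.im|) ≤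
      ‖Complex.exp (-z * Complex.I) - Complex.exp (z * Complex.I)‖ := by
    rcases abs_cases z.im with ⟨h, _⟩ | ⟨h, _⟩ <;> rw [h]
    · have := norm_sub_norm_le (Complex.exp (-z * Complex.I)) (Complex.exp (z * Complex.I))
      rwa [h2, h3] at this
    · have := norm_sub_norm_le (Complex.exp (z * Complex.I)) (Complex.exp (-z * Complex.I))
      rwa [h2, h3, norm_sub_rev, ← neg_neg z.im, neg_neg (-z.im)] at this
  have h5 : Real.exp (-|z.im|) ≤ 1 := Real.exp_le_one_iff.2 (by linarith)
  have h6 : 2 ≤ Real.exp |z.im| := by linarith [Real.add_one_le_exp |z.im|]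
  rw [h1]
  linarith

/-- Exponential decay of a product of two Gamma functions of opposite imaginary parts. -/
lemma norm_pi_div_sin_le {s : ℂ} (hs : 1 ≤ |s.im|) :
    ‖(Real.pi : ℂ) / Complex.sin (Real.pi * s)‖ ≤ 4 * Real.pi * Real.exp (-Real.pi * |s.im|) := by
  have him : ((Real.pi : ℂ) * s).im = Real.pi * s.im := by simp
  have hpi : 1 ≤ Real.pi := by linarith [Real.pi_gt_three]
  have h : |((Real.pi : ℂ) * s).im| = Real.pi * |s.im| := by
    rw [him, abs_mul, abs_of_pos Real.pi_pos]
  have h1 := exp_le_norm_sin (z := Real.pi * s) (by rw [h]; nlinarith)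
  rw [h] at h1
  have hpos : 0 < ‖Complex.sin (Real.pi * s)‖ := by
    have := Real.exp_pos (Real.pi * |s.im|); linarith
  rw [norm_div, Complex.norm_real, Real.norm_eq_abs, abs_of_pos Real.pi_pos, div_le_iff₀ hpos,
    neg_mul, Real.exp_neg]
  have h3 : 0 < Real.exp (Real.pi * |s.im|) := Real.exp_pos _
  have : 1 ≤ (Real.exp (Real.pi * |s.im|))⁻¹ * (4 * ‖Complex.sin (Real.pi * s)‖) := by
    rw [inv_mul_eq_div, le_div_iff₀ h3, one_mul]; exact h1
  nlinarith [Real.pi_pos]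

lemma Gamma_nat_add (M : ℕ) {s : ℂ} (hs : ∀ m : ℕ, s ≠ -m) :
    Complex.Gamma (s + M) = (∏ j ∈ Finset.range M, (s + j)) * Complex.Gamma s := by
  induction M with
  | zero => simp
  | succ M ih =>
    have : s + M ≠ 0 := fun h => hs M (by linear_combination h)
    rw [Finset.prod_range_succ, Nat.cast_succ, ← add_assoc, Complex.Gamma_add_one _ this, ih]
    ring

namespace StripDecay

/-- By the reflection formula the product is a polynomial times `π / sin (-π s)`. The rate `π` beats
the loss `|arg x| < π` of `x^s` for every `x` in the slit plane. -/
lemma Gamma_mul_Gamma (M : ℕ) : StripDecay (-(M + 1)) 0 Real.pi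
    fun s => Complex.Gamma (-s) * Complex.Gamma (1 + M + s) := by
  refine of_large (fun s hs => ?_) fun u v t hu hv ht => ?_
  · have h1 : 0 < (-s).re := by simp only [Complex.neg_re]; linarith [hs.2]
    have h2 : 0 < (1 + M + s).re := by
      simp only [Complex.add_re, Complex.natCast_re, Complex.one_re]; linarith [hs.1]
    refine (((Complex.differentiableAt_Gamma _ (Complex.Gamma_ne_pole h1)).comp s
      differentiableAt_id.neg).mul ((Complex.differentiableAt_Gamma _
      (Complex.Gamma_ne_pole h2)).comp s (differentiableAt_id.const_add
        (1 + M : ℂ)))).differentiableWithinAt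
  · have hp : StripDecay (-(M + 1)) 0 0 fun s => ∏ j ∈ Finset.range M, (s + (1 + j)) :=
      StripDecay.prod fun j => add_const _
    obtain ⟨C, hC⟩ := hp.bound u v (t - Real.pi) hu hv (by linarith)
    refine ⟨C * (4 * Real.pi), fun s h1 h2 h3 => ?_⟩
    have hs : ∀ m : ℕ, 1 + s ≠ -m := fun m h => by
      have := congrArg Complex.im h
      simp only [Complex.add_im, Complex.one_im, zero_add, Complex.neg_im, Complex.natCast_im,
        neg_zero] at this
      rw [this, abs_zero] at h3
      linarith
    have e : Complex.Gamma (-s) * Complex.Gamma (1 + M + s) =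
        (∏ j ∈ Finset.range M, (s + (1 + j))) *
          ((Real.pi : ℂ) / Complex.sin (Real.pi * (-s))) := by
      rw [← Complex.Gamma_mul_Gamma_one_sub, add_right_comm, Gamma_nat_add M hs, sub_neg_eq_add,
        show ∏ j ∈ Finset.range M, (1 + s + (j : ℂ)) = ∏ j ∈ Finset.range M, (s + (1 + (j : ℂ))) from
          Finset.prod_congr rfl fun j _ => by ring]
      ring
    have h4 := norm_pi_div_sin_le (s := -s) (by simpa using h3)
    rw [Complex.neg_im, abs_neg] at h4
    rw [e, norm_mul]
    refine (mul_le_mul (hC s h1 h2) h4 (norm_nonneg _) ((norm_nonneg _).trans (hC s h1 h2))).trans_eq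
      ?_
    rw [mul_mul_mul_comm, ← Real.exp_add]
    ring_nf

lemma dslope_cpow {w : ℂ} (hw : w ≠ 0) (l r : ℝ) :
    StripDecay l r (-|w.arg|) (dslope (fun s => w ^ s) 0) := by
  have hd : Differentiable ℂ fun s : ℂ => w ^ s := fun s =>
    DifferentiableAt.const_cpow differentiableAt_id (Or.inl hw)
  refine of_large (((Complex.differentiableOn_dslope univ_mem).2 hd.differentiableOn).mono
    (subset_univ _)) fun u v t hu hv ht => ?_
  have hc := (cpow (l := l) (r := r) hw).sub ((const (l := l) (r := r) 1).mono le_rfl le_rfl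
    (neg_nonpos.2 (abs_nonneg _)))
  obtain ⟨C, hC⟩ := hc.bound u v t hu hv ht
  refine ⟨C, fun s h1 h2 h3 => ?_⟩
  have hs : s ≠ 0 := fun h => by rw [h] at h3; simp at h3; linarith
  rw [dslope_of_ne _ hs, slope_def_field, Complex.cpow_zero, sub_zero, norm_div]
  refine (div_le_self (norm_nonneg _) (h3.trans (Complex.abs_im_le_norm s))).trans (hC s h1 h2)

lemma Gamma_one_sub_mul_Gamma_one_add : StripDecay (-1) 1 Real.pi
    fun s => Complex.Gamma (1 - s) * Complex.Gamma (1 + s) := by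
  refine of_large (fun s hs => ?_) fun u v t hu hv ht => ?_
  · have h1 : 0 < (1 - s).re := by simp only [Complex.sub_re, Complex.one_re]; linarith [hs.2]
    have h2 : 0 < (1 + s).re := by
      simp only [Complex.add_re, Complex.one_re]; linarith [hs.1]
    refine (((Complex.differentiableAt_Gamma _ (Complex.Gamma_ne_pole h1)).comp s
      (differentiableAt_id.const_sub 1)).mul ((Complex.differentiableAt_Gamma _
      (Complex.Gamma_ne_pole h2)).comp s (differentiableAt_id.const_add 1))).differentiableWithinAt
  · obtain ⟨C, hC⟩ := (id (l := -1) (r := 1)).bound u v (t - Real.pi) hu hv (by linarith)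
    refine ⟨C * (4 * Real.pi), fun s h1 h2 h3 => ?_⟩
    have hs : s ≠ 0 := fun h => by rw [h] at h3; simp at h3; linarith
    have e : Complex.Gamma (1 - s) * Complex.Gamma (1 + s) =
        s * ((Real.pi : ℂ) / Complex.sin (Real.pi * s)) := by
      rw [← Complex.Gamma_mul_Gamma_one_sub, add_comm 1 s, Complex.Gamma_add_one _ hs]
      ring
    rw [e, norm_mul]
    refine (mul_le_mul (hC s h1 h2) (norm_pi_div_sin_le h3) (norm_nonneg _)
      ((norm_nonneg _).trans (hC s h1 h2))).trans_eq ?_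
    rw [mul_mul_mul_comm, ← Real.exp_add]
    ring_nf

end StripDecay

lemma integral_pi_div_cosh :
    ∫ y : ℝ, Real.pi / Real.cosh (Real.pi * y) = Real.pi := by
  have hderiv : ∀ y : ℝ, HasDerivAt (fun y : ℝ => Real.arctan (Real.sinh (Real.pi * y)))
      (Real.pi / Real.cosh (Real.pi * y)) y := fun y => by
    have h := ((Real.hasDerivAt_sinh (Real.pi * y)).comp y
      ((hasDerivAt_id y).const_mul Real.pi)).arctan
    refine h.congr_deriv ?_
    have h1 := Real.cosh_sq' (Real.pi * y)
    have hp := Real.cosh_pos (Real.pi * y)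
    rw [Function.comp_apply, ← h1]
    field_simp
  have hpos : ∀ y : ℝ, 0 ≤ Real.pi / Real.cosh (Real.pi * y) := fun y =>
    div_nonneg Real.pi_pos.le (Real.cosh_pos _).le
  have htop : Tendsto (fun y : ℝ => Real.arctan (Real.sinh (Real.pi * y))) atTop
      (𝓝 (Real.pi / 2)) :=
    (Real.tendsto_arctan_atTop.mono_right nhdsWithin_le_nhds).comp
      (Real.sinhOrderIso.tendsto_atTop.comp (tendsto_id.const_mul_atTop Real.pi_pos))
  have hbot : Tendsto (fun y : ℝ => Real.arctan (Real.sinh (Real.pi * y))) atBot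
      (𝓝 (-(Real.pi / 2))) :=
    (Real.tendsto_arctan_atBot.mono_right nhdsWithin_le_nhds).comp
      (Real.sinhOrderIso.tendsto_atBot.comp (tendsto_id.const_mul_atBot Real.pi_pos))
  have hint : Integrable fun y : ℝ => Real.pi / Real.cosh (Real.pi * y) := by
    refine ((StripDecay.integrable_exp_neg_abs Real.pi_pos).const_mul (2 * Real.pi)).mono'
      (Continuous.aestronglyMeasurable (by
        have := fun y : ℝ => (Real.cosh_pos (Real.pi * y)).ne'
        fun_prop (disch := assumption))) (Eventually.of_forall fun y => ?_)
    rw [Real.norm_eq_abs, abs_of_nonneg (hpos y), ← Real.cosh_abs, abs_mul,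
      abs_of_pos Real.pi_pos, div_le_iff₀ (Real.cosh_pos _), Real.cosh_eq, neg_mul]
    have h1 := Real.exp_pos (-(Real.pi * |y|))
    have h2 : Real.exp (-(Real.pi * |y|)) * Real.exp (Real.pi * |y|) = 1 := by
      rw [← Real.exp_add]; simp
    nlinarith [Real.pi_pos, mul_pos Real.pi_pos (mul_pos h1 h1)]
  rw [integral_of_hasDerivAt_of_tendsto hderiv hint hbot htop]
  ring

lemma lineIntegral_congr {c : ℝ} {f g : ℂ → ℂ}
    (h : ∀ y : ℝ, f (c + y * Complex.I) = g (c + y * Complex.I)) :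
    lineIntegral c f = lineIntegral c g := by
  simp only [lineIntegral, h]

lemma lineIntegral_const_mul (c : ℝ) (b : ℂ) (f : ℂ → ℂ) :
    lineIntegral c (fun s => b * f s) = b * lineIntegral c f := by
  simp only [lineIntegral, integral_const_mul]
  ring

/-- On `Re s = -1/2` the reflection formula gives the integrand `π / cosh (π y)`. This is the value
at `w = 1`, which anchors the functional equation for general `w`. -/
lemma lineIntegral_Gamma_mul_Gamma :
    lineIntegral (-(1 / 2)) (fun s => Complex.Gamma (-s) * Complex.Gamma (1 + s)) = 1 / 2 := by
  have h : ∀ y : ℝ, Complex.Gamma (-(((-(1 / 2) : ℝ) : ℂ) + y * Complex.I)) *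
      Complex.Gamma (1 + (((-(1 / 2) : ℝ) : ℂ) + y * Complex.I)) =
      ((Real.pi / Real.cosh (Real.pi * y) : ℝ) : ℂ) := fun y => by
    have h1 := Complex.Gamma_mul_Gamma_one_sub (-(((-(1 / 2) : ℝ) : ℂ) + y * Complex.I))
    rw [sub_neg_eq_add] at h1
    rw [h1]
    push_cast
    rw [← Complex.cos_mul_I, ← Complex.sin_pi_div_two_sub]
    congr 2
    ring
  rw [lineIntegral]
  simp only [h]
  rw [integral_complex_ofReal, integral_pi_div_cosh]
  have : (Real.pi : ℂ) ≠ 0 := by exact_mod_cast Real.pi_ne_zero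
  field_simp

/-- The Mellin–Barnes representation of `1 / (1 + w)`. -/
lemma lineIntegral_cpow_Gamma_mul_Gamma {w : ℂ} (hw : w ∈ Complex.slitPlane) {c : ℝ} (h1 : -1 < c)
    (h0 : c < 0) :
    lineIntegral c (fun s => w ^ s * (Complex.Gamma (-s) * Complex.Gamma (1 + s))) =
      1 / (1 + w) := by
  have hw0 : w ≠ 0 := Complex.slitPlane_ne_zero hw
  have harg : |w.arg| < Real.pi := abs_lt.2 ⟨Complex.neg_pi_lt_arg w,
    lt_of_le_of_ne (Complex.arg_le_pi w) (Complex.mem_slitPlane_iff_arg.1 hw).1⟩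
  have hG : StripDecay (-1) 0 Real.pi fun s => Complex.Gamma (-s) * Complex.Gamma (1 + s) := by
    simpa using StripDecay.Gamma_mul_Gamma 0
  have hGw := (StripDecay.cpow (l := -1) (r := 0) hw0).mul hG
  rw [hGw.lineIntegral_eq (by linarith) h1 h0 (by norm_num : (-1 : ℝ) < -(1 / 2)) (by norm_num)]
  -- The function `(w^s - 1)/s · Γ(1 - s) Γ(1 + s)` has no pole at `0`, so its integrals along `Re s
  -- = -1/2` and `Re s = 1/2` agree; subtracting `1` replaces a residue computation. With `I` the
  -- integral sought, the left line gives `1/2 - I` and the right line, translated by one, gives `w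
  -- I - 1/2`.
  have hD := (StripDecay.dslope_cpow hw0 (-1) 1).mul StripDecay.Gamma_one_sub_mul_Gamma_one_add
  have hs := hD.lineIntegral_eq (by linarith) (by norm_num : (-1 : ℝ) < -(1 / 2)) (by norm_num)
    (by norm_num : (-1 : ℝ) < 1 / 2) (by norm_num)
  have hne : ∀ {c : ℝ} {y : ℝ}, c ≠ 0 → (c : ℂ) + y * Complex.I ≠ 0 := fun hc h => hc (by
    simpa using congrArg Complex.re h)
  have hi1 := hGw.integrable_line (by linarith) (by norm_num : (-1 : ℝ) < -(1 / 2)) (by norm_num)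
  have hi2 := hG.integrable_line Real.pi_pos (by norm_num : (-1 : ℝ) < -(1 / 2)) (by norm_num)
  have e1 : lineIntegral (-(1 / 2)) (fun s => dslope (fun s => w ^ s) 0 s *
      (Complex.Gamma (1 - s) * Complex.Gamma (1 + s))) =
      lineIntegral (-(1 / 2)) (fun s => Complex.Gamma (-s) * Complex.Gamma (1 + s)) -
      lineIntegral (-(1 / 2)) (fun s => w ^ s * (Complex.Gamma (-s) * Complex.Gamma (1 + s))) := by
    simp only [lineIntegral]
    rw [← mul_sub, ← integral_sub hi2 hi1]
    congr 2
    funext y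
    have h := hne (c := -(1 / 2)) (y := y) (by norm_num)
    rw [dslope_of_ne _ h, slope_def_field, Complex.cpow_zero, sub_zero,
      show (1 : ℂ) - (((-(1 / 2) : ℝ) : ℂ) + y * Complex.I) =
        -(((-(1 / 2) : ℝ) : ℂ) + y * Complex.I) + 1 by ring,
      Complex.Gamma_add_one _ (neg_ne_zero.2 h)]
    field_simp
    ring
  have e2 : lineIntegral (1 / 2) (fun s => dslope (fun s => w ^ s) 0 s *
      (Complex.Gamma (1 - s) * Complex.Gamma (1 + s))) =
      w * lineIntegral (-(1 / 2)) (fun s => w ^ s * (Complex.Gamma (-s) * Complex.Gamma (1 + s))) -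
      lineIntegral (-(1 / 2)) (fun s => Complex.Gamma (-s) * Complex.Gamma (1 + s)) := by
    rw [← lineIntegral_const_mul]
    simp only [lineIntegral]
    rw [← mul_sub, ← integral_sub (hi1.const_mul w) hi2]
    congr 2
    funext y
    have h := hne (c := 1 / 2) (y := y) (by norm_num)
    rw [dslope_of_ne _ h, slope_def_field, Complex.cpow_zero, sub_zero,
      show (((-(1 / 2) : ℝ) : ℂ) + y * Complex.I) =
        (((1 / 2 : ℝ) : ℂ) + y * Complex.I) - 1 by push_cast; ring]
    generalize ((1 / 2 : ℝ) : ℂ) + y * Complex.I = s at h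
    rw [Complex.cpow_sub _ _ hw0, Complex.cpow_one, add_comm 1 s, Complex.Gamma_add_one _ h,
      neg_sub, add_sub_cancel]
    field_simp
  rw [e1, e2, lineIntegral_Gamma_mul_Gamma] at hs
  have hne1 : 1 + w ≠ 0 := fun h => by
    have : w = -1 := by linear_combination h
    rw [this] at hw
    exact absurd hw (by norm_num [Complex.mem_slitPlane_iff])
  rw [eq_div_iff hne1]
  linear_combination -hs

lemma cpow_ofReal_mul {t : ℝ} (ht : 0 < t) {x : ℂ} (hx : x ≠ 0) (s : ℂ) :
    ((t : ℂ) * x) ^ s = (t : ℂ) ^ s * x ^ s := by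
  have ht' : (t : ℂ) ≠ 0 := by exact_mod_cast ht.ne'
  rw [Complex.cpow_def_of_ne_zero (mul_ne_zero ht' hx), Complex.cpow_def_of_ne_zero ht',
    Complex.cpow_def_of_ne_zero hx, Complex.log_ofReal_mul ht hx, ← Complex.exp_add,
    Complex.ofReal_log ht.le]
  ring_nf

lemma ofReal_mul_mem_slitPlane {t : ℝ} (ht : 0 < t) {x : ℂ} (hx : x ∈ Complex.slitPlane) :
    (t : ℂ) * x ∈ Complex.slitPlane := by
  rw [Complex.mem_slitPlane_iff] at hx ⊢
  simp only [Complex.mul_re, Complex.ofReal_re, Complex.ofReal_im, zero_mul, sub_zero,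
    Complex.mul_im, add_zero]
  exact hx.imp (mul_pos ht) (mul_ne_zero ht.ne')

lemma neg_mem_slitPlane {κ : ℂ} (hκ : ∀ x : ℝ, 0 ≤ x → κ ≠ x) : -κ ∈ Complex.slitPlane := by
  rw [Complex.mem_slitPlane_iff]
  by_contra! h
  simp only [Complex.neg_re, Complex.neg_im, neg_eq_zero] at h
  exact hκ κ.re (by linarith) (Complex.ext (by simp) (by simp [h.2]))

lemma inv_sub_eq_lineIntegral {κ : ℂ} (hκ : -κ ∈ Complex.slitPlane) {c : ℝ} (h1 : -1 < c)
    (h0 : c < 0) {x : ℝ} (hx : 0 < x) :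
    ((x : ℂ) - κ)⁻¹ = lineIntegral c fun s =>
      (x : ℂ) ^ (-s - 1) * ((-κ) ^ s * (Complex.Gamma (-s) * Complex.Gamma (1 + s))) := by
  have hx' : (x : ℂ) ≠ 0 := by exact_mod_cast hx.ne'
  have hk := Complex.slitPlane_ne_zero hκ
  have h := lineIntegral_cpow_Gamma_mul_Gamma
    (ofReal_mul_mem_slitPlane (inv_pos.2 hx) hκ) h1 h0
  have e : ((x : ℂ) - κ)⁻¹ = (x : ℂ)⁻¹ * (1 / (1 + ((x⁻¹ : ℝ) : ℂ) * -κ)) := by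
    push_cast
    rw [one_div, ← mul_inv]
    congr 1
    field_simp
    ring
  rw [e, ← h, ← lineIntegral_const_mul]
  refine lineIntegral_congr fun y => ?_
  generalize (c : ℂ) + y * Complex.I = s
  rw [cpow_ofReal_mul (inv_pos.2 hx) hk, Complex.cpow_sub _ _ hx', Complex.cpow_one,
    Complex.cpow_neg, Complex.ofReal_inv, Complex.inv_cpow]
  · field_simp
  · rw [Complex.arg_ofReal_of_nonneg hx.le]; exact Real.pi_ne_zero.symm

end MellinBarnes
end

/-! ### The functions `G^{3,1}_{2,3}` as line integrals. -/

noncomputable section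

/-- The Mellin transform behind `G^{3,1}_{2,3}(-M; M+2a+1 | 0, a, 2a+1)`. -/
def lineKernel (M : ℕ) (a : ℝ) (s : ℂ) : ℂ :=
  Complex.Gamma (-s) * Complex.Gamma (1 + M + s) * Complex.Gamma (a - s) *
    ∏ j ∈ Finset.range M, (((2 * a + 1 + j : ℝ) : ℂ) - s)⁻¹

/-- The Mellin transform behind `G^{3,1}_{2,3}(-M; M+2a+1 | 0, a+1, 2a+1)`. -/
def lineKernelSucc (M : ℕ) (a : ℝ) (s : ℂ) : ℂ :=
  Complex.Gamma (-s) * Complex.Gamma (1 + M + s) * Complex.Gamma (((a + 1 : ℝ) : ℂ) - s) *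
    ∏ j ∈ Finset.range M, (((2 * a + 1 + j : ℝ) : ℂ) - s)⁻¹

section Kernels

variable {M : ℕ} {a : ℝ}

lemma stripDecay_gamma_prod (M : ℕ) (a b : ℝ) :
    StripDecay (-(M + 1)) (min 0 (min b (2 * a + 1))) Real.pi fun s =>
      Complex.Gamma (-s) * Complex.Gamma (1 + M + s) * Complex.Gamma (b - s) *
        ∏ j ∈ Finset.range M, (((2 * a + 1 + j : ℝ) : ℂ) - s)⁻¹ := by
  have h1 := (StripDecay.Gamma_mul_Gamma M).mono le_rfl (min_le_left 0 (min b (2 * a + 1))) le_rfl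
  have h2 : StripDecay (-(M + 1)) (min 0 (min b (2 * a + 1))) 0 fun s => Complex.Gamma (b - s) :=
    StripDecay.Gamma_sub ((min_le_right _ _).trans (min_le_left _ _))
  have h3 : StripDecay (-(M + 1)) (min 0 (min b (2 * a + 1))) 0 fun s =>
      ∏ j ∈ Finset.range M, (((2 * a + 1 + j : ℝ) : ℂ) - s)⁻¹ :=
    StripDecay.prod fun j => StripDecay.inv_const_sub
      (((min_le_right _ _).trans (min_le_right _ _)).trans (by
        have : (0 : ℝ) ≤ j := Nat.cast_nonneg _
        linarith))
  simpa using (h1.mul h2).mul h3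

lemma stripDecay_lineKernel (M : ℕ) (a : ℝ) :
    StripDecay (-(M + 1)) (min 0 (min a (2 * a + 1))) Real.pi (lineKernel M a) :=
  stripDecay_gamma_prod M a a

lemma stripDecay_lineKernelSucc (M : ℕ) (a : ℝ) :
    StripDecay (-(M + 1)) (min 0 (min (a + 1) (2 * a + 1))) Real.pi (lineKernelSucc M a) :=
  stripDecay_gamma_prod M a (a + 1)

/-- Replacing `Γ(a - s)` by `Γ(a + 1 - s)` inserts the factor `a - s`, one half of the numerator of
a Schur ratio; it also removes the pole at `s = a`, so this kernel can live on a wider strip. -/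
lemma lineKernelSucc_eq {s : ℂ} (hs : (a : ℂ) ≠ s) :
    lineKernelSucc M a s = (a - s) * lineKernel M a s := by
  have : (((a + 1 : ℝ) : ℂ) - s) = (a - s) + 1 := by push_cast; ring
  rw [lineKernelSucc, this, Complex.Gamma_add_one _ (sub_ne_zero.2 hs), lineKernel]
  ring

lemma abs_arg_lt_pi {x : ℂ} (hx : x ∈ Complex.slitPlane) : |x.arg| < Real.pi :=
  abs_lt.2 ⟨Complex.neg_pi_lt_arg x,
    lt_of_le_of_ne (Complex.arg_le_pi x) (Complex.mem_slitPlane_iff_arg.1 hx).1⟩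

lemma stripDecay_cpow_mul {l r : ℝ} {f : ℂ → ℂ} (hf : StripDecay l r Real.pi f) {x : ℂ}
    (hx : x ∈ Complex.slitPlane) : StripDecay l r (-|x.arg| + Real.pi) fun s => x ^ s * f s :=
  (StripDecay.cpow (Complex.slitPlane_ne_zero hx)).mul hf

lemma neg_abs_arg_add_pi_pos {x : ℂ} (hx : x ∈ Complex.slitPlane) : 0 < -|x.arg| + Real.pi := by
  linarith [abs_arg_lt_pi hx]

lemma lineIntegral_cpow_mul_eq {l r : ℝ} {f : ℂ → ℂ} (hf : StripDecay l r Real.pi f) {x : ℂ}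
    (hx : x ∈ Complex.slitPlane) {c d : ℝ} (hlc : l < c) (hcr : c < r) (hld : l < d) (hdr : d < r) :
    lineIntegral c (fun s => x ^ s * f s) = lineIntegral d fun s => x ^ s * f s :=
  (stripDecay_cpow_mul hf hx).lineIntegral_eq (neg_abs_arg_add_pi_pos hx) hlc hcr hld hdr

lemma integrable_cpow_mul {l r : ℝ} {f : ℂ → ℂ} (hf : StripDecay l r Real.pi f) {x : ℂ}
    (hx : x ∈ Complex.slitPlane) {c : ℝ} (hlc : l < c) (hcr : c < r) :
    Integrable fun y : ℝ => x ^ ((c : ℂ) + y * Complex.I) * f (c + y * Complex.I) :=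
  (stripDecay_cpow_mul hf hx).integrable_line (neg_abs_arg_add_pi_pos hx) hlc hcr

lemma Gamma_div_Gamma_add (M : ℕ) {b : ℝ} {s : ℂ} (hs : s.re < b) :
    Complex.Gamma (b - s) / Complex.Gamma (M + b - s) =
      ∏ j ∈ Finset.range M, (((b + j : ℝ) : ℂ) - s)⁻¹ := by
  have hre : 0 < ((b : ℂ) - s).re := by simpa using hs
  have h0 := Complex.Gamma_ne_zero_of_re_pos hre
  rw [show (M : ℂ) + b - s = (b - s) + M by ring, Gamma_nat_add M (Complex.Gamma_ne_pole hre),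
    Finset.prod_inv_distrib, div_mul_cancel_right₀ h0]
  congr 1
  refine Finset.prod_congr rfl fun j _ => ?_
  push_cast
  ring

/-- The abscissa in the definition is an unspecified choice, known only to lie between the two
families of poles; the line is afterwards moved to a chosen abscissa. -/
lemma meijerG31_eq {x : ℂ} (hx : x ≠ 0) (a₁ a₂ b₁ b₂ b₃ : ℝ) {l r : ℝ} (hl : l = a₁ - 1)
    (hr : r = min b₁ (min b₂ b₃)) (hlr : l < r) :
    ∃ c, l < c ∧ c < r ∧ meijerG31 a₁ a₂ b₁ b₂ b₃ x = lineIntegral c fun s =>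
      x ^ s * (Complex.Gamma (b₁ - s) * Complex.Gamma (b₂ - s) * Complex.Gamma (b₃ - s) *
        Complex.Gamma (1 - a₁ + s) / Complex.Gamma (a₂ - s)) := by
  have hex : ∃ c : ℝ, (∀ j, (![a₁] : Fin 1 → ℝ) j - 1 < c) ∧ ∀ j, c < (![b₁, b₂, b₃] : Fin 3 → ℝ) j := by
    refine ⟨(l + r) / 2, fun j => ?_, fun j => ?_⟩
    · simp; linarith
    · have h1 : r ≤ b₁ := hr ▸ min_le_left _ _
      have h2 : r ≤ b₂ := hr ▸ (min_le_right _ _).trans (min_le_left _ _)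
      have h3 : r ≤ b₃ := hr ▸ (min_le_right _ _).trans (min_le_right _ _)
      fin_cases j <;> simp <;> linarith
  have hspec := Classical.epsilon_spec hex
  refine ⟨meijerAbscissa ![a₁] ![b₁, b₂, b₃], ?_, ?_, ?_⟩
  · rw [hl]; exact hspec.1 0
  · rw [hr]
    exact lt_min (hspec.2 0) (lt_min (hspec.2 1) (hspec.2 2))
  · rw [meijerG31, meijerG, if_neg hx, meijerIntegral, if_pos (by norm_num)]
    refine lineIntegral_congr fun y => ?_
    simp [meijerIntegrand, Fin.prod_univ_succ]
    ring

lemma meijerG31_lineKernel {x : ℂ} (hx : x ∈ Complex.slitPlane) {c : ℝ}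
    (hl : -(M + 1) < c) (hr : c < min 0 (min a (2 * a + 1))) :
    meijerG31 (-M) (M + 2 * a + 1) 0 a (2 * a + 1) x =
      lineIntegral c fun s => x ^ s * lineKernel M a s := by
  obtain ⟨d, hd1, hd2, h⟩ := meijerG31_eq (Complex.slitPlane_ne_zero hx) (-M) (M + 2 * a + 1) 0 a
    (2 * a + 1) (l := -(M + 1)) (by ring) rfl (hl.trans hr)
  rw [h, ← lineIntegral_cpow_mul_eq (stripDecay_lineKernel M a) hx hd1 hd2 hl hr]
  refine lineIntegral_congr fun y => ?_
  have hre : ((d : ℂ) + y * Complex.I).re < 2 * a + 1 := by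
    simpa using hd2.trans_le ((min_le_right _ _).trans (min_le_right _ _))
  rw [lineKernel, ← Gamma_div_Gamma_add M hre]
  push_cast
  ring_nf

lemma meijerG31_lineKernelSucc {x : ℂ} (hx : x ∈ Complex.slitPlane) {c : ℝ}
    (hl : -(M + 1) < c) (hr : c < min 0 (min (a + 1) (2 * a + 1))) :
    meijerG31 (-M) (M + 2 * a + 1) 0 (a + 1) (2 * a + 1) x =
      lineIntegral c fun s => x ^ s * lineKernelSucc M a s := by
  obtain ⟨d, hd1, hd2, h⟩ := meijerG31_eq (Complex.slitPlane_ne_zero hx) (-M) (M + 2 * a + 1) 0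
    (a + 1) (2 * a + 1) (l := -(M + 1)) (by ring) rfl (hl.trans hr)
  rw [h, ← lineIntegral_cpow_mul_eq (stripDecay_lineKernelSucc M a) hx hd1 hd2 hl hr]
  refine lineIntegral_congr fun y => ?_
  have hre : ((d : ℂ) + y * Complex.I).re < 2 * a + 1 := by
    simpa using hd2.trans_le ((min_le_right _ _).trans (min_le_right _ _))
  rw [lineKernelSucc, ← Gamma_div_Gamma_add M hre]
  push_cast
  ring_nf

lemma lineIntegral_shift (c b : ℝ) (f : ℂ → ℂ) :
    lineIntegral c f = lineIntegral (c + b) fun s => f (s - b) := by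
  refine congrArg _ (congrArg _ (funext fun y => congrArg f ?_))
  push_cast
  ring

/-- Translating `s` by `a` turns the lower parameters `0, -a, a + 1` into `a, 0, 2a + 1` and
releases the power `x^{-a}`. -/
lemma meijerG31_shift_lineKernel {x : ℂ} (hx : x ∈ Complex.slitPlane) {c : ℝ}
    (hl : -(M + 1) < c) (hr : c < min 0 (min a (2 * a + 1))) :
    meijerG31 (-M - a) (M + a + 1) 0 (-a) (a + 1) x =
      x ^ (-a : ℂ) * lineIntegral c fun s => x ^ s * lineKernel M a s := by
  have hx0 := Complex.slitPlane_ne_zero hx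
  have hmin : min 0 (min (-a) (a + 1)) = min 0 (min a (2 * a + 1)) - a := by
    simp only [min_def]
    split_ifs <;> linarith
  obtain ⟨d, hd1, hd2, h⟩ := meijerG31_eq hx0 (-M - a) (M + a + 1) 0 (-a)
    (a + 1) (l := -(M + 1) - a) (by ring) rfl (by rw [hmin]; linarith)
  rw [hmin] at hd2
  rw [h, lineIntegral_shift d a, lineIntegral_cpow_mul_eq (stripDecay_lineKernel M a) hx hl hr
    (by linarith : -(M + 1) < d + a) (by linarith), ← lineIntegral_const_mul]
  refine lineIntegral_congr fun y => ?_
  have hre : (((d + a : ℝ) : ℂ) + y * Complex.I).re < 2 * a + 1 := by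
    have := (min_le_right 0 (min a (2 * a + 1))).trans (min_le_right _ _)
    simp
    linarith
  rw [lineKernel, ← Gamma_div_Gamma_add M hre, Complex.cpow_sub _ _ hx0, Complex.cpow_neg]
  push_cast
  ring_nf

/-- The same with the translation by `a + 1`, which turns `0, -a - 1, a` into `a + 1, 0, 2a + 1`. -/
lemma meijerG31_shift_lineKernelSucc {x : ℂ} (hx : x ∈ Complex.slitPlane) {c : ℝ}
    (hl : -(M + 1) < c) (hr : c < min 0 (min (a + 1) (2 * a + 1))) :
    meijerG31 (-M - a - 1) (M + a) 0 (-a - 1) a x =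
      x ^ (-a - 1 : ℂ) * lineIntegral c fun s => x ^ s * lineKernelSucc M a s := by
  have hx0 := Complex.slitPlane_ne_zero hx
  have hmin : min 0 (min (-a - 1) a) = min 0 (min (a + 1) (2 * a + 1)) - (a + 1) := by
    simp only [min_def]
    split_ifs <;> linarith
  obtain ⟨d, hd1, hd2, h⟩ := meijerG31_eq hx0 (-M - a - 1) (M + a) 0 (-a - 1)
    a (l := -(M + 1) - (a + 1)) (by ring) rfl (by rw [hmin]; linarith)
  rw [hmin] at hd2
  rw [h, lineIntegral_shift d (a + 1), lineIntegral_cpow_mul_eq (stripDecay_lineKernelSucc M a) hx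
    hl hr (by linarith : -(M + 1) < d + (a + 1)) (by linarith), ← lineIntegral_const_mul]
  refine lineIntegral_congr fun y => ?_
  have hre : (((d + (a + 1) : ℝ) : ℂ) + y * Complex.I).re < 2 * a + 1 := by
    have := (min_le_right 0 (min (a + 1) (2 * a + 1))).trans (min_le_right _ _)
    simp
    linarith
  rw [lineKernelSucc, ← Gamma_div_Gamma_add M hre, Complex.cpow_sub _ _ hx0,
    show (-a - 1 : ℂ) = -((a + 1 : ℝ) : ℂ) by push_cast; ring, Complex.cpow_neg]
  push_cast
  ring_nf

end Kernels

section SchurIntegral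

variable {a : ℝ} {n : ℕ}

lemma norm_gammaDensity {α : ℂ} {x : ℝ} (hx : 0 < x) :
    ‖gammaDensity α x‖ = ‖gammaDensity (α.re : ℂ) x‖ := by
  simp only [gammaDensity, norm_mul, Complex.norm_cpow_eq_rpow_re_of_pos hx, Complex.sub_re,
    Complex.one_re, Complex.ofReal_re]

lemma cauchyDensity_eq_lineIntegral {κ : ℂ} (hκ : -κ ∈ Complex.slitPlane) {c : ℝ} (h1 : -1 < c)
    (h0 : c < 0) {x : ℝ} (hx : 0 < x) :
    cauchyDensity a κ x = lineIntegral c fun s =>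
      (-κ) ^ s * (Complex.Gamma (-s) * Complex.Gamma (1 + s)) * gammaDensity (a - s) x := by
  have hx' : (x : ℂ) ≠ 0 := by exact_mod_cast hx.ne'
  rw [cauchyDensity, inv_sub_eq_lineIntegral hκ h1 h0 hx, mul_comm, ← lineIntegral_const_mul]
  refine lineIntegral_congr fun y => ?_
  generalize (c : ℂ) + y * Complex.I = s
  rw [gammaDensity, gammaDensity, show (a : ℂ) - s - 1 = a + (-s - 1) by ring,
    Complex.cpow_add _ _ hx', add_sub_cancel_right]
  ring

/-- Mellin–Barnes representation of the first factor under `schurIntegral`. -/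
lemma schurIntegral_cons_cauchyDensity (ha : -1 < a) {κ : ℂ} (hκ : ∀ x : ℝ, 0 ≤ x → κ ≠ x) {c : ℝ}
    (h1 : -1 < c) (h0 : c < 0) (hca : c < a) {f : Fin n → ℝ → ℂ}
    (hf : ∀ i, Integrable (f i) posMeasure) :
    schurIntegral (Fin.cons (cauchyDensity a κ) f : Fin (n + 1) → ℝ → ℂ) =
      lineIntegral c fun s => (-κ) ^ s * (Complex.Gamma (-s) * Complex.Gamma (1 + s)) *
        schurIntegral (Fin.cons (gammaDensity (a - s)) f : Fin (n + 1) → ℝ → ℂ) := by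
  have hκ' := neg_mem_slitPlane hκ
  have hm : StripDecay (-1) 0 (-|(-κ).arg| + Real.pi) fun s =>
      (-κ) ^ s * (Complex.Gamma (-s) * Complex.Gamma (1 + s)) :=
    stripDecay_cpow_mul (by simpa using StripDecay.Gamma_mul_Gamma 0) hκ'
  have hmi := hm.integrable_line (neg_abs_arg_add_pi_pos hκ') h1 h0
  obtain ⟨m, hmdef⟩ : ∃ m : ℂ → ℂ, m = fun s =>
    (-κ) ^ s * (Complex.Gamma (-s) * Complex.Gamma (1 + s)) := ⟨_, rfl⟩
  replace hmi : Integrable fun y : ℝ => m (c + y * Complex.I) := by rw [hmdef]; exact hmi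
  have hre : ∀ y : ℝ, ((a : ℂ) - (c + y * Complex.I)).re = a - c := fun y => by simp
  have hpos : ∀ y : ℝ, 0 < ((a : ℂ) - (c + y * Complex.I)).re := fun y => by rw [hre]; linarith
  -- Fubini is dominated by a product: the cofactor is bounded, the modulus of the Gamma density
  -- depends only on the fixed real part `a - c`, and the Mellin factor is integrable on the line.
  obtain ⟨K, hK⟩ := norm_schurCofactor_le hf
  have hint : Integrable (Function.uncurry fun (x y : ℝ) => m (c + y * Complex.I) *
      gammaDensity (a - (c + y * Complex.I)) x * schurCofactor f x) (posMeasure.prod volume) := by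
    have hbd : Integrable (fun p : ℝ × ℝ => (‖gammaDensity ((a - c : ℝ) : ℂ) p.1‖ * K) *
        ‖m (c + p.2 * Complex.I)‖) (posMeasure.prod volume) :=
      ((integrable_gammaDensity (by simpa using hca)).norm.mul_const K).mul_prod hmi.norm
    refine hbd.mono' ?_ ?_
    · refine AEStronglyMeasurable.mul (AEStronglyMeasurable.mul hmi.aestronglyMeasurable.comp_snd
        (Measurable.aestronglyMeasurable ?_)) (aestronglyMeasurable_schurCofactor hf).comp_fst
      unfold gammaDensity
      fun_prop
    · have : ∀ᵐ p ∂(posMeasure.prod (volume : Measure ℝ)), 0 < p.1 :=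
        Measure.quasiMeasurePreserving_fst.ae ae_posMeasure
      filter_upwards [this] with p hp
      simp only [Function.uncurry, norm_mul]
      rw [norm_gammaDensity hp, hre]
      have h3 := hK p.1 hp
      calc _ = ‖gammaDensity ((a - c : ℝ) : ℂ) p.1‖ * ‖schurCofactor f p.1‖ *
            ‖m (c + p.2 * Complex.I)‖ := by ring
        _ ≤ _ := by gcongr
  rw [schurIntegral_cons (integrable_cauchyDensity ha hκ) hf]
  have e1 : ∫ x, cauchyDensity a κ x * schurCofactor f x ∂posMeasure =
      (1 / (2 * Real.pi : ℂ)) * ∫ x, (∫ y : ℝ, m (c + y * Complex.I) *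
      gammaDensity (a - (c + y * Complex.I)) x * schurCofactor f x) ∂posMeasure := by
    rw [← integral_const_mul]
    refine integral_congr_ae ?_
    filter_upwards [ae_posMeasure] with x hx
    rw [cauchyDensity_eq_lineIntegral hκ' h1 h0 hx, lineIntegral, integral_mul_const, hmdef]
    ring
  rw [e1, integral_integral_swap hint, lineIntegral]
  congr 2
  funext y
  rw [schurIntegral_cons (integrable_gammaDensity (hpos y)) hf, hmdef, ← integral_const_mul]
  simp only [mul_assoc]

end SchurIntegral
end

/-! ### Closed forms of the averages. -/

noncomputable section

/-- The coefficients, up to a factor, of the polynomial `G^{1,1}_{2,3}` of degree `n`. -/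
def buresCoeff (a : ℝ) {n : ℕ} (k : Fin (n + 1)) : ℂ :=
  (Complex.Gamma (buresExponent a k) *
    ∏ i : Fin n, schurRatio (buresExponent a k) (buresExponent a (k.succAbove i)))⁻¹

section Averages

variable {a : ℝ} {n : ℕ}

lemma buresExponent_add_ne_zero (ha : -1 < a) {m : ℕ} (i : Fin n) (j : Fin m) :
    buresExponent a i + buresExponent a j ≠ 0 :=
  add_ne_zero_of_re_pos (buresExponent_re ha i) (buresExponent_re ha j)

lemma buresExponent_injective : Function.Injective fun i : Fin n => buresExponent a i :=
  fun i j h => by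
    simp only [buresExponent, add_left_inj, Nat.cast_inj] at h
    exact Fin.ext h

lemma schurRatio_buresExponent_ne_zero (ha : -1 < a) {i j : Fin n} (hij : i ≠ j) :
    schurRatio (buresExponent a i) (buresExponent a j) ≠ 0 :=
  div_ne_zero (sub_ne_zero.2 fun h => hij (buresExponent_injective h.symm))
    (buresExponent_add_ne_zero ha _ _)

lemma Gamma_buresExponent_ne_zero (ha : -1 < a) (i : Fin n) :
    Complex.Gamma (buresExponent a i) ≠ 0 :=
  Complex.Gamma_ne_zero_of_re_pos (buresExponent_re ha i)

lemma buresZ_ne_zero (ha : -1 < a) (N : ℕ) : buresZ N a ![] ![] ≠ 0 := by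
  rw [buresZ_zero_zero ha]
  refine mul_ne_zero (Finset.prod_ne_zero_iff.2 fun i _ => Gamma_buresExponent_ne_zero ha i)
    (Finset.prod_ne_zero_iff.2 fun i _ => Finset.prod_ne_zero_iff.2 fun j hj =>
      schurRatio_buresExponent_ne_zero ha (Finset.mem_Ioi.1 hj).ne)

lemma prod_succAbove_succAbove {R : Type*} [CommMonoid R] (f : Fin (n + 2) → R) (k : Fin (n + 2))
    (l : Fin (n + 1)) : ∏ j, f ((k.succAbove l).succAbove j) =
      f k * ∏ i, f (k.succAbove (l.succAbove i)) := by
  have h : ∀ g : Fin (n + 2) → R, g (k.succAbove l) * ∏ j, g ((k.succAbove l).succAbove j) =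
      g k * (g (k.succAbove l) * ∏ i, g (k.succAbove (l.succAbove i))) := fun g => by
    rw [← Fin.prod_univ_succAbove, Fin.prod_univ_succAbove _ k, Fin.prod_univ_succAbove _ l]
  -- A commutative monoid allows no cancellation, so the extra factor is instead set to `1`.
  have h1 := h (Function.update f (k.succAbove l) 1)
  have h2 : ∀ i, k.succAbove (l.succAbove i) ≠ k.succAbove l := fun i h =>
    Fin.succAbove_ne l i (Fin.succAbove_right_injective h)
  simpa [Function.update_of_ne, h2, Fin.succAbove_ne, (Fin.succAbove_ne k l).symm] using h1

/-- Both integrals are explicit, and their quotient is the Gamma factor and the Schur ratios of the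
deleted exponent. -/
lemma schurIntegral_removeNth (ha : -1 < a) (k : Fin (n + 1)) :
    (-1) ^ (k : ℕ) * schurIntegral (k.removeNth fun i => gammaDensity (buresExponent a i)) =
      buresZ (n + 1) a ![] ![] * buresCoeff a k := by
  have h := schurIntegral_gammaDensity (k.removeNth fun i : Fin (n + 1) => buresExponent a i)
    fun i => buresExponent_re ha _
  have e : (k.removeNth fun i => gammaDensity (buresExponent a i)) =
    fun i => gammaDensity ((k.removeNth fun i : Fin (n + 1) => buresExponent a i) i) := rfl
  have h0 : ∏ i : Fin n, schurRatio (buresExponent a k) (buresExponent a (k.succAbove i)) ≠ 0 :=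
    Finset.prod_ne_zero_iff.2 fun i _ =>
      schurRatio_buresExponent_ne_zero ha (Fin.succAbove_ne k i).symm
  have h1 := Gamma_buresExponent_ne_zero ha k
  have h2 : ((-1 : ℂ) ^ (k : ℕ)) * (-1) ^ (k : ℕ) = 1 := by rw [← mul_pow]; simp
  rw [e, h, buresZ_zero_zero ha, schurProd_eq_removeNth _ k, Fin.prod_univ_succAbove _ k, buresCoeff]
  simp only [Fin.removeNth_apply]
  field_simp

lemma buresZ_zero_one_eq (ha : -1 < a) (lam : ℂ) :
    buresZ n a ![] ![lam] = buresZ (n + 1) a ![] ![] *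
      ∑ k : Fin (n + 1), buresCoeff a k * lam ^ (k : ℕ) := by
  rw [buresZ_zero_one ha, Finset.mul_sum]
  refine Finset.sum_congr rfl fun k _ => ?_
  rw [← mul_assoc, ← schurIntegral_removeNth ha]
  ring

/-- Each of the two coefficients contains the inverse ratio of the deleted pair, but deletion
removes that pair only once; so one ratio is multiplied back. It becomes the coupling of the two
variables. -/
lemma schurIntegral_removeNth_removeNth (ha : -1 < a) (k : Fin (n + 2)) (l : Fin (n + 1)) :
    (-1) ^ (k : ℕ) * (-1) ^ (l : ℕ) * schurIntegral
      (l.removeNth (k.removeNth fun i => gammaDensity (buresExponent a i))) =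
      buresZ (n + 2) a ![] ![] * (buresCoeff a k * buresCoeff a (k.succAbove l) *
        schurRatio (buresExponent a (k.succAbove l)) (buresExponent a k)) := by
  have h := schurIntegral_gammaDensity
    (l.removeNth (k.removeNth fun i : Fin (n + 2) => buresExponent a i))
    fun i => buresExponent_re ha _
  have e : (l.removeNth (k.removeNth fun i => gammaDensity (buresExponent a i))) =
    fun i => gammaDensity ((l.removeNth (k.removeNth fun i : Fin (n + 2) => buresExponent a i)) i) :=
    rfl
  have h0 : ∏ i : Fin (n + 1), schurRatio (buresExponent a k) (buresExponent a (k.succAbove i)) ≠ 0 :=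
    Finset.prod_ne_zero_iff.2 fun i _ =>
      schurRatio_buresExponent_ne_zero ha (Fin.succAbove_ne k i).symm
  have h0' : ∏ i : Fin n, schurRatio (buresExponent a (k.succAbove l))
      (buresExponent a (k.succAbove (l.succAbove i))) ≠ 0 :=
    Finset.prod_ne_zero_iff.2 fun i _ =>
      schurRatio_buresExponent_ne_zero ha fun h => Fin.succAbove_ne l i
        (Fin.succAbove_right_injective h).symm
  have h1 := Gamma_buresExponent_ne_zero ha k
  have h3 := Gamma_buresExponent_ne_zero ha (k.succAbove l)
  have h4 := schurRatio_buresExponent_ne_zero ha (Fin.succAbove_ne k l)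
  have h2 : ((-1 : ℂ) ^ (k : ℕ)) * (-1) ^ (k : ℕ) = 1 := by rw [← mul_pow]; simp
  have h2' : ((-1 : ℂ) ^ (l : ℕ)) * (-1) ^ (l : ℕ) = 1 := by rw [← mul_pow]; simp
  rw [e, h, buresZ_zero_zero ha, schurProd_eq_removeNth _ k, schurProd_eq_removeNth _ l,
    Fin.prod_univ_succAbove _ k, Fin.prod_univ_succAbove _ l, buresCoeff, buresCoeff,
    prod_succAbove_succAbove fun j => schurRatio (buresExponent a (k.succAbove l))
      (buresExponent a j)]
  simp only [Fin.removeNth_apply]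
  field_simp

lemma buresZ_zero_two_eq (ha : -1 < a) (lam₁ lam₂ : ℂ) :
    (lam₁ - lam₂) * buresZ n a ![] ![lam₁, lam₂] = buresZ (n + 2) a ![] ![] *
      ∑ k : Fin (n + 2), ∑ l : Fin (n + 2), buresCoeff a k * buresCoeff a l *
        schurRatio (buresExponent a k) (buresExponent a l) *
          (lam₁ ^ (k : ℕ) * lam₂ ^ (l : ℕ)) := by
  have h := buresZ_zero_two ha n lam₁ lam₂
  rw [Fintype.sum_prod_type] at h
  rw [← neg_sub, neg_mul, h, Finset.mul_sum, ← Finset.sum_neg_distrib]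
  refine Finset.sum_congr rfl fun k _ => ?_
  rw [Fin.sum_univ_succAbove _ k, ← Finset.sum_neg_distrib]
  have : schurRatio (buresExponent a k) (buresExponent a k) = 0 := by simp [schurRatio]
  rw [this, mul_zero, zero_mul, zero_add, Finset.mul_sum]
  refine Finset.sum_congr rfl fun l _ => ?_
  have h1 := schurIntegral_removeNth_removeNth ha k l
  rw [schurRatio_swap (buresExponent a k)]
  linear_combination -(lam₁ ^ (k : ℕ) * lam₂ ^ (k.succAbove l : ℕ)) * h1

lemma schurIntegral_cons_gammaDensity {β : ℂ} (hβ : 0 < β.re) {α : Fin n → ℂ}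
    (hα : ∀ i, 0 < (α i).re) :
    schurIntegral (Fin.cons (gammaDensity β) fun i => gammaDensity (α i) :
        Fin (n + 1) → ℝ → ℂ) = Complex.Gamma β * (∏ i, schurRatio β (α i)) *
      ((∏ i, Complex.Gamma (α i)) * schurProd α) := by
  have h := schurIntegral_gammaDensity (Fin.cons β α : Fin (n + 1) → ℂ) fun i => by
    induction i using Fin.cases with
    | zero => exact hβ
    | succ i => exact hα i
  have e : (Fin.cons (gammaDensity β) fun i => gammaDensity (α i) : Fin (n + 1) → ℝ → ℂ) =
      fun i => gammaDensity ((Fin.cons β α : Fin (n + 1) → ℂ) i) := by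
    funext i
    induction i using Fin.cases <;> rfl
  rw [e, h, schurProd_cons, Fin.prod_univ_succ]
  simp only [Fin.cons_zero, Fin.cons_succ]
  ring

/-- The ratio of `a - s` with the exponent `i + a + 1` is `(1 + s + i)/(2a + 1 + i - s)`. The
numerators raise `Γ(1 + s)` to `Γ(1 + M + s)`, and the denominators are the inverse linear factors
of the kernel. -/
lemma lineKernel_eq_prod_schurRatio (M : ℕ) {s : ℂ} (hs : -1 < s.re) :
    Complex.Gamma (-s) * Complex.Gamma (1 + s) *
      (Complex.Gamma (a - s) * ∏ i : Fin M, schurRatio (a - s) (buresExponent a i)) =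
      lineKernel M a s := by
  have h1 : 0 < (1 + s).re := by simp; linarith
  have h2 : ∏ i : Fin M, schurRatio (a - s) (buresExponent a i) =
      ∏ j ∈ Finset.range M, ((1 + s + j) * (((2 * a + 1 + j : ℝ) : ℂ) - s)⁻¹) := by
    rw [Finset.prod_range]
    refine Finset.prod_congr rfl fun i _ => ?_
    rw [schurRatio, buresExponent, div_eq_mul_inv]
    push_cast
    ring_nf
  rw [h2, Finset.prod_mul_distrib, lineKernel, add_right_comm,
    Gamma_nat_add M (Complex.Gamma_ne_pole h1)]
  ring

variable {c : ℝ}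

lemma buresZ_one_zero_eq (ha : -1 < a) (M : ℕ) {κ : ℂ} (hκ : ∀ x : ℝ, 0 ≤ x → κ ≠ x)
    (h1 : -1 < c) (h0 : c < 0) (hca : c < a) :
    buresZ (M + 1) a ![κ] ![] = buresZ M a ![] ![] *
      lineIntegral c fun s => (-κ) ^ s * lineKernel M a s := by
  rw [buresZ_one_zero ha M hκ, schurIntegral_cons_cauchyDensity ha hκ h1 h0 hca
    fun i => integrable_buresExponent ha i, ← lineIntegral_const_mul]
  refine lineIntegral_congr fun y => ?_
  have hre : ((c : ℂ) + y * Complex.I).re = c := by simp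
  generalize (c : ℂ) + y * Complex.I = s at hre
  rw [schurIntegral_cons_gammaDensity (by simp [hre, hca]) fun i => buresExponent_re ha i,
    ← lineKernel_eq_prod_schurRatio M (by rw [hre]; exact h1), buresZ_zero_zero ha]
  ring

lemma schurRatio_sub_buresExponent {s : ℂ} (k : Fin n) :
    schurRatio (a - s) (buresExponent a k) = (k + 1 + s) / (2 * a + 1 + k - s) := by
  rw [schurRatio, buresExponent]
  congr 1 <;> ring

/-- Deleting the exponent `k + a + 1` divides its ratio with `a - s` out of the full kernel; hence
the inverse ratio under the integral. -/
lemma schurIntegral_cons_removeNth (ha : -1 < a) (k : Fin (n + 1)) {κ : ℂ}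
    (hκ : ∀ x : ℝ, 0 ≤ x → κ ≠ x) (h1 : -1 < c) (h0 : c < 0) (hca : c < a) :
    (-1) ^ (k : ℕ) * schurIntegral (Fin.cons (cauchyDensity a κ)
      (k.removeNth fun i => gammaDensity (buresExponent a i)) : Fin (n + 1) → ℝ → ℂ) =
      buresZ (n + 1) a ![] ![] * (buresCoeff a k * lineIntegral c fun s =>
        (-κ) ^ s * (lineKernel (n + 1) a s * ((2 * a + 1 + k - s) / (k + 1 + s)))) := by
  rw [schurIntegral_cons_cauchyDensity ha hκ h1 h0 hca
    (f := k.removeNth fun i => gammaDensity (buresExponent a i))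
    fun i => integrable_buresExponent ha (k.succAbove i), ← mul_assoc, ← lineIntegral_const_mul,
    ← lineIntegral_const_mul]
  refine lineIntegral_congr fun y => ?_
  have hre : ((c : ℂ) + y * Complex.I).re = c := by simp
  generalize (c : ℂ) + y * Complex.I = s at hre
  have hk : (0 : ℝ) ≤ (k : ℕ) := Nat.cast_nonneg _
  have hn : ((k : ℕ) : ℂ) + 1 + s ≠ 0 := fun h => by
    have := congrArg Complex.re h
    simp [hre] at this
    linarith
  have hd : (2 : ℂ) * a + 1 + (k : ℕ) - s ≠ 0 := fun h => by
    have := congrArg Complex.re h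
    simp [hre] at this
    linarith
  have h := schurIntegral_cons_gammaDensity (β := a - s)
    (α := k.removeNth fun i : Fin (n + 1) => buresExponent a i) (by simp [hre, hca])
    fun i => buresExponent_re ha _
  have h2 := schurIntegral_removeNth ha k
  have h3 := schurIntegral_gammaDensity (k.removeNth fun i : Fin (n + 1) => buresExponent a i)
    fun i => buresExponent_re ha _
  have e : (k.removeNth fun i => gammaDensity (buresExponent a i)) =
    fun i => gammaDensity ((k.removeNth fun i : Fin (n + 1) => buresExponent a i) i) := rfl
  rw [e] at h2 ⊢
  rw [h3] at h2
  rw [h, ← h2, ← lineKernel_eq_prod_schurRatio (n + 1) (by rw [hre]; exact h1),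
    Fin.prod_univ_succAbove _ k, schurRatio_sub_buresExponent]
  simp only [Fin.removeNth_apply]
  have h4 : (k + 1 + s) / (2 * a + 1 + k - s) * ((2 * a + 1 + k - s) / (k + 1 + s)) = 1 :=
    (div_mul_div_cancel₀ hd).trans (div_self hn)
  linear_combination (-(-κ) ^ s * Complex.Gamma (-s) * Complex.Gamma (1 + s) *
    Complex.Gamma (a - s) * (∏ i, schurRatio (a - s) (buresExponent a (k.succAbove i))) *
    ((-1) ^ (k : ℕ) * ((∏ i, Complex.Gamma (buresExponent a (k.succAbove i))) *
      schurProd (k.removeNth fun i => buresExponent a i)))) * h4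

lemma buresZ_one_one_eq (ha : -1 < a) {κ lam : ℂ} (hκ : ∀ x : ℝ, 0 ≤ x → κ ≠ x)
    (hne : κ ≠ lam) (h1 : -1 < c) (h0 : c < 0) (hca : c < a) :
    1 / (κ - lam) * buresZ (n + 1) a ![κ] ![lam] = buresZ (n + 1) a ![] ![] *
      (1 / (κ - lam) + ∑ k : Fin (n + 1), buresCoeff a k * lam ^ (k : ℕ) * lineIntegral c fun s =>
        (-κ) ^ s * (lineKernel (n + 1) a s * ((2 * a + 1 + k - s) / (k + 1 + s)))) := by
  have h := buresZ_one_one ha n hκ hne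
  have e : 1 / (κ - lam) = -(lam - κ)⁻¹ := by rw [← neg_sub lam, one_div, inv_neg]
  have hs : ∑ k : Fin (n + 1), (-1) ^ (k : ℕ) * lam ^ (k : ℕ) *
      schurIntegral (Fin.cons (cauchyDensity a κ)
      (k.removeNth fun i => gammaDensity (buresExponent a i)) : Fin (n + 1) → ℝ → ℂ) =
      buresZ (n + 1) a ![] ![] * ∑ k : Fin (n + 1), buresCoeff a k * lam ^ (k : ℕ) *
        lineIntegral c fun s =>
        (-κ) ^ s * (lineKernel (n + 1) a s * ((2 * a + 1 + k - s) / (k + 1 + s))) := by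
    rw [Finset.mul_sum]
    refine Finset.sum_congr rfl fun k _ => ?_
    linear_combination lam ^ (k : ℕ) * schurIntegral_cons_removeNth ha k hκ h1 h0 hca
  rw [hs] at h
  rw [e]
  linear_combination -h

/-- This brings the second Cauchy density to the front, where its Mellin–Barnes representation
applies. -/
lemma schurIntegral_cons_cons_swap (h₁ h₂ : ℝ → ℂ) (f : Fin n → ℝ → ℂ) :
    schurIntegral (Fin.cons h₁ (Fin.cons h₂ f) : Fin (n + 2) → ℝ → ℂ) =
      -schurIntegral (Fin.cons h₂ (Fin.cons h₁ f) : Fin (n + 2) → ℝ → ℂ) := by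
  have h := schurIntegral_comp_perm (Fin.cons h₂ (Fin.cons h₁ f) : Fin (n + 2) → ℝ → ℂ)
    (Equiv.swap 0 1)
  have e : (Fin.cons h₂ (Fin.cons h₁ f) : Fin (n + 2) → ℝ → ℂ) ∘ Equiv.swap 0 1 =
      Fin.cons h₁ (Fin.cons h₂ f) := by
    funext i
    induction i using Fin.cases with
    | zero => rfl
    | succ i =>
      induction i using Fin.cases with
      | zero => rfl
      | succ i =>
        rw [Function.comp_apply, Equiv.swap_apply_of_ne_of_ne (Fin.succ_ne_zero _)]
        · rfl
        · exact fun h => Fin.succ_ne_zero i (Fin.succ_injective _ h)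
  rw [e, Equiv.Perm.sign_swap (by simp)] at h
  rw [h]
  simp

/-- Each Cauchy density adds an exponent, `a - s` and `a - s'`. Their ratios with the old exponents
give the two kernels, and their mutual ratio is the coupling factor. -/
lemma buresZ_two_zero_eq (ha : -1 < a) (M : ℕ) {κ₁ κ₂ : ℂ} (hκ₁ : ∀ x : ℝ, 0 ≤ x → κ₁ ≠ x)
    (hκ₂ : ∀ x : ℝ, 0 ≤ x → κ₂ ≠ x) (h1 : -1 < c) (h0 : c < 0) (hca : c < a) :
    (κ₁ - κ₂) * buresZ (M + 2) a ![κ₁, κ₂] ![] = buresZ M a ![] ![] *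
      lineIntegral c fun s => lineIntegral c fun s' =>
        (-κ₁) ^ s * lineKernel M a s * ((-κ₂) ^ s' * lineKernel M a s') *
          ((s - s') / (2 * a - s - s')) := by
  rw [buresZ_two_zero ha M hκ₁ hκ₂, schurIntegral_cons_cauchyDensity ha hκ₁ h1 h0 hca
    fun i => by
      induction i using Fin.cases with
      | zero => exact integrable_cauchyDensity ha hκ₂
      | succ i => exact integrable_buresExponent ha i, ← lineIntegral_const_mul]
  refine lineIntegral_congr fun y => ?_
  have hre : ((c : ℂ) + y * Complex.I).re = c := by simp
  generalize (c : ℂ) + y * Complex.I = s at hre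
  have hs : 0 < ((a : ℂ) - s).re := by simp [hre, hca]
  rw [schurIntegral_cons_cons_swap, schurIntegral_cons_cauchyDensity ha hκ₂ h1 h0 hca
    fun i => by
      induction i using Fin.cases with
      | zero => exact integrable_gammaDensity hs
      | succ i => exact integrable_buresExponent ha i, mul_neg, ← neg_mul,
    ← lineIntegral_const_mul, ← lineIntegral_const_mul]
  refine lineIntegral_congr fun y => ?_
  have hre' : ((c : ℂ) + y * Complex.I).re = c := by simp
  generalize (c : ℂ) + y * Complex.I = s' at hre'
  have hs' : 0 < ((a : ℂ) - s').re := by simp [hre', hca]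
  have e : (Fin.cons (gammaDensity (a - s)) fun i => gammaDensity (buresExponent a i) :
      Fin (M + 1) → ℝ → ℂ) = fun i => gammaDensity ((Fin.cons (a - s)
        fun i : Fin M => buresExponent a i : Fin (M + 1) → ℂ) i) := by
    funext i
    induction i using Fin.cases <;> rfl
  rw [e, schurIntegral_cons_gammaDensity hs' fun i => by
    induction i using Fin.cases with
    | zero => exact hs
    | succ i => exact buresExponent_re ha i]
  simp only [Fin.prod_univ_succ, Fin.cons_zero, Fin.cons_succ, schurProd_cons]
  rw [← lineKernel_eq_prod_schurRatio M (by rw [hre]; exact h1),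
    ← lineKernel_eq_prod_schurRatio M (by rw [hre']; exact h1), buresZ_zero_zero ha]
  have h3 : schurRatio ((a : ℂ) - s') (a - s) = -((s - s') / (2 * a - s - s')) := by
    rw [schurRatio, ← neg_div]
    congr 1 <;> ring
  rw [h3]
  ring

end Averages
end

/-! ### Residue calculus for the loop contour. -/

noncomputable section

section Loop

lemma log_neg_of_im_pos {w : ℂ} (hw : 0 < w.im) :
    Complex.log (-w) = Complex.log w - Real.pi * Complex.I := by
  rw [Complex.log, Complex.log, norm_neg, Complex.arg_neg_eq_arg_sub_pi_of_im_pos hw]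
  push_cast
  ring

lemma mem_slitPlane_of_im_ne_zero {w : ℂ} (hw : w.im ≠ 0) : w ∈ Complex.slitPlane :=
  Complex.mem_slitPlane_iff.2 (Or.inr hw)

lemma mem_slitPlane_of_re_pos {w : ℂ} (hw : 0 < w.re) : w ∈ Complex.slitPlane :=
  Complex.mem_slitPlane_iff.2 (Or.inl hw)

lemma integral_inv_horizontal (c T k ε : ℝ) (hε : ε ≠ 0) :
    ∫ x in c..T, ((x : ℂ) + ε * Complex.I - k)⁻¹ =
      Complex.log (T + ε * Complex.I - k) - Complex.log (c + ε * Complex.I - k) := by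
  have hm : ∀ x : ℝ, (x : ℂ) + ε * Complex.I - k ∈ Complex.slitPlane := fun x =>
    mem_slitPlane_of_im_ne_zero (by simpa using hε)
  refine intervalIntegral.integral_eq_sub_of_hasDerivAt
    (f := fun x : ℝ => Complex.log ((x : ℂ) + ε * Complex.I - k)) (fun x _ => ?_) ?_
  · have h := ((Complex.ofRealCLM.hasDerivAt (x := x)).add_const (ε * Complex.I)).sub_const (k : ℂ)
    simpa [one_div] using h.clog_real (hm x)
  · refine (Continuous.inv₀ (by fun_prop) fun x => ?_).intervalIntegrable _ _
    exact Complex.slitPlane_ne_zero (hm x)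

lemma integral_inv_vertical {c k : ℝ} (σ : ℝ) (hσ : 0 < σ * (c - k)) :
    Complex.I * ∫ y in (-1 : ℝ)..1, ((c : ℂ) + y * Complex.I - k)⁻¹ =
      Complex.log (σ * (c + Complex.I - k)) - Complex.log (σ * (c - Complex.I - k)) := by
  have hm : ∀ y : ℝ, (σ : ℂ) * (c + y * Complex.I - k) ∈ Complex.slitPlane := fun y =>
    mem_slitPlane_of_re_pos (by simpa using hσ)
  have hσ0 : (σ : ℂ) ≠ 0 := by
    rintro h
    simp [Complex.ofReal_eq_zero.1 h] at hσ
  rw [← intervalIntegral.integral_const_mul]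
  have := intervalIntegral.integral_eq_sub_of_hasDerivAt
    (f := fun y : ℝ => Complex.log (σ * (c + y * Complex.I - k)))
    (f' := fun y : ℝ => Complex.I * ((c : ℂ) + y * Complex.I - k)⁻¹) (a := -1) (b := 1)
    (fun y _ => ?_) ?_
  · rw [this]
    push_cast
    ring_nf
  · have h := ((((Complex.ofRealCLM.hasDerivAt (x := y)).mul_const Complex.I).const_add
      (c : ℂ)).sub_const (k : ℂ)).const_mul (σ : ℂ)
    have h2 := h.clog_real (hm y)
    have h3 := right_ne_zero_of_mul (Complex.slitPlane_ne_zero (hm y))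
    refine HasDerivAt.congr_deriv (f' := (σ : ℂ) * (((1 : ℝ) : ℂ) * Complex.I) /
      (σ * (c + y * Complex.I - k))) h2 ?_
    push_cast
    field_simp
  · refine (Continuous.mul continuous_const (Continuous.inv₀ (by fun_prop) fun y => ?_)
      ).intervalIntegrable _ _
    exact right_ne_zero_of_mul (Complex.slitPlane_ne_zero (hm y))

/-- The principal logarithm is a primitive on three sides. On the left side, which crosses the cut,
the logarithm of `-(s - k)` is used, and the two mismatches of `π i` at its corners add up to `2π
i`. -/
lemma rect_integral_inv_sub {c T k : ℝ} (hc : c < k) (hT : k < T) :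
    (∫ x in c..T, ((x : ℂ) - Complex.I - k)⁻¹) - (∫ x in c..T, ((x : ℂ) + Complex.I - k)⁻¹) +
      Complex.I * (∫ y in (-1 : ℝ)..1, ((T : ℂ) + y * Complex.I - k)⁻¹) -
      Complex.I * (∫ y in (-1 : ℝ)..1, ((c : ℂ) + y * Complex.I - k)⁻¹) =
      2 * Real.pi * Complex.I := by
  have h1 := integral_inv_horizontal c T k (-1) (by norm_num)
  have h2 := integral_inv_horizontal c T k 1 (by norm_num)
  have h3 := integral_inv_vertical (c := T) (k := k) 1 (by linarith)
  have h4 := integral_inv_vertical (c := c) (k := k) (-1) (by linarith)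
  push_cast at h1 h2 h3 h4
  simp only [one_mul, neg_one_mul, ← sub_eq_add_neg] at h1 h2 h3 h4
  have h5 := log_neg_of_im_pos (w := (c : ℂ) + Complex.I - k) (by simp)
  have h6 := log_neg_of_im_pos (w := -((c : ℂ) - Complex.I - k)) (by simp)
  rw [neg_neg] at h6
  rw [h1, h2, h3, h4, h5, h6]
  ring

variable {A : ℂ → ℂ}

/-- The quotient `(A(s) - A(k))/(s - k)` extends holomorphically over `k` and integrates to zero,
which leaves `A(k)` times the integral of `1/(s - k)`. -/
lemma rect_integral_div_sub (hA : Differentiable ℂ A) {c T k : ℝ} (hc : c < k) (hT : k < T) :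
    (∫ x in c..T, A (x - Complex.I) / (x - Complex.I - k)) -
      (∫ x in c..T, A (x + Complex.I) / (x + Complex.I - k)) +
      Complex.I * (∫ y in (-1 : ℝ)..1, A (T + y * Complex.I) / (T + y * Complex.I - k)) -
      Complex.I * (∫ y in (-1 : ℝ)..1, A (c + y * Complex.I) / (c + y * Complex.I - k)) =
      2 * Real.pi * Complex.I * A k := by
  have hcont : Continuous (dslope A k) := continuous_iff_continuousAt.2 fun s => by
    rcases eq_or_ne s k with rfl | h
    · exact continuousAt_dslope_same.2 (hA _)
    · exact (continuousAt_dslope_of_ne h).2 (hA s).continuousAt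
  have h := Complex.integral_boundary_rect_eq_zero_of_differentiable_on_off_countable
    (dslope A k) (c - Complex.I) (T + Complex.I) {(k : ℂ)} (countable_singleton _)
    hcont.continuousOn fun s hs => (differentiableAt_dslope_of_ne fun h => hs.2 h).2 (hA s)
  simp only [Complex.sub_re, Complex.add_re, Complex.ofReal_re, Complex.I_re, sub_zero, add_zero,
    Complex.sub_im, Complex.add_im, Complex.ofReal_im, Complex.I_im, zero_sub, zero_add,
    smul_eq_mul, Complex.ofReal_neg, Complex.ofReal_one, neg_one_mul, one_mul,
    ← sub_eq_add_neg] at h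
  have key : ∀ (γ : ℝ → ℂ) (u v : ℝ), Continuous γ → (∀ x, γ x ≠ k) →
      ∫ x in u..v, dslope A k (γ x) =
        (∫ x in u..v, A (γ x) / (γ x - k)) - A k * ∫ x in u..v, (γ x - k)⁻¹ := by
    intro γ u v hγ hne
    have hne' : ∀ x, γ x - k ≠ 0 := fun x => sub_ne_zero.2 (hne x)
    rw [← intervalIntegral.integral_const_mul, ← intervalIntegral.integral_sub]
    · refine intervalIntegral.integral_congr fun x _ => ?_
      rw [dslope_of_ne _ (hne x), slope_def_field, sub_div, div_eq_mul_inv (A k)]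
    · exact ((hA.continuous.comp hγ).div (hγ.sub continuous_const) hne').intervalIntegrable _ _
    · exact (continuous_const.mul ((hγ.sub continuous_const).inv₀ hne')).intervalIntegrable _ _
  have him : ∀ s : ℂ, s.im ≠ 0 → s ≠ k := fun s hs h => hs (by simp [h])
  have hre : ∀ s : ℂ, s.re ≠ k → s ≠ k := fun s hs h => hs (by simp [h])
  rw [key (fun x : ℝ => (x : ℂ) - Complex.I) _ _ (by fun_prop) fun x => him _ (by simp),
    key (fun x : ℝ => (x : ℂ) + Complex.I) _ _ (by fun_prop) fun x => him _ (by simp),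
    key (fun y : ℝ => (T : ℂ) + y * Complex.I) _ _ (by fun_prop) fun x => hre _ (by simp [hT.ne']),
    key (fun y : ℝ => (c : ℂ) + y * Complex.I) _ _ (by fun_prop)
      fun x => hre _ (by simp [hc.ne])] at h
  linear_combination h + A k * rect_integral_inv_sub hc hT

/-- The three edges of the loop of `loopIntegral` carry integrable functions. -/
structure LoopIntegrable (c : ℝ) (f : ℂ → ℂ) : Prop where
  lower : IntegrableOn (fun x : ℝ => f (x - Complex.I)) (Ioi c)
  left : IntervalIntegrable (fun y : ℝ => f (c + y * Complex.I)) volume (-1) 1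
  upper : IntegrableOn (fun x : ℝ => f (x + Complex.I)) (Ioi c)

lemma loopIntegral_sum {ι : Type*} (s : Finset ι) {c : ℝ} {f : ι → ℂ → ℂ} (w : ι → ℂ)
    (hf : ∀ i ∈ s, LoopIntegrable c (f i)) :
    loopIntegral c (fun z => ∑ i ∈ s, w i * f i z) = ∑ i ∈ s, w i * loopIntegral c (f i) := by
  simp only [loopIntegral]
  rw [integral_finsetSum _ fun i hi => (hf i hi).lower.const_mul _,
    integral_finsetSum _ fun i hi => (hf i hi).upper.const_mul _,
    intervalIntegral.integral_finsetSum fun i hi => (hf i hi).left.const_mul _]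
  simp only [integral_const_mul, intervalIntegral.integral_const_mul, ← Finset.sum_neg_distrib,
    Finset.mul_sum, ← Finset.sum_add_distrib]
  exact Finset.sum_congr rfl fun i _ => by ring

/-- The loop meets the real axis in a single point. Gamma identities are thus needed only off the
axis, where no argument is a pole. -/
lemma loopIntegral_congr {c : ℝ} {f g : ℂ → ℂ} (h : ∀ s : ℂ, s.im ≠ 0 → f s = g s) :
    loopIntegral c f = loopIntegral c g := by
  have h1 : ∫ y in (-1 : ℝ)..1, f (c + y * Complex.I) =
      ∫ y in (-1 : ℝ)..1, g (c + y * Complex.I) := by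
    refine intervalIntegral.integral_congr_ae ?_
    filter_upwards [compl_mem_ae_iff.2 (measure_singleton (0 : ℝ))] with y hy _
    exact h _ (by simpa using hy)
  rw [loopIntegral, loopIntegral, h1]
  congr 3
  · exact congrArg _ (integral_congr_ae (Eventually.of_forall fun x => h _ (by simp)))
  · exact funext fun x => h _ (by simp)

lemma loopIntegrable_div_sub (hA : Differentiable ℂ A) {c C k : ℝ} (hc : c < k)
    (hC : ∀ s : ℂ, c ≤ s.re → |s.im| ≤ 1 → ‖A s‖ ≤ C * Real.exp (-s.re)) :
    LoopIntegrable c fun s => A s / (k - s) := by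
  have key : ∀ ε : ℝ, |ε| = 1 → IntegrableOn
      (fun x : ℝ => A (x + ε * Complex.I) / (k - (x + ε * Complex.I))) (Ioi c) := fun ε hε => by
    have hn : ∀ x : ℝ, 1 ≤ ‖(k : ℂ) - (x + ε * Complex.I)‖ := fun x => by
      refine le_trans ?_ (Complex.abs_im_le_norm _)
      simp [hε]
    refine Integrable.mono' (g := fun x => C * Real.exp (-x))
      ((integrableOn_exp_neg_Ioi c).const_mul C) ?_ ?_
    · refine (Continuous.div (hA.continuous.comp (by fun_prop)) (by fun_prop)
        fun x h => ?_).aestronglyMeasurable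
      have := hn x
      rw [h, norm_zero] at this
      linarith
    · refine (ae_restrict_mem measurableSet_Ioi).mono fun x hx => ?_
      rw [norm_div]
      refine (div_le_self (norm_nonneg _) (hn x)).trans ?_
      simpa using hC (x + ε * Complex.I) (by simpa using (mem_Ioi.1 hx).le) (by simp [hε])
  refine ⟨?_, ?_, ?_⟩
  · simpa [← sub_eq_add_neg] using key (-1) (by simp)
  · refine (Continuous.div (hA.continuous.comp (by fun_prop)) (by fun_prop)
      fun y h => ?_).intervalIntegrable _ _
    have := congrArg Complex.re h
    simp at this
    linarith
  · simpa using key 1 (by simp)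

/-- The residue theorem for a simple pole and a function decaying to the right. -/
lemma loopIntegral_div_sub (hA : Differentiable ℂ A) {c C k : ℝ} (hc : c < k)
    (hC : ∀ s : ℂ, c ≤ s.re → |s.im| ≤ 1 → ‖A s‖ ≤ C * Real.exp (-s.re)) :
    loopIntegral c (fun s => A s / (k - s)) = A k := by
  have hL := loopIntegrable_div_sub hA hc hC
  have hneg : ∀ s : ℂ, A s / (k - s) = -(A s / (s - k)) := fun s => by
    rw [← neg_sub, div_neg]
  have h1 := intervalIntegral_tendsto_integral_Ioi c hL.lower tendsto_id
  have h2 := intervalIntegral_tendsto_integral_Ioi c hL.upper tendsto_id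
  -- The loop is a rectangle whose right side goes to infinity, and the integral over that side
  -- vanishes in the limit.
  have h3 : Tendsto (fun T : ℝ => ∫ y in (-1 : ℝ)..1, A (T + y * Complex.I) /
      (T + y * Complex.I - k)) atTop (𝓝 0) := by
    have hlim : Tendsto (fun T : ℝ => C * Real.exp (-T) * |1 - (-1)|) atTop (𝓝 0) := by
      have := (Real.tendsto_exp_atBot.comp tendsto_neg_atTop_atBot).const_mul C
        |>.mul_const |(1 : ℝ) - (-1)|
      simpa using this
    refine squeeze_zero_norm' ?_ hlim
    filter_upwards [eventually_ge_atTop (k + 1)] with T hT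
    refine intervalIntegral.norm_integral_le_of_norm_le_const fun y hy => ?_
    rw [uIoc_of_le (by norm_num)] at hy
    rw [norm_div]
    refine (div_le_self (norm_nonneg _) ?_).trans ?_
    · refine le_trans ?_ (Complex.re_le_norm _)
      simp
      linarith
    · simpa using hC (T + y * Complex.I) (by simp; linarith)
        (by simpa using abs_le.2 ⟨hy.1.le, hy.2⟩)
  have h4 := ((h1.neg.add h2).add ((h3.const_mul Complex.I))).add_const
    (Complex.I * ∫ y in (-1 : ℝ)..1, A (c + y * Complex.I) / (k - (c + y * Complex.I)))
  have h5 := tendsto_nhds_unique h4 (tendsto_const_nhds (x := 2 * Real.pi * Complex.I * A k)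
    |>.congr' ?_)
  · rw [loopIntegral, one_div, inv_mul_eq_iff_eq_mul₀ Complex.two_pi_I_ne_zero, ← h5]
    ring
  · filter_upwards [eventually_gt_atTop k] with T hT
    rw [← rect_integral_div_sub hA hc hT]
    simp only [hneg, intervalIntegral.integral_neg, id]
    ring

end Loop
end

/-! ### The functions `G^{1,1}_{2,3}` as polynomials. -/

noncomputable section

section Polynomial

/-- At most exponential growth on the half strip `c ≤ Re s`, `|Im s| ≤ 1`. -/
def HalfStripBound (c : ℝ) (f : ℂ → ℂ) : Prop :=
  ∃ K C : ℝ, ∀ s : ℂ, c ≤ s.re → |s.im| ≤ 1 → ‖f s‖ ≤ C * Real.exp (K * s.re)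

namespace HalfStripBound

variable {c : ℝ} {f g : ℂ → ℂ}

lemma mul (hf : HalfStripBound c f) (hg : HalfStripBound c g) :
    HalfStripBound c fun s => f s * g s := by
  obtain ⟨K, C, hC⟩ := hf
  obtain ⟨L, D, hD⟩ := hg
  refine ⟨K + L, C * D, fun s h1 h2 => ?_⟩
  rw [norm_mul, add_mul, Real.exp_add, mul_mul_mul_comm]
  exact mul_le_mul (hC s h1 h2) (hD s h1 h2) (norm_nonneg _) ((norm_nonneg _).trans (hC s h1 h2))

lemma const_add (β : ℂ) : HalfStripBound c fun s => β + s := by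
  refine ⟨1, (2 + |c| + ‖β‖) * Real.exp (-c), fun s h1 h2 => ?_⟩
  have h3 : s.re - c + 1 ≤ Real.exp (s.re - c) := Real.add_one_le_exp _
  have h4 : |s.re| ≤ (s.re - c) + |c| := by
    calc |s.re| = |(s.re - c) + c| := by ring_nf
      _ ≤ |s.re - c| + |c| := abs_add_le _ _
      _ = _ := by rw [abs_of_nonneg (by linarith)]
  have h5 : 1 ≤ Real.exp (s.re - c) := by linarith
  have h6 : |c| + 1 + ‖β‖ ≤ (|c| + 1 + ‖β‖) * Real.exp (s.re - c) :=
    le_mul_of_one_le_right (by positivity) h5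
  calc ‖β + s‖ ≤ ‖β‖ + ‖s‖ := norm_add_le _ _
    _ ≤ ‖β‖ + (|s.re| + |s.im|) := by gcongr; exact Complex.norm_le_abs_re_add_abs_im s
    _ ≤ (2 + |c| + ‖β‖) * Real.exp (s.re - c) := by linarith
    _ = _ := by rw [mul_assoc, ← Real.exp_add]; ring_nf

lemma cpow {z : ℂ} (hz : z ≠ 0) : HalfStripBound c fun s => z ^ s := by
  refine ⟨Real.log ‖z‖, Real.exp Real.pi, fun s _ h2 => ?_⟩
  rw [Complex.norm_cpow_of_ne_zero hz, Real.rpow_def_of_pos (norm_pos_iff.2 hz), div_eq_mul_inv,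
    ← Real.exp_neg, mul_comm]
  gcongr
  calc -(z.arg * s.im) ≤ |z.arg * s.im| := neg_le_abs _
    _ = |z.arg| * |s.im| := abs_mul _ _
    _ ≤ Real.pi * 1 := by gcongr; exact Complex.abs_arg_le_pi z
    _ = Real.pi := mul_one _

lemma neg (hf : HalfStripBound c f) : HalfStripBound c fun s => -f s := by
  simpa only [HalfStripBound, norm_neg] using hf

lemma prod {M : ℕ} {F : ℕ → ℂ → ℂ} (hF : ∀ j, HalfStripBound c (F j)) :
    HalfStripBound c fun s => ∏ j ∈ Finset.range M, F j s := by
  induction M with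
  | zero => exact ⟨0, 1, fun s _ _ => by simp⟩
  | succ M ih =>
    simp only [Finset.prod_range_succ]
    exact ih.mul (hF M)

end HalfStripBound

/-- The reciprocal Gamma function decays faster than any exponential to the right. -/
lemma exists_norm_inv_Gamma_le (c e K : ℝ) : ∃ C : ℝ, ∀ s : ℂ, c ≤ s.re → |s.im| ≤ 1 →
    ‖(Complex.Gamma (e + s))⁻¹‖ ≤ C * Real.exp (-K * s.re) := by
  -- Once the real part of `s` is at least `x₀`, a unit step to the right multiplies `|Γ(e + s)|` by
  -- at least `e^K`. Compactness covers the initial piece, and induction on the number of steps the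
  -- rest.
  obtain ⟨x₀, hx₀, hcx⟩ : ∃ x₀ : ℝ, Real.exp K ≤ e + x₀ ∧ c ≤ x₀ :=
    ⟨max (Real.exp K - e) c, by linarith [le_max_left (Real.exp K - e) c], le_max_right _ _⟩
  have hcont : Continuous fun s : ℂ => ‖(Complex.Gamma (e + s))⁻¹‖ / Real.exp (-K * s.re) := by
    refine Continuous.div (Complex.differentiable_one_div_Gamma.continuous.comp (by fun_prop)).norm
      (by fun_prop) fun _ => (Real.exp_pos _).ne'
  have hK : IsCompact (Icc c (x₀ + 1) ×ℂ Icc (-1) 1) := isCompact_Icc.reProdIm isCompact_Icc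
  obtain ⟨C, hC⟩ := (hK.image hcont).bddAbove
  have key : ∀ n : ℕ, ∀ s : ℂ, c ≤ s.re → |s.im| ≤ 1 → s.re ≤ x₀ + 1 + n →
      ‖(Complex.Gamma (e + s))⁻¹‖ ≤ C * Real.exp (-K * s.re) := by
    intro n
    induction n with
    | zero =>
      intro s h1 h2 h3
      have := hC ⟨s, Complex.mem_reProdIm.2 ⟨⟨h1, by simpa using h3⟩, abs_le.1 h2⟩, rfl⟩
      rwa [div_le_iff₀ (Real.exp_pos _)] at this
    | succ n ih =>
      intro s h1 h2 h3
      push_cast at h3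
      rcases le_or_gt s.re (x₀ + 1 + n) with h | h
      · exact ih s h1 h2 h
      have hn : (0 : ℝ) ≤ n := Nat.cast_nonneg _
      have h4 : c ≤ (s - 1).re := by simp; linarith
      have h5 := ih (s - 1) h4 (by simpa using h2) (by simp; linarith)
      have h6 : Real.exp K ≤ ‖(e : ℂ) + (s - 1)‖ := by
        refine le_trans ?_ (Complex.re_le_norm _)
        simp
        linarith
      rw [Complex.one_div_Gamma_eq_self_mul_one_div_Gamma_add_one, norm_mul,
        show (e : ℂ) + (s - 1) + 1 = e + s by ring] at h5
      have h7 : Real.exp K * ‖(Complex.Gamma (e + s))⁻¹‖ ≤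
          C * Real.exp (-K * (s - 1).re) := le_trans (by gcongr) h5
      rw [← le_div_iff₀' (Real.exp_pos _), mul_div_assoc, ← Real.exp_sub] at h7
      refine h7.trans_eq ?_
      simp only [Complex.sub_re, Complex.one_re]
      ring_nf
  refine ⟨C, fun s h1 h2 => ?_⟩
  obtain ⟨n, hn⟩ := exists_nat_ge (s.re - (x₀ + 1))
  exact key n s h1 h2 (by linarith)

lemma HalfStripBound.exists_mul_inv_Gamma_le {c : ℝ} {g : ℂ → ℂ} (hg : HalfStripBound c g)
    (e : ℝ) : ∃ C : ℝ, ∀ s : ℂ, c ≤ s.re → |s.im| ≤ 1 →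
      ‖g s * (Complex.Gamma (e + s))⁻¹‖ ≤ C * Real.exp (-s.re) := by
  obtain ⟨K, C, hC⟩ := hg
  obtain ⟨D, hD⟩ := exists_norm_inv_Gamma_le c e (K + 1)
  refine ⟨C * D, fun s h1 h2 => ?_⟩
  rw [norm_mul]
  refine (mul_le_mul (hC s h1 h2) (hD s h1 h2) (norm_nonneg _)
    ((norm_nonneg _).trans (hC s h1 h2))).trans_eq ?_
  rw [mul_mul_mul_comm, ← Real.exp_add]
  ring_nf

/-- These partial fractions are the identity that the Lagrange basis polynomials at `0, …, m` sum to
`1`, divided by the full product. -/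
lemma inv_prod_sub_eq_sum (m : ℕ) {s : ℂ} (hs : s.im ≠ 0) :
    (∏ j ∈ Finset.range (m + 1), ((j : ℂ) - s))⁻¹ =
      ∑ k : Fin (m + 1), (∏ i : Fin m, (((k.succAbove i : ℕ) : ℂ) - (k : ℕ)))⁻¹ *
        ((k : ℕ) - s)⁻¹ := by
  have hne : ∀ j : ℕ, (j : ℂ) - s ≠ 0 := fun j h => hs (by simpa using congrArg Complex.im h)
  have hv : Function.Injective fun i : Fin (m + 1) => ((i : ℕ) : ℂ) := fun i j h =>
    Fin.ext (Nat.cast_injective h)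
  have h := congrArg (Polynomial.eval s) (Lagrange.sum_basis (s := Finset.univ) hv.injOn
    Finset.univ_nonempty)
  rw [Polynomial.eval_finsetSum, Polynomial.eval_one] at h
  rw [inv_eq_one_div, ← h, Finset.sum_div]
  refine Finset.sum_congr rfl fun k _ => ?_
  have e : Finset.univ.erase k = Finset.univ.image k.succAbove := by
    rw [Fin.image_succAbove_univ, Finset.compl_singleton]
  rw [Lagrange.basis, Polynomial.eval_prod, e, Finset.prod_image
    fun a _ b _ hab => Fin.succAbove_right_injective hab, Finset.prod_range,
    Fin.prod_univ_succAbove _ k, ← Finset.prod_inv_distrib,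
    div_eq_iff (mul_ne_zero (hne _) (Finset.prod_ne_zero_iff.2 fun i _ => hne _)),
    mul_assoc, inv_mul_cancel_left₀ (hne _), ← Finset.prod_mul_distrib]
  refine Finset.prod_congr rfl fun i _ => ?_
  simp only [Lagrange.basisDivisor, Polynomial.eval_mul, Polynomial.eval_C, Polynomial.eval_sub,
    Polynomial.eval_X]
  rw [← neg_sub, inv_neg, neg_mul, ← mul_neg, neg_sub]

variable {g : ℂ → ℂ} {c : ℝ}

lemma loopIntegral_mul_inv_Gamma (hg : Differentiable ℂ g) (hb : HalfStripBound c g) (e : ℝ)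
    (hc : c < 0) (m : ℕ) :
    loopIntegral c (fun s => g s * (Complex.Gamma (e + s))⁻¹ *
      (∏ j ∈ Finset.range (m + 1), ((j : ℂ) - s))⁻¹) =
      ∑ k : Fin (m + 1), (∏ i : Fin m, (((k.succAbove i : ℕ) : ℂ) - (k : ℕ)))⁻¹ *
        (g (k : ℕ) * (Complex.Gamma (e + (k : ℕ)))⁻¹) := by
  obtain ⟨C, hC⟩ := hb.exists_mul_inv_Gamma_le e
  have hA : Differentiable ℂ fun s => g s * (Complex.Gamma (e + s))⁻¹ :=
    hg.mul (Complex.differentiable_one_div_Gamma.comp ((differentiable_const _).add differentiable_id))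
  have hk : ∀ k : ℕ, c < (k : ℝ) := fun k => hc.trans_le (Nat.cast_nonneg _)
  rw [loopIntegral_congr (g := fun s => ∑ k : Fin (m + 1),
    (∏ i : Fin m, (((k.succAbove i : ℕ) : ℂ) - (k : ℕ)))⁻¹ *
      (g s * (Complex.Gamma (e + s))⁻¹ / (((k : ℕ) : ℝ) - s))), loopIntegral_sum]
  · refine Finset.sum_congr rfl fun k _ => ?_
    rw [loopIntegral_div_sub hA (hk k) hC, Complex.ofReal_natCast]
  · exact fun k _ => loopIntegrable_div_sub hA (hk k) hC
  · intro s hs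
    rw [inv_prod_sub_eq_sum m hs, Finset.mul_sum]
    refine Finset.sum_congr rfl fun k _ => ?_
    rw [Complex.ofReal_natCast]
    ring

/-- An artificial factor `s/s` reduces this to the case of one pole at `0`, with residue zero. -/
lemma loopIntegral_mul_inv_Gamma_eq_zero (hg : Differentiable ℂ g) (hb : HalfStripBound c g)
    (e : ℝ) (hc : c < 0) : loopIntegral c (fun s => g s * (Complex.Gamma (e + s))⁻¹) = 0 := by
  have h := loopIntegral_mul_inv_Gamma (g := fun s => -(g s * (0 + s)))
    (hg.mul ((differentiable_const _).add differentiable_id)).neg (hb.mul (.const_add 0)).neg e hc 0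
  rw [Fin.sum_univ_one, Fin.val_zero, Nat.cast_zero, add_zero, mul_zero, neg_zero, zero_mul,
    mul_zero] at h
  rw [← h]
  refine loopIntegral_congr fun s hs => ?_
  have hs' : s ≠ 0 := fun h => hs (by simp [h])
  rw [Finset.prod_range_one, Nat.cast_zero, zero_sub, zero_add]
  field_simp

/-- Two Gamma quotients collapse: `Γ(2a+2+M+s)/Γ(2a+2+s)` is a polynomial, and `Γ(-s)/Γ(M-s)` leaves
only the poles `0, …, M-1`. The third lower parameter is written `1 - e` so that both companion
functions are covered, with `e = a + 1` and `e = a + 2`. -/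
lemma meijerG11_eq_loopIntegral (a e : ℝ) (ha : -1 < a) (M : ℕ) {x : ℂ} (hx : x ≠ 0) :
    ∃ c < 0, meijerG11 (-2 * a - M - 1) M 0 (1 - e) (-2 * a - 1) x = loopIntegral c fun s =>
      (x ^ s * ∏ j ∈ Finset.range M, (((2 * a + 2 + j : ℝ) : ℂ) + s)) *
        (Complex.Gamma (e + s))⁻¹ * (∏ j ∈ Finset.range M, ((j : ℂ) - s))⁻¹ := by
  have hM : (0 : ℝ) ≤ M := Nat.cast_nonneg _
  have hex : ∃ c : ℝ, (∀ j, (![-2 * a - M - 1] : Fin 1 → ℝ) j - 1 < c) ∧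
      ∀ j, c < (![0] : Fin 1 → ℝ) j := by
    refine ⟨(-2 * a - 2) / 2, fun j => ?_, fun j => ?_⟩ <;> simp <;> linarith
  have hspec := Classical.epsilon_spec hex
  refine ⟨meijerAbscissa ![-2 * a - M - 1] ![0], hspec.2 0, ?_⟩
  rw [meijerG11, meijerG, if_neg hx, meijerIntegral, if_neg (by norm_num)]
  refine loopIntegral_congr fun s hs => ?_
  have h1 : ∀ m : ℕ, (2 * a + 2 + s : ℂ) ≠ -m := fun m h => hs (by simpa using congrArg Complex.im h)
  have h2 : ∀ m : ℕ, -s ≠ -m := fun m h => hs (by simpa using congrArg Complex.im h)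
  have h3 := Gamma_nat_add M h1
  have h4 := Gamma_nat_add M h2
  have h5 := Complex.Gamma_ne_zero h1
  have h6 := Complex.Gamma_ne_zero h2
  have e1 : ∏ j ∈ Finset.range M, ((j : ℂ) - s) = ∏ j ∈ Finset.range M, (-s + (j : ℂ)) :=
    Finset.prod_congr rfl fun j _ => by ring
  have e2 : ∏ j ∈ Finset.range M, (((2 * a + 2 + j : ℝ) : ℂ) + s) =
      ∏ j ∈ Finset.range M, (2 * a + 2 + s + (j : ℂ)) :=
    Finset.prod_congr rfl fun j _ => by push_cast; ring
  simp only [meijerIntegrand, Fin.prod_univ_one, Fin.prod_univ_two, Matrix.cons_val_zero,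
    Matrix.cons_val_one, Matrix.cons_val_fin_one]
  rw [e2]
  push_cast
  rw [show (0 : ℂ) - s = -s by ring, show (1 : ℂ) - (-2 * a - M - 1) + s = 2 * a + 2 + s + M by ring,
    show (1 : ℂ) - (1 - e) + s = e + s by ring, show (1 : ℂ) - (-2 * a - 1) + s = 2 * a + 2 + s by
    ring, show (M : ℂ) - s = -s + M by ring, h3, h4, e1]
  generalize ∏ j ∈ Finset.range M, (-s + (j : ℂ)) = p
  generalize Complex.Gamma (e + s) = q
  generalize Complex.Gamma (-s) = u at h6 ⊢
  generalize Complex.Gamma (2 * a + 2 + s) = v at h5 ⊢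
  simp only [div_eq_mul_inv, mul_inv]
  field_simp

lemma differentiable_cpow_mul_prod (a : ℝ) (M : ℕ) {x : ℂ} (hx : x ≠ 0) :
    Differentiable ℂ fun s : ℂ =>
      x ^ s * ∏ j ∈ Finset.range M, (((2 * a + 2 + j : ℝ) : ℂ) + s) := by
  refine Differentiable.mul (fun s => DifferentiableAt.const_cpow differentiableAt_id (Or.inl hx)) ?_
  exact Differentiable.fun_finsetProd fun _ _ => (differentiable_const _).add differentiable_id

lemma halfStripBound_cpow_mul_prod (c a : ℝ) (M : ℕ) {x : ℂ} (hx : x ≠ 0) :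
    HalfStripBound c fun s : ℂ =>
      x ^ s * ∏ j ∈ Finset.range M, (((2 * a + 2 + j : ℝ) : ℂ) + s) :=
  (HalfStripBound.cpow hx).mul (HalfStripBound.prod fun _ => .const_add _)

lemma meijerG11_eq_of_ne_zero {a₁ a₂ b₁ b₂ b₃ : ℝ} {p : ℂ → ℂ} (hp : Continuous p)
    (h : ∀ x ≠ 0, meijerG11 a₁ a₂ b₁ b₂ b₃ x = p x) (x : ℂ) : meijerG11 a₁ a₂ b₁ b₂ b₃ x = p x := by
  rcases eq_or_ne x 0 with rfl | hx
  · rw [meijerG11, meijerG, if_pos rfl]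
    refine ((hp.tendsto 0).mono_left nhdsWithin_le_nhds |>.congr' ?_).limUnder_eq
    filter_upwards [self_mem_nhdsWithin] with x hx
    rw [← h x hx, meijerG11, meijerG, if_neg (mem_compl_singleton_iff.1 hx)]
  · exact h x hx

/-- For `M = 0` no pole is left inside the loop. -/
lemma meijerG11_zero (a e : ℝ) (ha : -1 < a) (x : ℂ) :
    meijerG11 (-2 * a - (0 : ℕ) - 1) (0 : ℕ) 0 (1 - e) (-2 * a - 1) x = 0 := by
  refine meijerG11_eq_of_ne_zero continuous_const (fun x hx => ?_) x
  obtain ⟨c, hc, h⟩ := meijerG11_eq_loopIntegral a e ha 0 hx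
  rw [h, ← loopIntegral_mul_inv_Gamma_eq_zero (differentiable_cpow_mul_prod a 0 hx)
    (halfStripBound_cpow_mul_prod c a 0 hx) e hc]
  simp

/-- In the residue at `k` the linear factors with index `i ≠ k` pair up into inverse Schur ratios,
that is, into `buresCoeff`; the unpaired numerator factor is `2a + 2 + 2k`, twice the exponent. -/
lemma meijerG11_succ (a e : ℝ) (ha : -1 < a) (m : ℕ) (x : ℂ) :
    meijerG11 (-2 * a - (m + 1 : ℕ) - 1) (m + 1 : ℕ) 0 (1 - e) (-2 * a - 1) x =
      ∑ k : Fin (m + 1), 2 * (buresExponent a k * Complex.Gamma (buresExponent a k) *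
        (Complex.Gamma (e + (k : ℕ)))⁻¹) * buresCoeff a k * x ^ (k : ℕ) := by
  refine meijerG11_eq_of_ne_zero (p := fun x => ∑ k : Fin (m + 1), 2 * (buresExponent a k *
    Complex.Gamma (buresExponent a k) * (Complex.Gamma (e + (k : ℕ)))⁻¹) * buresCoeff a k *
      x ^ (k : ℕ)) (by fun_prop) (fun x hx => ?_) x
  obtain ⟨c, hc, h⟩ := meijerG11_eq_loopIntegral a e ha (m + 1) hx
  rw [h, loopIntegral_mul_inv_Gamma (differentiable_cpow_mul_prod a (m + 1) hx)
    (halfStripBound_cpow_mul_prod c a (m + 1) hx) e hc]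
  refine Finset.sum_congr rfl fun k _ => ?_
  have hG := Gamma_buresExponent_ne_zero ha k
  rw [Complex.cpow_natCast, Finset.prod_range, Fin.prod_univ_succAbove _ k, buresCoeff, mul_inv,
    ← Finset.prod_inv_distrib, ← Finset.prod_inv_distrib]
  have e1 : ∏ i : Fin m, (schurRatio (buresExponent a k) (buresExponent a (k.succAbove i)))⁻¹ =
      (∏ i : Fin m, (((k.succAbove i : ℕ) : ℂ) - (k : ℕ))⁻¹) *
        ∏ i : Fin m, (((2 * a + 2 + (k.succAbove i : ℕ) : ℝ) : ℂ) + (k : ℕ)) := by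
    rw [← Finset.prod_mul_distrib]
    refine Finset.prod_congr rfl fun i _ => ?_
    rw [schurRatio, inv_div, div_eq_inv_mul, buresExponent, buresExponent]
    push_cast
    congr 1
    · congr 1
      ring
    · ring
  rw [e1]
  have e2 : ((2 * a + 2 + (k : ℕ) : ℝ) : ℂ) + (k : ℕ) = 2 * buresExponent a k := by
    rw [buresExponent]
    push_cast
    ring
  rw [e2]
  field_simp

/-- Here `1/Γ(e + k)` cancels the Gamma factor together with the exponent; in the companion
`meijerG11_succ_eq_sum_mul` the exponent survives as a weight. -/
lemma meijerG11_succ_eq_sum (a : ℝ) (ha : -1 < a) (m : ℕ) (x : ℂ) :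
    meijerG11 (-2 * a - (m + 1 : ℕ) - 1) (m + 1 : ℕ) 0 (-a - 1) (-2 * a - 1) x =
      ∑ k : Fin (m + 1), 2 * buresCoeff a k * x ^ (k : ℕ) := by
  have h := meijerG11_succ a (a + 2) ha m x
  rw [show 1 - (a + 2) = -a - 1 by ring] at h
  rw [h]
  refine Finset.sum_congr rfl fun k _ => ?_
  have h0 : buresExponent a k ≠ 0 := Complex.ne_zero_of_re_pos (buresExponent_re ha k)
  have hG := Gamma_buresExponent_ne_zero ha k
  rw [show ((a + 2 : ℝ) : ℂ) + (k : ℕ) = buresExponent a k + 1 by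
    rw [buresExponent]; push_cast; ring, Complex.Gamma_add_one _ h0,
    mul_inv_cancel₀ (mul_ne_zero h0 hG), mul_one]

lemma meijerG11_succ_eq_sum_mul (a : ℝ) (ha : -1 < a) (m : ℕ) (x : ℂ) :
    meijerG11 (-2 * a - (m + 1 : ℕ) - 1) (m + 1 : ℕ) 0 (-a) (-2 * a - 1) x =
      ∑ k : Fin (m + 1), 2 * buresExponent a k * buresCoeff a k * x ^ (k : ℕ) := by
  have h := meijerG11_succ a (a + 1) ha m x
  rw [show 1 - (a + 1) = -a by ring] at h
  rw [h]
  refine Finset.sum_congr rfl fun k _ => ?_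
  have hG := Gamma_buresExponent_ne_zero ha k
  rw [show ((a + 1 : ℝ) : ℂ) + (k : ℕ) = buresExponent a k by
    rw [buresExponent]; push_cast; ring, mul_inv_cancel_right₀ hG]

lemma meijerG11_comm (a₁ a₂ b₁ b₂ b₃ : ℝ) :
    meijerG11 a₁ a₂ b₁ b₂ b₃ = meijerG11 a₁ a₂ b₁ b₃ b₂ := by
  have h : meijerIntegrand ![a₁] ![a₂] ![b₁] ![b₂, b₃] =
      meijerIntegrand ![a₁] ![a₂] ![b₁] ![b₃, b₂] := by
    funext z s
    simp only [meijerIntegrand, Fin.prod_univ_two, Matrix.cons_val_zero, Matrix.cons_val_one]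
    rw [mul_comm (Complex.Gamma (1 - (b₂ : ℂ) + s))]
  have h2 : meijerIntegral ![a₁] ![a₂] ![b₁] ![b₂, b₃] =
      meijerIntegral ![a₁] ![a₂] ![b₁] ![b₃, b₂] := by
    funext z
    rw [meijerIntegral, meijerIntegral, h]
  funext z
  rw [meijerG11, meijerG11, meijerG, meijerG, h2]

end Polynomial
end

/-! ### Kernels with a characteristic polynomial in the numerator. -/

noncomputable section

section PowerIntegrals

/-- Since `Re w` is constant, `|t^w|` does not depend on `y`, and Fubini is dominated by a product.
-/
lemma integral_cpow_mul_swap {Y : Type*} [MeasurableSpace Y] {ν : Measure Y} [SFinite ν]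
    {F w : Y → ℂ} (hF : Integrable F ν) (hw : Measurable w) {ρ : ℝ} (hρ : ∀ y, (w y).re = ρ)
    {I : Set ℝ} (hI : MeasurableSet I) (hpos : I ⊆ Ioi 0)
    (hint : IntegrableOn (fun t : ℝ => t ^ ρ) I) :
    IntegrableOn (fun t : ℝ => ∫ y, (t : ℂ) ^ w y * F y ∂ν) I ∧
      ∫ t in I, ∫ y, (t : ℂ) ^ w y * F y ∂ν = ∫ y, (∫ t in I, (t : ℂ) ^ w y) * F y ∂ν := by
  have h : Integrable (Function.uncurry fun (t : ℝ) (y : Y) => (t : ℂ) ^ w y * F y)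
      ((volume.restrict I).prod ν) := by
    have hb : Integrable (fun p : ℝ × Y => p.1 ^ ρ * ‖F p.2‖) ((volume.restrict I).prod ν) :=
      Integrable.mul_prod hint hF.norm
    refine hb.mono' (AEStronglyMeasurable.mul (Measurable.aestronglyMeasurable (by fun_prop))
      hF.aestronglyMeasurable.comp_snd) ?_
    have : ∀ᵐ p ∂((volume.restrict I).prod ν), p.1 ∈ I :=
      Measure.quasiMeasurePreserving_fst.ae (ae_restrict_mem hI)
    filter_upwards [this] with p hp
    rw [Function.uncurry, norm_mul, Complex.norm_cpow_eq_rpow_re_of_pos (hpos hp), hρ]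
  refine ⟨h.integral_prod_left, ?_⟩
  rw [integral_integral_swap h]
  simp only [integral_mul_const]

lemma integrableOn_rpow_Ioc {ρ : ℝ} (hρ : -1 < ρ) : IntegrableOn (fun t : ℝ => t ^ ρ) (Ioc 0 1) :=
  (intervalIntegrable_iff_integrableOn_Ioc_of_le zero_le_one).1
    (intervalIntegral.intervalIntegrable_rpow' hρ)

lemma integral_cpow_Ioc {w : ℂ} (hw : -1 < w.re) : ∫ t in Ioc (0 : ℝ) 1, (t : ℂ) ^ w = (w + 1)⁻¹ := by
  have h0 : w + 1 ≠ 0 := fun h => by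
    have := congrArg Complex.re h
    simp at this
    linarith
  rw [← intervalIntegral.integral_of_le zero_le_one, integral_cpow (Or.inl hw)]
  simp [Complex.zero_cpow h0]

lemma integral_cpow_Ioi_one {w : ℂ} (hw : w.re < -1) :
    ∫ t in Ioi (1 : ℝ), (t : ℂ) ^ w = -(w + 1)⁻¹ := by
  rw [integral_Ioi_cpow_of_lt hw zero_lt_one]
  simp [neg_div]

lemma intervalIntegrable_cpow_mul {Y : Type*} [MeasurableSpace Y] {ν : Measure Y} [SFinite ν]
    {F w : Y → ℂ} (hF : Integrable F ν) (hw : Measurable w) {ρ : ℝ} (hρ : ∀ y, (w y).re = ρ)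
    (h : -1 < ρ) :
    IntegrableOn (fun t : ℝ => ∫ y, (t : ℂ) ^ w y * F y ∂ν) (Ioc 0 1) ∧
      ∫ t in Ioc (0 : ℝ) 1, ∫ y, (t : ℂ) ^ w y * F y ∂ν = ∫ y, (w y + 1)⁻¹ * F y ∂ν := by
  obtain ⟨h1, h2⟩ := integral_cpow_mul_swap hF hw hρ measurableSet_Ioc Ioc_subset_Ioi_self
    (integrableOn_rpow_Ioc h)
  refine ⟨h1, h2.trans (integral_congr_ae (Eventually.of_forall fun y => ?_))⟩
  simp only
  rw [integral_cpow_Ioc (by rwa [hρ])]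

lemma integrableOn_Ioi_cpow_mul {Y : Type*} [MeasurableSpace Y] {ν : Measure Y} [SFinite ν]
    {F w : Y → ℂ} (hF : Integrable F ν) (hw : Measurable w) {ρ : ℝ} (hρ : ∀ y, (w y).re = ρ)
    (h : ρ < -1) :
    IntegrableOn (fun t : ℝ => ∫ y, (t : ℂ) ^ w y * F y ∂ν) (Ioi 1) ∧
      ∫ t in Ioi (1 : ℝ), ∫ y, (t : ℂ) ^ w y * F y ∂ν = -∫ y, (w y + 1)⁻¹ * F y ∂ν := by
  obtain ⟨h1, h2⟩ := integral_cpow_mul_swap hF hw hρ measurableSet_Ioi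
    (Ioi_subset_Ioi zero_le_one) (integrableOn_Ioi_rpow_of_lt h zero_lt_one)
  refine ⟨h1, h2.trans ?_⟩
  rw [← integral_neg]
  refine integral_congr_ae (Eventually.of_forall fun y => ?_)
  simp only
  rw [integral_cpow_Ioi_one (by rwa [hρ]), neg_mul]

end PowerIntegrals

section NumeratorKernel

variable {a : ℝ}

lemma intervalIntegrable_finsetSum {ι : Type*} {s : Finset ι} {f : ι → ℝ → ℂ} {u v : ℝ}
    (h : ∀ i ∈ s, IntervalIntegrable (f i) volume u v) :
    IntervalIntegrable (fun t => ∑ i ∈ s, f i t) volume u v := by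
  simpa only [← Finset.sum_apply] using IntervalIntegrable.sum s h

/-- Only one function of each pair carries the exponent as a weight, so antisymmetrization produces
the difference of exponents; the power of `t` is such that integration over `(0,1)` produces the
inverse of their sum. -/
lemma kernelIntegrand02_succ (ha : -1 < a) (m : ℕ) (lam₁ lam₂ : ℂ) {t : ℝ} (ht : 0 < t) :
    kernelIntegrand02 (m + 1) a lam₁ lam₂ t = ∑ k : Fin (m + 1), ∑ l : Fin (m + 1),
      4 * (buresCoeff a k * buresCoeff a l * (buresExponent a k - buresExponent a l) *
        (lam₁ ^ (k : ℕ) * lam₂ ^ (l : ℕ))) *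
          (t : ℂ) ^ (buresExponent a k + buresExponent a l - 1) := by
  have ht' : (t : ℂ) ≠ 0 := by exact_mod_cast ht.ne'
  have e : ∀ k l : Fin (m + 1), (t : ℂ) ^ (buresExponent a k + buresExponent a l - 1) =
      ((t ^ (2 * a + 1) : ℝ) : ℂ) * ((t : ℂ) ^ (k : ℕ) * (t : ℂ) ^ (l : ℕ)) := fun k l => by
    rw [Complex.ofReal_cpow ht.le, ← Complex.cpow_natCast, ← Complex.cpow_natCast,
      ← Complex.cpow_add _ _ ht', ← Complex.cpow_add _ _ ht']
    congr 1
    simp only [buresExponent]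
    push_cast
    ring
  simp only [e]
  rw [kernelIntegrand02, meijerG11_succ_eq_sum_mul a ha, meijerG11_succ_eq_sum_mul a ha,
    meijerG11_succ_eq_sum a ha, meijerG11_succ_eq_sum a ha, Finset.sum_mul_sum,
    Finset.sum_mul_sum, Finset.sum_comm (s := Finset.univ (α := Fin (m + 1)))
      (f := fun i j => 2 * buresExponent a i * buresCoeff a i * (t * lam₂) ^ (i : ℕ) *
        (2 * buresCoeff a j * (t * lam₁) ^ (j : ℕ))), ← Finset.sum_sub_distrib, Finset.mul_sum]
  refine Finset.sum_congr rfl fun k _ => ?_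
  rw [← Finset.sum_sub_distrib, Finset.mul_sum]
  refine Finset.sum_congr rfl fun l _ => ?_
  simp only [mul_pow]
  ring

lemma intervalIntegrable_cpow_buresExponent (ha : -1 < a) {m : ℕ} (k l : Fin m) :
    IntervalIntegrable (fun t : ℝ => (t : ℂ) ^ (buresExponent a k + buresExponent a l - 1))
      volume 0 1 := by
  refine intervalIntegral.intervalIntegrable_cpow' ?_
  have h1 := buresExponent_re ha k
  have h2 := buresExponent_re ha l
  simp only [Complex.sub_re, Complex.add_re, Complex.one_re]
  linarith

lemma intervalIntegrable_kernelIntegrand02 (ha : -1 < a) (m : ℕ) (lam₁ lam₂ : ℂ) :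
    IntervalIntegrable (kernelIntegrand02 (m + 1) a lam₁ lam₂) volume 0 1 := by
  have h : IntervalIntegrable (fun t : ℝ => ∑ k : Fin (m + 1), ∑ l : Fin (m + 1),
      4 * (buresCoeff a k * buresCoeff a l * (buresExponent a k - buresExponent a l) *
        (lam₁ ^ (k : ℕ) * lam₂ ^ (l : ℕ))) *
          (t : ℂ) ^ (buresExponent a k + buresExponent a l - 1)) volume 0 1 :=
    intervalIntegrable_finsetSum fun k _ => intervalIntegrable_finsetSum fun l _ =>
      (intervalIntegrable_cpow_buresExponent ha k l).const_mul _
  refine h.congr fun t ht => ?_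
  rw [uIoc_of_le zero_le_one] at ht
  exact (kernelIntegrand02_succ ha m lam₁ lam₂ ht.1).symm

lemma integral_kernelIntegrand02 (ha : -1 < a) (m : ℕ) (lam₁ lam₂ : ℂ) :
    ∫ t in (0 : ℝ)..1, kernelIntegrand02 (m + 1) a lam₁ lam₂ t =
      -4 * ∑ k : Fin (m + 1), ∑ l : Fin (m + 1), buresCoeff a k * buresCoeff a l *
        schurRatio (buresExponent a k) (buresExponent a l) *
          (lam₁ ^ (k : ℕ) * lam₂ ^ (l : ℕ)) := by
  rw [intervalIntegral.integral_of_le zero_le_one, setIntegral_congr_fun measurableSet_Ioc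
    fun t ht => kernelIntegrand02_succ ha m lam₁ lam₂ ht.1,
    ← intervalIntegral.integral_of_le zero_le_one, intervalIntegral.integral_finsetSum
    fun k _ => intervalIntegrable_finsetSum fun l _ =>
      (intervalIntegrable_cpow_buresExponent ha k l).const_mul _, Finset.mul_sum]
  refine Finset.sum_congr rfl fun k _ => ?_
  rw [intervalIntegral.integral_finsetSum fun l _ =>
      (intervalIntegrable_cpow_buresExponent ha k l).const_mul _, Finset.mul_sum]
  refine Finset.sum_congr rfl fun l _ => ?_
  have h1 := buresExponent_re ha k
  have h2 := buresExponent_re ha l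
  rw [intervalIntegral.integral_const_mul, intervalIntegral.integral_of_le zero_le_one,
    integral_cpow_Ioc (by simp only [Complex.sub_re, Complex.add_re, Complex.one_re]; linarith),
    schurRatio, sub_add_cancel, div_eq_mul_inv, add_comm (buresExponent a l)]
  ring

end NumeratorKernel

section MixedKernel

variable {a c : ℝ}

lemma lineIntegral_add {f g : ℂ → ℂ} (hf : Integrable fun y : ℝ => f (c + y * Complex.I))
    (hg : Integrable fun y : ℝ => g (c + y * Complex.I)) :
    lineIntegral c (fun s => f s + g s) = lineIntegral c f + lineIntegral c g := by
  rw [lineIntegral, integral_add hf hg, mul_add, lineIntegral, lineIntegral]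

/-- Truncated Mellin transform of a Mellin–Barnes integral. -/
lemma integral_pow_mul_lineIntegral {f : ℂ → ℂ} (hf : Integrable fun y : ℝ => f (c + y * Complex.I))
    (hc : -1 < c) (k : ℕ) :
    IntegrableOn (fun t : ℝ => (t : ℂ) ^ k * lineIntegral c fun s => (t : ℂ) ^ s * f s) (Ioc 0 1) ∧
      ∫ t in Ioc (0 : ℝ) 1, (t : ℂ) ^ k * lineIntegral c (fun s => (t : ℂ) ^ s * f s) =
        lineIntegral c fun s => f s * (k + 1 + s)⁻¹ := by
  have hk : (0 : ℝ) ≤ k := Nat.cast_nonneg _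
  obtain ⟨h1, h2⟩ := intervalIntegrable_cpow_mul hf
    (w := fun y : ℝ => (k : ℂ) + (c + y * Complex.I)) (by fun_prop) (ρ := k + c) (by simp)
    (by linarith)
  have e : ∀ t ∈ Ioc (0 : ℝ) 1, (t : ℂ) ^ k * lineIntegral c (fun s => (t : ℂ) ^ s * f s) =
      (1 / (2 * Real.pi : ℂ)) * ∫ y : ℝ, (t : ℂ) ^ ((k : ℂ) + (c + y * Complex.I)) *
        f (c + y * Complex.I) := fun t ht => by
    have ht' : (t : ℂ) ≠ 0 := by exact_mod_cast ht.1.ne'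
    rw [← lineIntegral_const_mul, lineIntegral]
    refine congrArg _ (congrArg _ (funext fun y => ?_))
    rw [Complex.cpow_add (k : ℂ) _ ht', Complex.cpow_natCast, mul_assoc]
  refine ⟨(IntegrableOn.congr_fun (h1.const_mul _) (fun t ht => (e t ht).symm)
    measurableSet_Ioc), ?_⟩
  rw [setIntegral_congr_fun measurableSet_Ioc e, integral_const_mul, h2, lineIntegral]
  refine congrArg _ (congrArg _ (funext fun y => ?_))
  rw [mul_comm]
  congr 2
  ring

/-- From `a > -1` follows `a < 2a + 1`, so the poles starting at `2a + 1` impose no further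
restriction. -/
lemma lt_min_of_lt (ha : -1 < a) (h0 : c < 0) (hca : c < a) :
    c < min 0 (min a (2 * a + 1)) ∧ c < min 0 (min (a + 1) (2 * a + 1)) := by
  have h : c < 2 * a + 1 := by linarith
  exact ⟨lt_min h0 (lt_min hca h), lt_min h0 (lt_min (by linarith) h)⟩

lemma neg_succ_lt {M : ℕ} (h1 : -1 < c) : -(M + 1 : ℝ) < c := by
  have : (0 : ℝ) ≤ M := Nat.cast_nonneg _
  linarith

lemma kernelIntegrand11_zero (ha : -1 < a) (κ lam : ℂ) (t : ℝ) :
    kernelIntegrand11 0 a κ lam t = 0 := by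
  have h1 := meijerG11_zero a (a + 1) ha (t * lam)
  have h2 := meijerG11_zero a (a + 2) ha (t * lam)
  rw [show 1 - (a + 1) = -a by ring] at h1
  rw [show 1 - (a + 2) = -a - 1 by ring] at h2
  rw [kernelIntegrand11, h1, h2]
  ring

/-- The numerator of the inverse Schur ratio splits as `2a + 1 + k - s = (k + a + 1) + (a - s)`. The
first part is the weight in the first polynomial, the second turns `lineKernel` into
`lineKernelSucc`. -/
lemma kernelIntegrand11_succ (ha : -1 < a) (m : ℕ) {κ : ℂ} (hκ : ∀ x : ℝ, 0 ≤ x → κ ≠ x)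
    (lam : ℂ) (h1 : -1 < c) (h0 : c < 0) (hca : c < a) (hc2 : c < 2 * a + 1) {t : ℝ} (ht : 0 < t) :
    kernelIntegrand11 (m + 1) a κ lam t = ∑ k : Fin (m + 1),
      2 * (buresCoeff a k * lam ^ (k : ℕ)) * ((t : ℂ) ^ (k : ℕ) * lineIntegral c fun s =>
        (t : ℂ) ^ s * ((-κ) ^ s * (lineKernel (m + 1) a s * (2 * a + 1 + k - s)))) := by
  have hκ' := neg_mem_slitPlane hκ
  have hx := ofReal_mul_mem_slitPlane ht hκ'
  have hmin := lt_min hca hc2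
  have hmin' := lt_min (by linarith : c < a + 1) hc2
  rw [kernelIntegrand11, meijerG11_succ_eq_sum_mul a ha, meijerG11_succ_eq_sum a ha, ← mul_neg,
    meijerG31_lineKernel hx (neg_succ_lt h1) (lt_min h0 hmin),
    meijerG31_lineKernelSucc hx (neg_succ_lt h1) (lt_min h0 hmin'),
    Finset.sum_mul, Finset.sum_mul, ← Finset.sum_add_distrib]
  refine Finset.sum_congr rfl fun k _ => ?_
  have i1 := integrable_cpow_mul (stripDecay_lineKernel (m + 1) a) hx (neg_succ_lt h1)
    (lt_min h0 hmin)
  have i2 := integrable_cpow_mul (stripDecay_lineKernelSucc (m + 1) a) hx (neg_succ_lt h1)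
    (lt_min h0 hmin')
  have e : lineIntegral c (fun s => (t : ℂ) ^ s * ((-κ) ^ s *
      (lineKernel (m + 1) a s * (2 * a + 1 + k - s)))) =
      buresExponent a k * lineIntegral c (fun s => (t * -κ) ^ s * lineKernel (m + 1) a s) +
        lineIntegral c (fun s => (t * -κ) ^ s * lineKernelSucc (m + 1) a s) := by
    rw [← lineIntegral_const_mul, ← lineIntegral_add (i1.const_mul _) i2]
    refine lineIntegral_congr fun y => ?_
    have hre : ((c : ℂ) + y * Complex.I).re = c := by simp
    generalize (c : ℂ) + y * Complex.I = s at hre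
    rw [lineKernelSucc_eq fun h => by rw [← h] at hre; simp at hre; linarith,
      cpow_ofReal_mul ht (Complex.slitPlane_ne_zero hκ'), buresExponent]
    ring
  rw [e, mul_pow]
  ring

lemma integral_kernelIntegrand11 (ha : -1 < a) (m : ℕ) {κ : ℂ} (hκ : ∀ x : ℝ, 0 ≤ x → κ ≠ x)
    (lam : ℂ) (h1 : -1 < c) (h0 : c < 0) (hca : c < a) (hc2 : c < 2 * a + 1) :
    IntervalIntegrable (kernelIntegrand11 (m + 1) a κ lam) volume 0 1 ∧
      ∫ t in (0 : ℝ)..1, kernelIntegrand11 (m + 1) a κ lam t =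
        2 * ∑ k : Fin (m + 1), buresCoeff a k * lam ^ (k : ℕ) * lineIntegral c fun s =>
          (-κ) ^ s * (lineKernel (m + 1) a s * ((2 * a + 1 + k - s) / (k + 1 + s))) := by
  have hκ' := neg_mem_slitPlane hκ
  have hmin := lt_min hca hc2
  have key : ∀ k : Fin (m + 1), Integrable fun y : ℝ => (-κ) ^ ((c : ℂ) + y * Complex.I) *
      (lineKernel (m + 1) a (c + y * Complex.I) * (2 * a + 1 + k - (c + y * Complex.I))) := by
    intro k
    have h := (stripDecay_lineKernel (m + 1) a).mul (StripDecay.const_sub (2 * a + 1 + (k : ℕ)))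
    rw [add_zero] at h
    exact integrable_cpow_mul h hκ' (neg_succ_lt h1) (lt_min h0 hmin)
  have key2 := fun k : Fin (m + 1) => integral_pow_mul_lineIntegral
    (f := fun s => (-κ) ^ s * (lineKernel (m + 1) a s * (2 * a + 1 + (k : ℕ) - s))) (key k) h1 k
  have e := fun (t : ℝ) (ht : t ∈ Ioc (0 : ℝ) 1) =>
    kernelIntegrand11_succ ha m hκ lam h1 h0 hca hc2 ht.1
  constructor
  · rw [intervalIntegrable_iff_integrableOn_Ioc_of_le zero_le_one]
    refine IntegrableOn.congr_fun ?_ (fun t ht => (e t ht).symm) measurableSet_Ioc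
    exact integrable_finsetSum _ fun k _ => (key2 k).1.const_mul _
  · rw [intervalIntegral.integral_of_le zero_le_one, setIntegral_congr_fun measurableSet_Ioc e,
      integral_finsetSum _ fun k _ => (key2 k).1.const_mul _, Finset.mul_sum]
    refine Finset.sum_congr rfl fun k _ => ?_
    rw [integral_const_mul, (key2 k).2, mul_assoc]
    refine congrArg _ (congrArg _ (lineIntegral_congr fun y => ?_))
    ring

end MixedKernel
end

/-! ### The kernel with two characteristic polynomials in the denominator. -/

noncomputable section

/-- The product of Meijer G-functions whose antisymmetrization is the kernel with two
characteristic polynomials in the denominator. -/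
def meijerProduct (M : ℕ) (a : ℝ) (x₁ x₂ : ℂ) (t : ℝ) : ℂ :=
  (t : ℂ) ^ (-(2 * a + 1) : ℂ) * (meijerG31 (-M) (M + 2 * a + 1) 0 a (2 * a + 1) (t * x₁) *
    meijerG31 (-M) (M + 2 * a + 1) 0 (a + 1) (2 * a + 1) (t * x₂))

/-- The double Mellin transform of `meijerProduct` on the contours `Re s = c` and `Re s = c'`. -/
def meijerProductKernel (M : ℕ) (a : ℝ) (x₁ x₂ : ℂ) (c c' : ℝ) (p : ℝ × ℝ) : ℂ :=
  x₁ ^ ((c : ℂ) + p.1 * Complex.I) * lineKernel M a (c + p.1 * Complex.I) *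
    (x₂ ^ ((c' : ℂ) + p.2 * Complex.I) * lineKernelSucc M a (c' + p.2 * Complex.I))

section DenominatorKernel

variable {M : ℕ} {a c c' : ℝ} {x₁ x₂ : ℂ}

lemma lineIntegral_mul_lineIntegral (f g : ℂ → ℂ) :
    lineIntegral c f * lineIntegral c' g = (1 / (2 * Real.pi : ℂ)) ^ 2 *
      ∫ p : ℝ × ℝ, f (c + p.1 * Complex.I) * g (c' + p.2 * Complex.I) := by
  rw [lineIntegral, lineIntegral, Measure.volume_eq_prod,
    integral_prod_mul (fun y : ℝ => f (c + y * Complex.I)) fun y : ℝ => g (c' + y * Complex.I)]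
  ring

lemma lineIntegral_lineIntegral {H : ℂ → ℂ → ℂ}
    (hH : Integrable fun p : ℝ × ℝ => H (c + p.1 * Complex.I) (c' + p.2 * Complex.I)) :
    (lineIntegral c fun s => lineIntegral c' fun s' => H s s') = (1 / (2 * Real.pi : ℂ)) ^ 2 *
      ∫ p : ℝ × ℝ, H (c + p.1 * Complex.I) (c' + p.2 * Complex.I) := by
  rw [Measure.volume_eq_prod, integral_prod _ hH]
  simp only [lineIntegral, integral_const_mul]
  ring

lemma integrable_meijerProductKernel (hx₁ : x₁ ∈ Complex.slitPlane) (hx₂ : x₂ ∈ Complex.slitPlane)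
    (h1 : -1 < c) (h2 : c < min 0 (min a (2 * a + 1))) (h1' : -1 < c')
    (h2' : c' < min 0 (min (a + 1) (2 * a + 1))) :
    Integrable (meijerProductKernel M a x₁ x₂ c c') :=
  (integrable_cpow_mul (stripDecay_lineKernel M a) hx₁ (neg_succ_lt h1) h2).mul_prod
    (integrable_cpow_mul (stripDecay_lineKernelSucc M a) hx₂ (neg_succ_lt h1') h2')

lemma meijerProduct_eq_integral (hx₁ : x₁ ∈ Complex.slitPlane) (hx₂ : x₂ ∈ Complex.slitPlane)
    (h1 : -1 < c) (h2 : c < min 0 (min a (2 * a + 1))) (h1' : -1 < c')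
    (h2' : c' < min 0 (min (a + 1) (2 * a + 1))) {t : ℝ} (ht : 0 < t) :
    meijerProduct M a x₁ x₂ t = (1 / (2 * Real.pi : ℂ)) ^ 2 * ∫ p : ℝ × ℝ,
      (t : ℂ) ^ ((c + p.1 * Complex.I) + (c' + p.2 * Complex.I) - (2 * a + 1) : ℂ) *
        meijerProductKernel M a x₁ x₂ c c' p := by
  have ht' : (t : ℂ) ≠ 0 := by exact_mod_cast ht.ne'
  rw [meijerProduct, meijerG31_lineKernel (ofReal_mul_mem_slitPlane ht hx₁) (neg_succ_lt h1) h2,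
    meijerG31_lineKernelSucc (ofReal_mul_mem_slitPlane ht hx₂) (neg_succ_lt h1') h2',
    lineIntegral_mul_lineIntegral, mul_left_comm, ← integral_const_mul]
  refine congrArg _ (congrArg _ (funext fun p => ?_))
  rw [meijerProductKernel]
  generalize (c : ℂ) + p.1 * Complex.I = s
  generalize (c' : ℂ) + p.2 * Complex.I = s'
  rw [cpow_ofReal_mul ht (Complex.slitPlane_ne_zero hx₁),
    cpow_ofReal_mul ht (Complex.slitPlane_ne_zero hx₂), sub_eq_add_neg,
    Complex.cpow_add (s + s') _ ht', Complex.cpow_add s s' ht']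
  ring

lemma measurable_lineExponent (c c' a : ℝ) : Measurable fun p : ℝ × ℝ =>
    ((c + p.1 * Complex.I) + (c' + p.2 * Complex.I) - (2 * a + 1) : ℂ) := by fun_prop

lemma lineExponent_re (c c' a : ℝ) (p : ℝ × ℝ) :
    ((c + p.1 * Complex.I) + (c' + p.2 * Complex.I) - (2 * a + 1) : ℂ).re =
      c + c' - (2 * a + 1) := by simp

lemma lineExponent_add_one_ne_zero (h : c + c' ≠ 2 * a) (p : ℝ × ℝ) :
    ((c + p.1 * Complex.I) + (c' + p.2 * Complex.I) - (2 * a + 1) + 1 : ℂ) ≠ 0 := fun h0 => by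
  have := congrArg Complex.re h0
  rw [Complex.add_re, lineExponent_re] at this
  simp only [Complex.one_re, Complex.zero_re] at this
  exact h (by linarith)

/-- On the product of the two lines `s + s' - 2a` has constant nonzero real part, so its inverse is
bounded. -/
lemma integrable_inv_mul {F : ℝ × ℝ → ℂ} (hF : Integrable F) (h : c + c' ≠ 2 * a) :
    Integrable fun p : ℝ × ℝ =>
      ((c + p.1 * Complex.I) + (c' + p.2 * Complex.I) - (2 * a + 1) + 1 : ℂ)⁻¹ * F p := by
  refine hF.bdd_mul (c := |c + c' - 2 * a|⁻¹) (Measurable.aestronglyMeasurable (by fun_prop))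
    (Eventually.of_forall fun p => ?_)
  rw [norm_inv]
  refine inv_anti₀ (abs_pos.2 (sub_ne_zero.2 h)) ?_
  refine le_trans (le_of_eq ?_) (Complex.abs_re_le_norm _)
  rw [Complex.add_re, lineExponent_re, Complex.one_re]
  congr 1
  ring

lemma integral_meijerProduct_Ioi (hx₁ : x₁ ∈ Complex.slitPlane) (hx₂ : x₂ ∈ Complex.slitPlane)
    (h1 : -1 < c) (h2 : c < min 0 (min a (2 * a + 1))) (h1' : -1 < c')
    (h2' : c' < min 0 (min (a + 1) (2 * a + 1))) (h : c + c' < 2 * a) :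
    IntegrableOn (meijerProduct M a x₁ x₂) (Ioi 1) ∧
      ∫ t in Ioi (1 : ℝ), meijerProduct M a x₁ x₂ t = -((1 / (2 * Real.pi : ℂ)) ^ 2 *
        ∫ p : ℝ × ℝ, ((c + p.1 * Complex.I) + (c' + p.2 * Complex.I) - (2 * a + 1) + 1 : ℂ)⁻¹ *
          meijerProductKernel M a x₁ x₂ c c' p) := by
  obtain ⟨i1, i2⟩ := integrableOn_Ioi_cpow_mul
    (integrable_meijerProductKernel (M := M) hx₁ hx₂ h1 h2 h1' h2') (measurable_lineExponent c c' a)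
    (lineExponent_re c c' a) (by linarith)
  have e := fun (t : ℝ) (ht : t ∈ Ioi (1 : ℝ)) => meijerProduct_eq_integral (M := M) hx₁ hx₂ h1 h2
    h1' h2' (zero_lt_one.trans ht)
  refine ⟨IntegrableOn.congr_fun (i1.const_mul _) (fun t ht => (e t ht).symm) measurableSet_Ioi, ?_⟩
  rw [setIntegral_congr_fun measurableSet_Ioi e, integral_const_mul, i2, mul_neg]

/-- On the contours `Re (s + s') < 2a`, so `1/(2a - s - s')` is an integral of a power over `(1,∞)`.
Writing `s - s' = (a - s') - (a - s)` turns one of the two kernels into `lineKernelSucc` in each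
term. -/
lemma buresZ_two_zero_eq_integral (ha : -1 < a) (M : ℕ) {κ₁ κ₂ : ℂ}
    (hκ₁ : ∀ x : ℝ, 0 ≤ x → κ₁ ≠ x) (hκ₂ : ∀ x : ℝ, 0 ≤ x → κ₂ ≠ x) :
    (κ₁ - κ₂) * buresZ (M + 2) a ![κ₁, κ₂] ![] = buresZ M a ![] ![] *
      ((∫ t in Ioi (1 : ℝ), meijerProduct M a (-κ₁) (-κ₂) t) -
        ∫ t in Ioi (1 : ℝ), meijerProduct M a (-κ₂) (-κ₁) t) := by
  obtain ⟨c, h1, hc⟩ := exists_between (show (-1 : ℝ) < min 0 a from lt_min (by norm_num) ha)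
  obtain ⟨h0, hca⟩ := lt_min_iff.1 hc
  obtain ⟨h2, h2'⟩ := lt_min_of_lt ha h0 hca
  have hcc : c + c < 2 * a := by linarith
  have hx₁ := neg_mem_slitPlane hκ₁
  have hx₂ := neg_mem_slitPlane hκ₂
  have j1 := integrable_inv_mul
    (integrable_meijerProductKernel (M := M) hx₁ hx₂ h1 h2 h1 h2') hcc.ne
  have j2 : Integrable fun p : ℝ × ℝ =>
      ((c + p.2 * Complex.I) + (c + p.1 * Complex.I) - (2 * a + 1) + 1 : ℂ)⁻¹ *
        meijerProductKernel M a (-κ₂) (-κ₁) c c p.swap := (integrable_inv_mul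
    (integrable_meijerProductKernel (M := M) hx₂ hx₁ h1 h2 h1 h2') hcc.ne).swap
  rw [(integral_meijerProduct_Ioi hx₁ hx₂ h1 h2 h1 h2' hcc).2,
    (integral_meijerProduct_Ioi hx₂ hx₁ h1 h2 h1 h2' hcc).2,
    buresZ_two_zero_eq ha M hκ₁ hκ₂ h1 h0 hca, neg_sub_neg, ← mul_sub]
  congr 1
  have e : ∀ p : ℝ × ℝ, (-κ₁) ^ ((c : ℂ) + p.1 * Complex.I) *
      lineKernel M a (c + p.1 * Complex.I) * ((-κ₂) ^ ((c : ℂ) + p.2 * Complex.I) *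
      lineKernel M a (c + p.2 * Complex.I)) * (((c : ℂ) + p.1 * Complex.I -
        (c + p.2 * Complex.I)) / (2 * a - (c + p.1 * Complex.I) - (c + p.2 * Complex.I))) =
      ((c + p.2 * Complex.I) + (c + p.1 * Complex.I) - (2 * a + 1) + 1 : ℂ)⁻¹ *
        meijerProductKernel M a (-κ₂) (-κ₁) c c p.swap -
      ((c + p.1 * Complex.I) + (c + p.2 * Complex.I) - (2 * a + 1) + 1 : ℂ)⁻¹ *
        meijerProductKernel M a (-κ₁) (-κ₂) c c p := fun p => by
    have hn : ∀ y : ℝ, (a : ℂ) ≠ c + y * Complex.I := fun y h => by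
      have := congrArg Complex.re h
      simp at this
      linarith
    rw [meijerProductKernel, meijerProductKernel, Prod.fst_swap, Prod.snd_swap,
      lineKernelSucc_eq (hn _), lineKernelSucc_eq (hn _)]
    generalize (c : ℂ) + p.1 * Complex.I = s
    generalize (c : ℂ) + p.2 * Complex.I = s'
    rw [show (2 * a - s - s' : ℂ) = -(s + s' - (2 * a + 1) + 1) by ring, div_neg, add_comm s' s,
      div_eq_mul_inv]
    ring
  have hs := integral_prod_swap (μ := (volume : Measure ℝ)) (ν := volume) fun p : ℝ × ℝ =>
    ((c + p.1 * Complex.I) + (c + p.2 * Complex.I) - (2 * a + 1) + 1 : ℂ)⁻¹ *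
      meijerProductKernel M a (-κ₂) (-κ₁) c c p
  rw [← Measure.volume_eq_prod] at hs
  simp only [Prod.fst_swap, Prod.snd_swap] at hs
  rw [← hs, ← integral_sub j2 j1, lineIntegral_lineIntegral]
  · exact congrArg _ (integral_congr_ae (Eventually.of_forall e))
  · exact (j2.sub j1).congr (Eventually.of_forall fun p => (e p).symm)

/-- The Mellin transform that governs the difference of consecutive products. -/
def lineKernelQuot (f : ℂ → ℂ) (M : ℕ) (a : ℝ) (s : ℂ) : ℂ :=
  f s * (((2 * a + 1 + M : ℝ) : ℂ) - s)⁻¹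

lemma stripDecay_lineKernelQuot {f : ℂ → ℂ} {l r : ℝ} (hf : StripDecay l r Real.pi f) (M : ℕ)
    (hr : r ≤ 2 * a + 1) : StripDecay l r Real.pi (lineKernelQuot f M a) := by
  have hM : (0 : ℝ) ≤ M := Nat.cast_nonneg _
  have h := hf.mul (StripDecay.inv_const_sub (l := l) (c := 2 * a + 1 + M) (by linarith))
  rwa [add_zero] at h

lemma gamma_prod_succ (M : ℕ) (g : ℂ) {s : ℂ} (hs : -1 < s.re) :
    Complex.Gamma (-s) * Complex.Gamma (1 + (M + 1 : ℕ) + s) * g *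
        ∏ j ∈ Finset.range (M + 1), (((2 * a + 1 + j : ℝ) : ℂ) - s)⁻¹ =
      (Complex.Gamma (-s) * Complex.Gamma (1 + M + s) * g *
        ∏ j ∈ Finset.range M, (((2 * a + 1 + j : ℝ) : ℂ) - s)⁻¹) *
        (((2 * a + 1 + M : ℝ) : ℂ) - s)⁻¹ * (1 + M + s) := by
  have hM : (0 : ℝ) ≤ M := Nat.cast_nonneg _
  have h0 : (1 + M + s : ℂ) ≠ 0 := Complex.ne_zero_of_re_pos (by simp; linarith)
  rw [show (1 + (M + 1 : ℕ) + s : ℂ) = (1 + M + s) + 1 by push_cast; ring,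
    Complex.Gamma_add_one _ h0, Finset.prod_range_succ]
  ring

/-- Passing from `M` to `M + 1` multiplies each kernel by `(1+M+s)/(2a+1+M-s)`. The key is the
identity `(1+M+s)(1+M+s') - (2a+1+M-s)(2a+1+M-s') = 2(a+M+1)(s+s'-2a)`: it cancels the coupling
denominator, so the result factorizes and has no pole at `s + s' = 2a`. -/
lemma meijerProductKernel_succ_sub (M : ℕ) (h1 : -1 < c) (h2 : c < 2 * a + 1) (h1' : -1 < c')
    (h2' : c' < 2 * a + 1) (h : c + c' ≠ 2 * a) (p : ℝ × ℝ) :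
    ((c + p.1 * Complex.I) + (c' + p.2 * Complex.I) - (2 * a + 1) + 1 : ℂ)⁻¹ *
      (meijerProductKernel (M + 1) a x₁ x₂ c c' p - meijerProductKernel M a x₁ x₂ c c' p) =
      2 * (a + M + 1) * ((x₁ ^ ((c : ℂ) + p.1 * Complex.I) *
          lineKernelQuot (lineKernel M a) M a (c + p.1 * Complex.I)) *
        (x₂ ^ ((c' : ℂ) + p.2 * Complex.I) *
          lineKernelQuot (lineKernelSucc M a) M a (c' + p.2 * Complex.I))) := by
  have h3 := lineExponent_add_one_ne_zero h p
  have hM : (0 : ℝ) ≤ M := Nat.cast_nonneg _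
  have hs : ((c : ℂ) + p.1 * Complex.I).re = c := by simp
  have hs' : ((c' : ℂ) + p.2 * Complex.I).re = c' := by simp
  simp only [meijerProductKernel]
  generalize (c : ℂ) + p.1 * Complex.I = s at *
  generalize (c' : ℂ) + p.2 * Complex.I = s' at *
  have e1 : lineKernel (M + 1) a s = lineKernelQuot (lineKernel M a) M a s * (1 + M + s) :=
    gamma_prod_succ M _ (by rwa [hs])
  have e2 : lineKernelSucc (M + 1) a s' =
      lineKernelQuot (lineKernelSucc M a) M a s' * (1 + M + s') :=
    gamma_prod_succ M _ (by rwa [hs'])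
  have n1 : ((2 * a + 1 + M : ℝ) : ℂ) - s ≠ 0 := Complex.ne_zero_of_re_pos (by
    rw [Complex.sub_re, Complex.ofReal_re, hs]; linarith)
  have n2 : ((2 * a + 1 + M : ℝ) : ℂ) - s' ≠ 0 := Complex.ne_zero_of_re_pos (by
    rw [Complex.sub_re, Complex.ofReal_re, hs']; linarith)
  have e3 : lineKernel M a s = lineKernelQuot (lineKernel M a) M a s *
      (((2 * a + 1 + M : ℝ) : ℂ) - s) := by rw [lineKernelQuot, inv_mul_cancel_right₀ n1]
  have e4 : lineKernelSucc M a s' = lineKernelQuot (lineKernelSucc M a) M a s' *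
      (((2 * a + 1 + M : ℝ) : ℂ) - s') := by rw [lineKernelQuot, inv_mul_cancel_right₀ n2]
  generalize lineKernelQuot (lineKernel M a) M a s = q at *
  generalize lineKernelQuot (lineKernelSucc M a) M a s' = q' at *
  rw [inv_mul_eq_iff_eq_mul₀ h3, e1, e2, e3, e4]
  push_cast
  ring

lemma meijerProduct_succ_sub_eq (M : ℕ) (hx₁ : x₁ ∈ Complex.slitPlane)
    (hx₂ : x₂ ∈ Complex.slitPlane) (h1 : -1 < c) (h2 : c < min 0 (min a (2 * a + 1)))
    (h1' : -1 < c') (h2' : c' < min 0 (min (a + 1) (2 * a + 1))) {t : ℝ} (ht : 0 < t) :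
    meijerProduct (M + 1) a x₁ x₂ t - meijerProduct M a x₁ x₂ t =
      (1 / (2 * Real.pi : ℂ)) ^ 2 * ∫ p : ℝ × ℝ,
      (t : ℂ) ^ ((c + p.1 * Complex.I) + (c' + p.2 * Complex.I) - (2 * a + 1) : ℂ) *
        (meijerProductKernel (M + 1) a x₁ x₂ c c' p - meijerProductKernel M a x₁ x₂ c c' p) := by
  have key : ∀ N, Integrable fun p : ℝ × ℝ =>
      (t : ℂ) ^ ((c + p.1 * Complex.I) + (c' + p.2 * Complex.I) - (2 * a + 1) : ℂ) *
        meijerProductKernel N a x₁ x₂ c c' p := fun N => by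
    refine (integrable_meijerProductKernel hx₁ hx₂ h1 h2 h1' h2').bdd_mul
      (c := t ^ (c + c' - (2 * a + 1))) (Measurable.aestronglyMeasurable (by fun_prop))
      (Eventually.of_forall fun p => ?_)
    rw [Complex.norm_cpow_eq_rpow_re_of_pos ht, lineExponent_re]
  rw [meijerProduct_eq_integral hx₁ hx₂ h1 h2 h1' h2' ht,
    meijerProduct_eq_integral hx₁ hx₂ h1 h2 h1' h2' ht, ← mul_sub, ← integral_sub (key _) (key _)]
  simp only [mul_sub]

lemma integral_meijerProductKernel_succ_sub (M : ℕ) (h1 : -1 < c) (h2 : c < 2 * a + 1)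
    (h1' : -1 < c') (h2' : c' < 2 * a + 1) (h : c + c' ≠ 2 * a) :
    (1 / (2 * Real.pi : ℂ)) ^ 2 * (∫ p : ℝ × ℝ,
      ((c + p.1 * Complex.I) + (c' + p.2 * Complex.I) - (2 * a + 1) + 1 : ℂ)⁻¹ *
      (meijerProductKernel (M + 1) a x₁ x₂ c c' p - meijerProductKernel M a x₁ x₂ c c' p)) =
      2 * (a + M + 1) * (lineIntegral c (fun s => x₁ ^ s * lineKernelQuot (lineKernel M a) M a s) *
        lineIntegral c' fun s => x₂ ^ s * lineKernelQuot (lineKernelSucc M a) M a s) := by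
  rw [lineIntegral_mul_lineIntegral, mul_left_comm, ← integral_const_mul (2 * (a + M + 1) : ℂ)]
  exact congrArg _ (integral_congr_ae (Eventually.of_forall
    (meijerProductKernel_succ_sub M h1 h2 h1' h2' h)))

/-- The differences of consecutive products have total integral zero over `(0, ∞)`. -/
lemma integral_meijerProduct_succ_sub (ha : -1 < a) (ha0 : a < 0) (M : ℕ)
    (hx₁ : x₁ ∈ Complex.slitPlane) (hx₂ : x₂ ∈ Complex.slitPlane) :
    IntegrableOn (fun t => meijerProduct (M + 1) a x₁ x₂ t - meijerProduct M a x₁ x₂ t) (Ioc 0 1) ∧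
      ∫ t in Ioc (0 : ℝ) 1, (meijerProduct (M + 1) a x₁ x₂ t - meijerProduct M a x₁ x₂ t) =
      -((∫ t in Ioi (1 : ℝ), meijerProduct (M + 1) a x₁ x₂ t) -
        ∫ t in Ioi (1 : ℝ), meijerProduct M a x₁ x₂ t) := by
  -- For `-1 < a < 0` the strip of `lineKernelSucc` extends to `min 0 (2a + 1) = a + min (-a) (a +
  -- 1)`, beyond `a`. With both lines at distance `ε` from their right ends, the bound on `ε`
  -- ensures `c + d > 2a`, as needed for convergence at `t = 0`, while `c + c < 2a` serves the
  -- integral at infinity.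
  obtain ⟨ε, hε, hεm⟩ := exists_between (show (0 : ℝ) < min (-a) (a + 1) / 2 by
    have : 0 < min (-a) (a + 1) := lt_min (by linarith) (by linarith)
    linarith)
  have hm1 := min_le_left (-a) (a + 1)
  have hm2 := min_le_right (-a) (a + 1)
  obtain ⟨c, hc⟩ : ∃ c, c = a - ε := ⟨_, rfl⟩
  obtain ⟨d, hd⟩ : ∃ d, d = min 0 (2 * a + 1) - ε := ⟨_, rfl⟩
  have hmm : min 0 (2 * a + 1) = a + min (-a) (a + 1) := by
    simp only [min_def]; split_ifs <;> linarith
  have hn1 := min_le_left 0 (2 * a + 1)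
  have hn2 := min_le_right 0 (2 * a + 1)
  have c1 : -1 < c := by linarith
  obtain ⟨c2, c2'⟩ := lt_min_of_lt (c := c) ha (by linarith) (by linarith)
  have d1 : -1 < d := by linarith
  have d2 : d < min 0 (min (a + 1) (2 * a + 1)) :=
    lt_min (by linarith) (lt_min (by linarith) (by linarith))
  have hcd : 2 * a < c + d := by linarith
  have hcc : c + c < 2 * a := by linarith
  have r1 := (min_le_right 0 (min a (2 * a + 1))).trans (min_le_right _ _)
  have r2 := (min_le_right 0 (min (a + 1) (2 * a + 1))).trans (min_le_right _ _)
  have j1 := fun N => integrable_meijerProductKernel (M := N) hx₁ hx₂ c1 c2 d1 d2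
  have j2 := fun N => integrable_meijerProductKernel (M := N) hx₁ hx₂ c1 c2 c1 c2'
  obtain ⟨i1, i2⟩ := intervalIntegrable_cpow_mul ((j1 (M + 1)).sub (j1 M))
    (measurable_lineExponent c d a) (lineExponent_re c d a) (by linarith)
  have e := fun (t : ℝ) (ht : t ∈ Ioc (0 : ℝ) 1) =>
    meijerProduct_succ_sub_eq M hx₁ hx₂ c1 c2 d1 d2 ht.1
  refine ⟨IntegrableOn.congr_fun (i1.const_mul _) (fun t ht => (e t ht).symm) measurableSet_Ioc, ?_⟩
  rw [setIntegral_congr_fun measurableSet_Ioc e, integral_const_mul]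
  refine (congrArg _ i2).trans ?_
  rw [(integral_meijerProduct_Ioi hx₁ hx₂ c1 c2 c1 c2' hcc).2,
    (integral_meijerProduct_Ioi hx₁ hx₂ c1 c2 c1 c2' hcc).2, neg_sub_neg, neg_sub, ← mul_sub,
    ← integral_sub (integrable_inv_mul (j2 _) hcc.ne) (integrable_inv_mul (j2 _) hcc.ne)]
  simp only [← mul_sub]
  rw [integral_meijerProductKernel_succ_sub M c1 (by linarith) c1 (by linarith) hcc.ne]
  refine (integral_meijerProductKernel_succ_sub M c1 (by linarith) d1 (by linarith)
    hcd.ne').trans ?_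
  -- Once factorized, the second integral can be moved from `d` back to `c`, although this crosses
  -- `c + c' = 2a`.
  rw [lineIntegral_cpow_mul_eq (stripDecay_lineKernelQuot (stripDecay_lineKernelSucc M a) M r2) hx₂
    (neg_succ_lt d1) d2 (neg_succ_lt c1) c2']

/-- Telescoping in `M`. Only differences are integrated over `(0,1]`; subtracting the product for `M
= 0` is what makes this possible. -/
lemma integral_meijerProduct_sub_zero (ha : -1 < a) (ha0 : a < 0) (M : ℕ)
    (hx₁ : x₁ ∈ Complex.slitPlane) (hx₂ : x₂ ∈ Complex.slitPlane) :
    IntegrableOn (fun t => meijerProduct M a x₁ x₂ t - meijerProduct 0 a x₁ x₂ t) (Ioc 0 1) ∧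
      ∫ t in Ioc (0 : ℝ) 1, (meijerProduct M a x₁ x₂ t - meijerProduct 0 a x₁ x₂ t) =
      -((∫ t in Ioi (1 : ℝ), meijerProduct M a x₁ x₂ t) -
        ∫ t in Ioi (1 : ℝ), meijerProduct 0 a x₁ x₂ t) := by
  induction M with
  | zero => simp
  | succ M ih =>
    obtain ⟨h1, h2⟩ := integral_meijerProduct_succ_sub ha ha0 M hx₁ hx₂
    have e : (fun t => meijerProduct (M + 1) a x₁ x₂ t - meijerProduct 0 a x₁ x₂ t) =
        fun t => (meijerProduct (M + 1) a x₁ x₂ t - meijerProduct M a x₁ x₂ t) +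
          (meijerProduct M a x₁ x₂ t - meijerProduct 0 a x₁ x₂ t) := by
      funext t; ring
    rw [e]
    refine ⟨h1.add ih.1, ?_⟩
    rw [integral_add h1 ih.1, h2, ih.2]
    ring

/-- The powers released by the translations `a` and `a + 1` combine to `t^{-(2a+1)}` and the inverse
of the prefactor `(-κ₁)^a (-κ₂)^a`; the one remaining factor `-1/κ` cancels the explicit `κ` in the
kernel up to sign. -/
lemma kernelIntegrand20_eq (ha : -1 < a) (M : ℕ) {κ₁ κ₂ : ℂ} (hκ₁ : ∀ x : ℝ, 0 ≤ x → κ₁ ≠ x)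
    (hκ₂ : ∀ x : ℝ, 0 ≤ x → κ₂ ≠ x) {t : ℝ} (ht : 0 < t) :
    kernelIntegrand20 M a κ₁ κ₂ t = -((-κ₁) ^ (a : ℂ) * (-κ₂) ^ (a : ℂ))⁻¹ *
      (meijerProduct M a (-κ₁) (-κ₂) t - meijerProduct M a (-κ₂) (-κ₁) t) := by
  obtain ⟨c, h1, hc⟩ := exists_between (show (-1 : ℝ) < min 0 a from lt_min (by norm_num) ha)
  obtain ⟨h2, h2'⟩ := lt_min_of_lt ha (lt_min_iff.1 hc).1 (lt_min_iff.1 hc).2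
  have hx₁ := neg_mem_slitPlane hκ₁
  have hx₂ := neg_mem_slitPlane hκ₂
  have n1 : κ₁ ≠ 0 := by simpa using hκ₁ 0 le_rfl
  have n2 : κ₂ ≠ 0 := by simpa using hκ₂ 0 le_rfl
  have m1 := ofReal_mul_mem_slitPlane ht hx₁
  have m2 := ofReal_mul_mem_slitPlane ht hx₂
  have ht' : (t : ℂ) ≠ 0 := by exact_mod_cast ht.ne'
  have hl := neg_succ_lt (M := M) h1
  have e1 : ∀ κ : ℂ, κ ≠ 0 → (t * -κ) ^ (-a : ℂ) = (t : ℂ) ^ (-a : ℂ) * ((-κ) ^ (a : ℂ))⁻¹ :=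
    fun κ h => by rw [cpow_ofReal_mul ht (neg_ne_zero.2 h), Complex.cpow_neg (-κ)]
  have e2 : ∀ κ : ℂ, κ ≠ 0 → (t * -κ) ^ (-a - 1 : ℂ) =
      (t : ℂ) ^ (-a - 1 : ℂ) * ((-κ) ^ (a : ℂ))⁻¹ * (-κ⁻¹) :=
    fun κ h => by
      rw [cpow_ofReal_mul ht (neg_ne_zero.2 h), Complex.cpow_sub (-a : ℂ) 1 (neg_ne_zero.2 h),
        Complex.cpow_neg (-κ), Complex.cpow_one, div_eq_mul_inv, inv_neg, mul_assoc]
  have e3 : (t : ℂ) ^ (-(2 * a + 1) : ℂ) = (t : ℂ) ^ (-a : ℂ) * (t : ℂ) ^ (-a - 1 : ℂ) := by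
    rw [← Complex.cpow_add _ _ ht']
    congr 1
    ring
  rw [kernelIntegrand20, ← mul_neg, ← mul_neg, meijerG31_shift_lineKernel m1 hl h2,
    meijerG31_shift_lineKernel m2 hl h2, meijerG31_shift_lineKernelSucc m1 hl h2',
    meijerG31_shift_lineKernelSucc m2 hl h2', meijerProduct, meijerProduct,
    meijerG31_lineKernel m1 hl h2, meijerG31_lineKernel m2 hl h2,
    meijerG31_lineKernelSucc m1 hl h2', meijerG31_lineKernelSucc m2 hl h2', e1 κ₁ n1, e1 κ₂ n2,
    e2 κ₁ n1, e2 κ₂ n2, e3]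
  field_simp
  ring

lemma integrableOn_meijerProduct_Ioi (ha : -1 < a) (M : ℕ) (hx₁ : x₁ ∈ Complex.slitPlane)
    (hx₂ : x₂ ∈ Complex.slitPlane) : IntegrableOn (meijerProduct M a x₁ x₂) (Ioi 1) := by
  obtain ⟨c, h1, hc⟩ := exists_between (show (-1 : ℝ) < min 0 a from lt_min (by norm_num) ha)
  obtain ⟨h0, hca⟩ := lt_min_iff.1 hc
  obtain ⟨h2, h2'⟩ := lt_min_of_lt ha h0 hca
  exact (integral_meijerProduct_Ioi hx₁ hx₂ h1 h2 h1 h2' (by linarith)).1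

lemma cpow_mul_cpow_ne_zero (a : ℝ) {κ₁ κ₂ : ℂ} (hκ₁ : ∀ x : ℝ, 0 ≤ x → κ₁ ≠ x)
    (hκ₂ : ∀ x : ℝ, 0 ≤ x → κ₂ ≠ x) : (-κ₁) ^ (a : ℂ) * (-κ₂) ^ (a : ℂ) ≠ 0 := by
  have n1 : -κ₁ ≠ 0 := neg_ne_zero.2 (by simpa using hκ₁ 0 le_rfl)
  have n2 : -κ₂ ≠ 0 := neg_ne_zero.2 (by simpa using hκ₂ 0 le_rfl)
  exact mul_ne_zero (fun h => n1 (Complex.cpow_eq_zero_iff _ _ |>.1 h).1)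
    fun h => n2 (Complex.cpow_eq_zero_iff _ _ |>.1 h).1

lemma integral_kernelIntegrand20_Ioi (ha : -1 < a) (M : ℕ) {κ₁ κ₂ : ℂ}
    (hκ₁ : ∀ x : ℝ, 0 ≤ x → κ₁ ≠ x) (hκ₂ : ∀ x : ℝ, 0 ≤ x → κ₂ ≠ x) :
    IntegrableOn (kernelIntegrand20 M a κ₁ κ₂) (Ioi 1) ∧
      (-κ₁) ^ (a : ℂ) * (-κ₂) ^ (a : ℂ) * ∫ t in Ioi (1 : ℝ), kernelIntegrand20 M a κ₁ κ₂ t =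
        -((∫ t in Ioi (1 : ℝ), meijerProduct M a (-κ₁) (-κ₂) t) -
          ∫ t in Ioi (1 : ℝ), meijerProduct M a (-κ₂) (-κ₁) t) := by
  have e := fun (t : ℝ) (ht : t ∈ Ioi (1 : ℝ)) =>
    kernelIntegrand20_eq ha M hκ₁ hκ₂ (zero_lt_one.trans ht)
  have i1 := integrableOn_meijerProduct_Ioi ha M (neg_mem_slitPlane hκ₁) (neg_mem_slitPlane hκ₂)
  have i2 := integrableOn_meijerProduct_Ioi ha M (neg_mem_slitPlane hκ₂) (neg_mem_slitPlane hκ₁)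
  refine ⟨IntegrableOn.congr_fun ((i1.sub i2).const_mul _) (fun t ht => (e t ht).symm)
    measurableSet_Ioi, ?_⟩
  rw [setIntegral_congr_fun measurableSet_Ioi e, integral_const_mul, integral_sub i1 i2, neg_mul,
    mul_neg, mul_inv_cancel_left₀ (cpow_mul_cpow_ne_zero a hκ₁ hκ₂)]

lemma integral_kernelIntegrand20_sub (ha : -1 < a) (ha0 : a < 0) (M : ℕ) {κ₁ κ₂ : ℂ}
    (hκ₁ : ∀ x : ℝ, 0 ≤ x → κ₁ ≠ x) (hκ₂ : ∀ x : ℝ, 0 ≤ x → κ₂ ≠ x) :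
    IntervalIntegrable (fun t => kernelIntegrand20 M a κ₁ κ₂ t - kernelIntegrand20 0 a κ₁ κ₂ t)
      volume 0 1 ∧
      (-κ₁) ^ (a : ℂ) * (-κ₂) ^ (a : ℂ) * ∫ t in (0 : ℝ)..1,
        (kernelIntegrand20 M a κ₁ κ₂ t - kernelIntegrand20 0 a κ₁ κ₂ t) =
      ((∫ t in Ioi (1 : ℝ), meijerProduct M a (-κ₁) (-κ₂) t) -
          ∫ t in Ioi (1 : ℝ), meijerProduct M a (-κ₂) (-κ₁) t) -
        ((∫ t in Ioi (1 : ℝ), meijerProduct 0 a (-κ₁) (-κ₂) t) -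
          ∫ t in Ioi (1 : ℝ), meijerProduct 0 a (-κ₂) (-κ₁) t) := by
  have hx₁ := neg_mem_slitPlane hκ₁
  have hx₂ := neg_mem_slitPlane hκ₂
  have e : ∀ t ∈ Ioc (0 : ℝ) 1, kernelIntegrand20 M a κ₁ κ₂ t - kernelIntegrand20 0 a κ₁ κ₂ t =
      -((-κ₁) ^ (a : ℂ) * (-κ₂) ^ (a : ℂ))⁻¹ *
      ((meijerProduct M a (-κ₁) (-κ₂) t - meijerProduct 0 a (-κ₁) (-κ₂) t) -
        (meijerProduct M a (-κ₂) (-κ₁) t - meijerProduct 0 a (-κ₂) (-κ₁) t)) := fun t ht => by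
    rw [kernelIntegrand20_eq ha M hκ₁ hκ₂ ht.1, kernelIntegrand20_eq ha 0 hκ₁ hκ₂ ht.1]
    ring
  obtain ⟨i1, j1⟩ := integral_meijerProduct_sub_zero ha ha0 M hx₁ hx₂
  obtain ⟨i2, j2⟩ := integral_meijerProduct_sub_zero ha ha0 M hx₂ hx₁
  constructor
  · rw [intervalIntegrable_iff_integrableOn_Ioc_of_le zero_le_one]
    exact IntegrableOn.congr_fun ((i1.sub i2).const_mul _) (fun t ht => (e t ht).symm)
      measurableSet_Ioc
  · rw [intervalIntegral.integral_of_le zero_le_one, setIntegral_congr_fun measurableSet_Ioc e,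
      integral_const_mul, integral_sub i1 i2, j1, j2, neg_mul, mul_neg,
      mul_inv_cancel_left₀ (cpow_mul_cpow_ne_zero a hκ₁ hκ₂)]
    ring

lemma schurIntegral_fin_two (f : Fin 2 → ℝ → ℂ) :
    schurIntegral f = ∫ p : ℝ × ℝ, f 0 p.1 * f 1 p.2 * ((schurRatio p.1 p.2 : ℝ) : ℂ)
      ∂(posMeasure.prod posMeasure) := by
  rw [← (measurePreserving_finTwoArrow posMeasure).integral_comp', schurIntegral]
  refine integral_congr_ae (Eventually.of_forall fun z => ?_)
  have h : schurProd z = schurRatio (z 0) (z 1) := by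
    have := schurProd_cons (z 0) fun _ : Fin 1 => z 1
    have e : (Fin.cons (z 0) fun _ : Fin 1 => z 1 : Fin 2 → ℝ) = z := by
      funext i; fin_cases i <;> rfl
    rw [e] at this
    rw [this]
    simp [schurProd]
  simp only [h, Fin.prod_univ_two]
  rfl

lemma buresZ_two_two_zero (ha : -1 < a) {κ₁ κ₂ : ℂ} (hκ₁ : ∀ x : ℝ, 0 ≤ x → κ₁ ≠ x)
    (hκ₂ : ∀ x : ℝ, 0 ≤ x → κ₂ ≠ x) :
    (κ₁ - κ₂) * buresZ 2 a ![κ₁, κ₂] ![] = ∫ p in Ioi (0 : ℝ) ×ˢ Ioi (0 : ℝ),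
      (((p.1 * p.2) ^ a * (p.2 - p.1) * Real.exp (-p.1 - p.2) : ℝ) : ℂ) /
        ((κ₁ - p.1) * (κ₂ - p.2) * (p.1 + p.2)) := by
  rw [buresZ_two_zero ha 0 hκ₁ hκ₂, schurIntegral_fin_two, posMeasure, Measure.prod_restrict,
    ← Measure.volume_eq_prod]
  refine setIntegral_congr_fun (measurableSet_Ioi.prod measurableSet_Ioi) fun p hp => ?_
  obtain ⟨h1, h2⟩ : 0 < p.1 ∧ 0 < p.2 := hp
  simp only [Fin.cons_zero, Fin.cons_one, cauchyDensity, gammaDensity, schurRatio]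
  rw [add_sub_cancel_right, Real.mul_rpow h1.le h2.le, sub_eq_add_neg (-p.1), Real.exp_add]
  push_cast
  rw [Complex.ofReal_cpow h1.le, Complex.ofReal_cpow h2.le, ← neg_sub (p.1 : ℂ) κ₁,
    ← neg_sub (p.2 : ℂ) κ₂, neg_mul_neg, div_eq_mul_inv,
    div_eq_mul_inv, mul_inv, mul_inv, add_comm (p.2 : ℂ)]
  ring

end DenominatorKernel
end

/-! ### Normalization constants and assembly. -/

noncomputable section

section Normalization

variable {a : ℝ}

/-- The ratio of consecutive normalizations. -/
lemma buresZ_succ (ha : -1 < a) (M : ℕ) :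
    buresZ (M + 1) a ![] ![] = buresZ M a ![] ![] *
      ((Real.Gamma (M + a + 1) * M.factorial * Real.Gamma (M + 2 * a + 2) /
        Real.Gamma (2 * M + 2 * a + 2) : ℝ) : ℂ) := by
  have hM : (0 : ℝ) ≤ M := Nat.cast_nonneg _
  have hre : 0 < (M + 2 * a + 2 : ℂ).re := by simp; linarith
  have hG := Complex.Gamma_ne_zero_of_re_pos hre
  have h1 := Gamma_nat_add M (Complex.Gamma_ne_pole hre)
  have h2 : ∏ j ∈ Finset.range M, ((M : ℂ) + 2 * a + 2 + j) ≠ 0 := fun h => by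
    rw [h, zero_mul] at h1
    exact Complex.Gamma_ne_zero_of_re_pos (by simp; linarith) h1
  have h3 : ∏ j ∈ Finset.range M, ((M : ℂ) - j) = M.factorial := by
    rw [← Finset.prod_range_add_one_eq_factorial, ← Finset.prod_range_reflect]
    push_cast
    refine Finset.prod_congr rfl fun j hj => ?_
    have hj' := Finset.mem_range.1 hj
    rw [Nat.sub_sub, Nat.cast_sub (by omega)]
    push_cast
    ring
  -- The new exponent `M + a + 1` differs from the old ones by `M - i` and has sums `M + 2a + 2 + i`
  -- with them. The sign `(-1)^M` accounts for the last variable standing first in the ratios.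
  have h4 : (-1) ^ M * ∏ i : Fin M, schurRatio (buresExponent a (Fin.last M))
      (buresExponent a ((Fin.last M).succAbove i)) =
      M.factorial / ∏ j ∈ Finset.range M, ((M : ℂ) + 2 * a + 2 + j) := by
    rw [← h3, ← Finset.prod_div_distrib, Finset.prod_range, ← Fin.prod_const,
      ← Finset.prod_mul_distrib]
    refine Finset.prod_congr rfl fun i _ => ?_
    rw [schurRatio, Fin.succAbove_last, buresExponent, buresExponent, Fin.val_last, Fin.val_castSucc,
      ← neg_div_neg_eq, neg_div, neg_mul_neg, one_mul]
    rw [div_neg, ← neg_div]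
    congr 1 <;> ring
  have h5 : ((Fin.last M).removeNth fun i : Fin (M + 1) => buresExponent a i) =
      fun i : Fin M => buresExponent a i := by
    funext i
    rw [Fin.removeNth_apply, Fin.succAbove_last, buresExponent, buresExponent, Fin.val_castSucc]
  rw [buresZ_zero_zero ha, buresZ_zero_zero ha, schurProd_eq_removeNth _ (Fin.last M), Fin.val_last,
    h4, h5, Fin.prod_univ_castSucc]
  have h6 : Complex.Gamma (2 * M + 2 * a + 2) =
      (∏ j ∈ Finset.range M, ((M : ℂ) + 2 * a + 2 + j)) * Complex.Gamma (M + 2 * a + 2) := by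
    rw [← h1]
    congr 1
    ring
  have h7 : buresExponent a (Fin.last M) = M + a + 1 := by rw [buresExponent, Fin.val_last]
  have h8 : ∏ i : Fin M, Complex.Gamma (buresExponent a i.castSucc) =
      ∏ i : Fin M, Complex.Gamma (buresExponent a i) := rfl
  push_cast
  simp only [← Complex.Gamma_ofReal]
  push_cast
  rw [h6, h7, h8]
  generalize Complex.Gamma (M + 2 * a + 2) = g at hG ⊢
  generalize ∏ j ∈ Finset.range M, ((M : ℂ) + 2 * a + 2 + j) = p at h2 ⊢
  field_simp

/-- Legendre's duplication formula at `M + a + 1`. The factor `2` split off on the right is the one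
in the coefficients of `meijerG11_succ_eq_sum`. -/
lemma Gamma_duplication_div (ha : -1 < a) (M : ℕ) :
    Real.Gamma (2 * M + 2 * a + 2) / (Real.Gamma (M + a + 1) * M.factorial *
      Real.Gamma (M + 2 * a + 2)) = 2 * ((2 : ℝ) ^ (2 * (M + a)) * Real.Gamma (M + a + 3 / 2) /
        (Real.sqrt Real.pi * M.factorial * Real.Gamma (M + 2 * a + 2))) := by
  have hM : (0 : ℝ) ≤ M := Nat.cast_nonneg _
  have h := Real.Gamma_mul_Gamma_add_half (M + a + 1)
  have h1 : Real.Gamma (M + a + 1) ≠ 0 := (Real.Gamma_pos_of_pos (by linarith)).ne'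
  have h2 : Real.Gamma (M + 2 * a + 2) ≠ 0 := (Real.Gamma_pos_of_pos (by linarith)).ne'
  have h3 : Real.sqrt Real.pi ≠ 0 := (Real.sqrt_pos.2 Real.pi_pos).ne'
  have h4 : (M.factorial : ℝ) ≠ 0 := by exact_mod_cast M.factorial_ne_zero
  have h5 : (2 : ℝ) ^ (1 - 2 * (M + a + 1)) * 2 ^ (2 * (M + a)) = 1 / 2 := by
    rw [← Real.rpow_add two_pos, show (1 - 2 * (M + a + 1) + 2 * (M + a) : ℝ) = -1 by ring,
      Real.rpow_neg_one, one_div]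
  rw [show (M + a + 1 + 1 / 2 : ℝ) = M + a + 3 / 2 by ring,
    show (2 * (M + a + 1) : ℝ) = 2 * M + 2 * a + 2 by ring] at h
  rw [show (2 * (M + a + 1) : ℝ) = 2 * M + 2 * a + 2 by ring] at h5
  rw [div_eq_iff (mul_ne_zero (mul_ne_zero h1 h4) h2)]
  generalize Real.Gamma (M + a + 1) = g₁ at *
  generalize Real.Gamma (2 * M + 2 * a + 2) = g₂ at *
  generalize Real.Gamma (M + a + 3 / 2) = g₃ at *
  generalize Real.Gamma (M + 2 * a + 2) = g₄ at *
  generalize (2 : ℝ) ^ (2 * (M + a)) = v at *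
  field_simp
  linear_combination (-2 * v) * h - (2 * g₂ * Real.sqrt Real.pi) * h5

end Normalization

section Main

variable {a : ℝ}

lemma exists_abscissa (ha : -1 < a) : ∃ c : ℝ, -1 < c ∧ c < 0 ∧ c < a ∧ c < 2 * a + 1 := by
  obtain ⟨c, h1, hc⟩ := exists_between (show (-1 : ℝ) < min 0 a from lt_min (by norm_num) ha)
  obtain ⟨h0, hca⟩ := lt_min_iff.1 hc
  exact ⟨c, h1, h0, hca, by linarith⟩

lemma kernel_zero_two (ha : -1 < a) (m : ℕ) (lam₁ lam₂ : ℂ) :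
    (lam₁ - lam₂) * (buresZ m a ![] ![lam₁, lam₂] / buresZ (m + 2) a ![] ![]) =
      -(1 / 4) * ∫ t in (0 : ℝ)..1, kernelIntegrand02 (m + 2) a lam₁ lam₂ t := by
  rw [integral_kernelIntegrand02 ha (m + 1), ← mul_div_assoc, buresZ_zero_two_eq ha,
    mul_div_cancel_left₀ _ (buresZ_ne_zero ha _)]
  ring

lemma kernel_one_one (ha : -1 < a) (M : ℕ) {κ lam : ℂ} (hκ : ∀ x : ℝ, 0 ≤ x → κ ≠ x)
    (hne : κ ≠ lam) :
    IntervalIntegrable (kernelIntegrand11 M a κ lam) volume 0 1 ∧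
      1 / (κ - lam) * (buresZ M a ![κ] ![lam] / buresZ M a ![] ![]) =
        1 / (κ - lam) + 1 / 2 * ∫ t in (0 : ℝ)..1, kernelIntegrand11 M a κ lam t := by
  cases M with
  | zero =>
    have h : kernelIntegrand11 0 a κ lam = fun _ => 0 := funext (kernelIntegrand11_zero ha κ lam)
    rw [h, buresZ_of_isEmpty, buresZ_of_isEmpty]
    simp
  | succ m =>
    obtain ⟨c, h1, h0, hca, hc2⟩ := exists_abscissa ha
    obtain ⟨h, h'⟩ := integral_kernelIntegrand11 ha m hκ lam h1 h0 hca hc2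
    refine ⟨h, ?_⟩
    rw [h', ← mul_div_assoc, buresZ_one_one_eq ha hκ hne h1 h0 hca,
      mul_div_cancel_left₀ _ (buresZ_ne_zero ha _)]
    ring

lemma kernel_two_zero (ha : -1 < a) (M : ℕ) {κ₁ κ₂ : ℂ} (hκ₁ : ∀ x : ℝ, 0 ≤ x → κ₁ ≠ x)
    (hκ₂ : ∀ x : ℝ, 0 ≤ x → κ₂ ≠ x) :
    (κ₁ - κ₂) * (buresZ (M + 2) a ![κ₁, κ₂] ![] / buresZ M a ![] ![]) =
      (∫ t in Ioi (1 : ℝ), meijerProduct M a (-κ₁) (-κ₂) t) -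
        ∫ t in Ioi (1 : ℝ), meijerProduct M a (-κ₂) (-κ₁) t := by
  rw [← mul_div_assoc, buresZ_two_zero_eq_integral ha M hκ₁ hκ₂,
    mul_div_cancel_left₀ _ (buresZ_ne_zero ha _)]

lemma kernel_zero_one (ha : -1 < a) (m : ℕ) (lam : ℂ) :
    buresZ m a ![] ![lam] / buresZ (m + 2) a ![] ![] =
      (((2 : ℝ) ^ (2 * ((m + 1 : ℕ) + a)) * Real.Gamma ((m + 1 : ℕ) + a + 3 / 2) /
        (Real.sqrt Real.pi * (m + 1).factorial * Real.Gamma ((m + 1 : ℕ) + 2 * a + 2)) : ℝ) : ℂ) *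
        meijerG11 (-(m + 1 : ℕ) - 2 * a - 1) (m + 1 : ℕ) 0 (-2 * a - 1) (-a - 1) lam := by
  have h := Gamma_duplication_div ha (m + 1)
  have h1 := buresZ_succ ha (m + 1)
  rw [← inv_div, h] at h1
  rw [buresZ_zero_one_eq ha, h1, mul_div_mul_left _ _ (buresZ_ne_zero ha _), meijerG11_comm,
    show (-(m + 1 : ℕ) - 2 * a - 1 : ℝ) = -2 * a - (m + 1 : ℕ) - 1 by ring,
    meijerG11_succ_eq_sum a ha, Complex.ofReal_inv, div_inv_eq_mul, Finset.sum_mul, Finset.mul_sum]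
  refine Finset.sum_congr rfl fun k _ => ?_
  rw [Complex.ofReal_mul]
  push_cast
  ring

lemma kernel_one_zero (ha : -1 < a) (M : ℕ) {κ : ℂ} (hκ : ∀ x : ℝ, 0 ≤ x → κ ≠ x) :
    buresZ (M + 1) a ![κ] ![] / buresZ (M + 1) a ![] ![] =
      ((Real.Gamma (2 * M + 2 * a + 2) /
        (M.factorial * Real.Gamma (M + a + 1) * Real.Gamma (M + 2 * a + 2)) : ℝ) : ℂ) *
        meijerG31 (-M) (M + 2 * a + 1) 0 a (2 * a + 1) (-κ) := by
  obtain ⟨c, h1, h0, hca, hc2⟩ := exists_abscissa ha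
  rw [buresZ_one_zero_eq ha M hκ h1 h0 hca, buresZ_succ ha, meijerG31_lineKernel
    (neg_mem_slitPlane hκ) (neg_succ_lt h1) (lt_min h0 (lt_min hca hc2)),
    mul_div_mul_left _ _ (buresZ_ne_zero ha M), div_eq_inv_mul, ← Complex.ofReal_inv, inv_div,
    mul_comm (Real.Gamma (M + a + 1))]

end Main

end

theorem mainTheorem5 (a : ℝ) (ha : -1 < a) (M : ℕ) :
    -- two characteristic polynomials in the numerator
    (2 ≤ M → ∀ lam₁ lam₂ : ℂ,
      IntervalIntegrable (kernelIntegrand02 M a lam₁ lam₂) volume 0 1 ∧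
      (lam₁ - lam₂) * (buresZ (M - 2) a ![] ![lam₁, lam₂] / buresZ M a ![] ![])
        = -(1 / 4) * ∫ t in (0 : ℝ)..1, kernelIntegrand02 M a lam₁ lam₂ t) ∧
    -- one characteristic polynomial in the numerator, one in the denominator
    (∀ κ lam : ℂ, (∀ x : ℝ, 0 ≤ x → κ ≠ x) → κ ≠ lam →
      IntervalIntegrable (kernelIntegrand11 M a κ lam) volume 0 1 ∧
      1 / (κ - lam) * (buresZ M a ![κ] ![lam] / buresZ M a ![] ![])
        = 1 / (κ - lam) + 1 / 2 * ∫ t in (0 : ℝ)..1, kernelIntegrand11 M a κ lam t) ∧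
    -- two characteristic polynomials in the denominator, integral over `[0, 1]`
    (a < 0 → ∀ κ₁ κ₂ : ℂ, (∀ x : ℝ, 0 ≤ x → κ₁ ≠ x) → (∀ x : ℝ, 0 ≤ x → κ₂ ≠ x) →
      IntervalIntegrable
        (fun t => kernelIntegrand20 M a κ₁ κ₂ t - kernelIntegrand20 0 a κ₁ κ₂ t) volume 0 1 ∧
      (κ₁ - κ₂) * (buresZ (M + 2) a ![κ₁, κ₂] ![] / buresZ M a ![] ![])
        = (∫ p in Ioi (0 : ℝ) ×ˢ Ioi (0 : ℝ),
            (((p.1 * p.2) ^ a * (p.2 - p.1) * Real.exp (-p.1 - p.2) : ℝ) : ℂ) /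
              ((κ₁ - p.1) * (κ₂ - p.2) * (p.1 + p.2)))
          + (-κ₁) ^ (a : ℂ) * (-κ₂) ^ (a : ℂ) *
            ∫ t in (0 : ℝ)..1, (kernelIntegrand20 M a κ₁ κ₂ t - kernelIntegrand20 0 a κ₁ κ₂ t)) ∧
    -- the same kernel for every `a > -1`, integral over `[1, ∞)`
    (∀ κ₁ κ₂ : ℂ, (∀ x : ℝ, 0 ≤ x → κ₁ ≠ x) → (∀ x : ℝ, 0 ≤ x → κ₂ ≠ x) →
      IntegrableOn (kernelIntegrand20 M a κ₁ κ₂) (Ioi 1) volume ∧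
      (κ₁ - κ₂) * (buresZ (M + 2) a ![κ₁, κ₂] ![] / buresZ M a ![] ![])
        = -((-κ₁) ^ (a : ℂ) * (-κ₂) ^ (a : ℂ) *
            ∫ t in Ioi (1 : ℝ), kernelIntegrand20 M a κ₁ κ₂ t)) ∧
    -- one characteristic polynomial in the numerator
    (1 ≤ M → ∀ lam : ℂ,
      buresZ (M - 1) a ![] ![lam] / buresZ (M + 1) a ![] ![]
        = (((2 : ℝ) ^ (2 * (M + a)) * Real.Gamma (M + a + 3 / 2) /
              (Real.sqrt Real.pi * M.factorial * Real.Gamma (M + 2 * a + 2)) : ℝ) : ℂ) *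
            meijerG11 (-M - 2 * a - 1) M 0 (-2 * a - 1) (-a - 1) lam) ∧
    -- one characteristic polynomial in the denominator
    (∀ κ : ℂ, (∀ x : ℝ, 0 ≤ x → κ ≠ x) →
      buresZ (M + 1) a ![κ] ![] / buresZ (M + 1) a ![] ![]
        = ((Real.Gamma (2 * M + 2 * a + 2) /
              (M.factorial * Real.Gamma (M + a + 1) * Real.Gamma (M + 2 * a + 2)) : ℝ) : ℂ) *
            meijerG31 (-M) (M + 2 * a + 1) 0 a (2 * a + 1) (-κ)) := by
  refine ⟨fun hM lam₁ lam₂ => ?_, fun κ lam hκ hne => kernel_one_one ha M hκ hne,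
    fun ha0 κ₁ κ₂ hκ₁ hκ₂ => ?_, fun κ₁ κ₂ hκ₁ hκ₂ => ?_, fun hM lam => ?_,
    fun κ hκ => kernel_one_zero ha M hκ⟩
  · obtain ⟨m, rfl⟩ := Nat.exists_eq_add_of_le' hM
    exact ⟨intervalIntegrable_kernelIntegrand02 ha (m + 1) lam₁ lam₂, kernel_zero_two ha m lam₁ lam₂⟩
  · obtain ⟨h1, h2⟩ := integral_kernelIntegrand20_sub ha ha0 M hκ₁ hκ₂
    refine ⟨h1, ?_⟩
    -- The subtracted `M = 0` term is the two-particle partition function, since the empty partition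
    -- function is `1`; this is the explicit double integral.
    have h0 := kernel_two_zero ha 0 hκ₁ hκ₂
    rw [buresZ_of_isEmpty, div_one, zero_add, buresZ_two_two_zero ha hκ₁ hκ₂] at h0
    rw [kernel_two_zero ha M hκ₁ hκ₂, h2, h0]
    ring
  · obtain ⟨h1, h2⟩ := integral_kernelIntegrand20_Ioi ha M hκ₁ hκ₂
    rw [kernel_two_zero ha M hκ₁ hκ₂, h2, neg_neg]
    exact ⟨h1, rfl⟩
  · obtain ⟨m, rfl⟩ := Nat.exists_eq_add_of_le' hM
    exact kernel_zero_one ha m lam
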